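/- Let $M$ be a compact smooth manifold. Its cone is $C(M)=M\times\mathbb{R}^{>0}$, with coordinate $t$ on $\mathbb{R}^{>0}$ and dilations $h_\lambda(x,t)=(x,\lambda t)$, $\lambda>0$. A Sasakian structure on $M$ is a Riemannian metric $g_M$ on $M$ together with a Kähler structure $(g,I,\omega)$ on $C(M)$ such that $g=t^2g_M+dt\otimes dt$, $\omega=g(\cdot,I\cdot)$, $I$ is invariant under all $h_\lambda$, and $h_\lambda^*\omega=\lambda^2\omega$. A non-trivial holomorphic homothety of $C(M)$ is a holomorphic diffeomorphism $q:C(M)\to C(M)$ with $q^*g=c^2g$ for a constant $c>0$, $c\neq 1$. Let $V$ be a compact complex manifold. A presentation $V=C(M)/\langle q\rangle$ consists of a compact manifold $M$ with a Sasakian structure, a non-trivial holomorphic homothety $q$ of $C(M)$, and a biholomorphism of $C(M)/\langle q\rangle$ with $V$, that is, a surjective holomorphic local diffeomorphism $\pi:C(M)\to V$ whose fibres are exactly the orbits of the group $\langle q\rangle=\{q^k: k\in\mathbb{Z}\}$. (The complex manifolds which have such a presentation are the compact Vaisman manifolds.) **Proposition.** For every presentation $V=C(M)/\langle q\rangle$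 the form $dd^c\log t$ on $C(M)$ (where $d^cf=df\circ I$) descends to $V$: there is a unique $2$-form $\omega_0$ on $V$ with $\pi^*\omega_0=dd^c\log t$. Put $\Sigma=\ker\omega_0\subset TV$, that is, $\Sigma_y=\{u\in T_yV:\ \omega_0(u,v)=0 \text{ for all } v\in T_yV\}$ (the canonical foliation of $V$). Then $\Sigma$ does not depend on the choice of the cone $C(M)$ and of the homothety $q$: if $V=C(M)/\langle q\rangle$ and $V=C(M')/\langle q'\rangle$ are two presentations of the same compact complex manifold $V$, with corresponding forms $\omega_0$ and $\omega_0'$ on $V$, then $\ker\omega_0=\ker\omega_0'$ at every point of $V$. -/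

import Mathlib

open scoped Manifold ContDiff

noncomputable section

namespace Vaisman

/-! ### Differential forms and complex structures on smooth manifolds -/

section General

variable {E : Type*} [NormedAddCommGroup E] [NormedSpace ℝ E]
  {H : Type*} [TopologicalSpace H] (I : ModelWithCorners ℝ E H)
  {M : Type*} [TopologicalSpace M] [ChartedSpace H M]
  {E' : Type*} [NormedAddCommGroup E'] [NormedSpace ℝ E']
  {H' : Type*} [TopologicalSpace H'] (I' : ModelWithCorners ℝ E' H')
  {N : Type*} [TopologicalSpace N] [ChartedSpace H' N]

/-- A (not necessarily smooth) real differential `k`-form on the manifold `M`. -/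
abbrev Form (M : Type*) [TopologicalSpace M] [ChartedSpace H M] (k : ℕ) : Type _ :=
  ∀ x : M, TangentSpace I x [⋀^Fin k]→L[ℝ] ℝ

/-- The pullback `f^* α` of a form along a map `f : M → N`, that is
`(f^* α)_x (v₁, …, v_k) = α_{f x} (df v₁, …, df v_k)`. -/
def Form.pullback {k : ℕ} (f : M → N) (α : Form I' N k) : Form I M k := fun x =>
  (α (f x)).compContinuousLinearMap (mfderiv I I' f x)

/-- The expression of a form on `M` in the preferred chart around `x₀`: a form on the model
space `E`, the pullback under the inverse of the chart. -/
def Form.inChart {k : ℕ} (α : Form I M k) (x₀ : M) : E → E [⋀^Fin k]→L[ℝ] ℝ := fun z =>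
  (α ((extChartAt I x₀).symm z)).compContinuousLinearMap
    (mfderivWithin 𝓘(ℝ, E) I (extChartAt I x₀).symm (Set.range I) z)

/-- The exterior derivative `dα` of a form on a manifold, computed in the chart around each
point. -/
def Form.d {k : ℕ} (α : Form I M k) : Form I M (k + 1) := fun x₀ =>
  (extDerivWithin (Form.inChart I α x₀) (Set.range I)
    (extChartAt I x₀ x₀)).compContinuousLinearMap
      (mfderiv I 𝓘(ℝ, E) (extChartAt I x₀) x₀)

/-- The kernel of a `2`-form on `M`, as a distribution: at each `x` the subspace of all
`u ∈ T_x M` with `α_x (u, v) = 0` for all `v ∈ T_x M`. -/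
def Form.ker (α : Form I M 2) (x : M) : Submodule ℝ (TangentSpace I x) :=
  LinearMap.ker (α x).toAlternatingMap.curryLeft

/-- A field of endomorphisms of the tangent bundle of `M`. -/
abbrev EndField (M : Type*) [TopologicalSpace M] [ChartedSpace H M] : Type _ :=
  ∀ x : M, TangentSpace I x →L[ℝ] TangentSpace I x

/-- `J` is a complex structure on the smooth manifold `M`: a smooth field of endomorphisms of
the tangent bundle with `J² = -1` and with vanishing Nijenhuis tensor (that is,
`[T^{1,0}, T^{1,0}] ⊆ T^{1,0}`). -/
structure IsComplexStructure [IsManifold I ∞ M] (J : EndField I M) : Prop where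
  smooth : ContMDiff I (I.prod 𝓘(ℝ, E →L[ℝ] E)) ∞
    (fun x => Bundle.TotalSpace.mk' (E →L[ℝ] E)
      (E := fun x : M => TangentSpace I x →L[ℝ] TangentSpace I x) x (J x))
  sq_eq_neg : ∀ (x : M) (v : TangentSpace I x), J x (J x v) = -v
  integrable : ∀ X Y : (∀ x : M, TangentSpace I x),
    ContMDiff I I.tangent ∞ (fun x => (⟨x, X x⟩ : TangentBundle I M)) →
    ContMDiff I I.tangent ∞ (fun x => (⟨x, Y x⟩ : TangentBundle I M)) →
    ∀ x : M,
      VectorField.mlieBracket I (fun y => J y (X y)) (fun y => J y (Y y)) x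
        = VectorField.mlieBracket I X Y x
          + J x (VectorField.mlieBracket I (fun y => J y (X y)) Y x)
          + J x (VectorField.mlieBracket I X (fun y => J y (Y y)) x)

/-- The differential `1`-form `d^c f = I d I⁻¹ f = df ∘ J` of a function `f`. -/
def dc (J : EndField I M) (f : M → ℝ) : Form I M 1 := fun x =>
  ContinuousAlternatingMap.ofSubsingleton ℝ (TangentSpace I x) ℝ (0 : Fin 1)
    ((show TangentSpace I x →L[ℝ] ℝ from mfderiv I 𝓘(ℝ, ℝ) f x).comp (J x))

/-- The `2`-form `dd^c f`. -/
def ddc (J : EndField I M) (f : M → ℝ) : Form I M 2 := Form.d I (dc I J f)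

/-- A field of (real-valued) pairings of tangent vectors, such as a Riemannian metric. -/
abbrev PairingField (M : Type*) [TopologicalSpace M] [ChartedSpace H M] : Type _ :=
  ∀ x : M, TangentSpace I x → TangentSpace I x → ℝ

/-- `(g, J, Ω)` is a Kähler structure, for `g` a Riemannian metric on `M`: `J` is a complex
structure, `g` is Hermitian, and `Ω = g(·, J ·)` is closed. -/
structure IsKaehler [IsManifold I ∞ M] (g : PairingField I M) (J : EndField I M)
    (Ω : Form I M 2) : Prop where
  complex : IsComplexStructure I J
  hermitian : ∀ (x : M) (u v : TangentSpace I x), g x (J x u) (J x v) = g x u v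
  form_eq : ∀ (x : M) (u v : TangentSpace I x), Ω x ![u, v] = g x u (J x v)
  closed : ∀ x : M, Form.d I Ω x = 0

/-- The map `f : (M, J) → (N, J')` is holomorphic: smooth with `df ∘ J = J' ∘ df`. -/
structure IsHolomorphic (J : EndField I M) (J' : EndField I' N) (f : M → N) : Prop where
  smooth : ContMDiff I I' ∞ f
  commutes : ∀ (x : M) (v : TangentSpace I x),
    mfderiv I I' f x (J x v) = J' (f x) (mfderiv I I' f x v)

end General

/-- Multiplication by `i` on the tangent spaces of a complex manifold `V` modelled on `ℂⁿ`,
considered as a field of endomorphisms of the real tangent bundle. -/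
def complexManifoldJ (n : ℕ) (V : Type*) [TopologicalSpace V]
    [ChartedSpace (EuclideanSpace ℂ (Fin n)) V] :
    EndField 𝓘(ℝ, EuclideanSpace ℂ (Fin n)) V := fun _ =>
  (Complex.I • ContinuousLinearMap.id ℝ (EuclideanSpace ℂ (Fin n)) :
    EuclideanSpace ℂ (Fin n) →L[ℝ] EuclideanSpace ℂ (Fin n))

/-! ### Cones and Sasakian manifolds -/

/-- The open half-line `ℝ^{>0}`, with its structure of open submanifold of `ℝ`. -/
def PosReal : TopologicalSpace.Opens ℝ := ⟨Set.Ioi 0, isOpen_Ioi⟩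

/-- The cone `C(M) = M × ℝ^{>0}`. -/
abbrev Cone (M : Type*) : Type _ := M × PosReal

/-- The model with corners of the cone over an `m`-dimensional manifold. -/
abbrev coneModel (m : ℕ) : ModelWithCorners ℝ (EuclideanSpace ℝ (Fin m) × ℝ)
    (ModelProd (EuclideanSpace ℝ (Fin m)) ℝ) :=
  (𝓡 m).prod 𝓘(ℝ, ℝ)

/-- The coordinate `t : C(M) → ℝ` on the cone. -/
def coneT {M : Type*} (p : Cone M) : ℝ := p.2

/-- The differential `dt` of the coordinate on the cone, as a real-valued functional on each
tangent space. -/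
def coneDt {m : ℕ} {M : Type*} [TopologicalSpace M] [ChartedSpace (EuclideanSpace ℝ (Fin m)) M]
    (p : Cone M) : TangentSpace (coneModel m) p →L[ℝ] ℝ :=
  mfderiv (coneModel m) 𝓘(ℝ, ℝ) (coneT : Cone M → ℝ) p

/-- The dilation `h_l (x, t) = (x, l t)` of the cone, for `l > 0`. -/
def dilation {M : Type*} (l : PosReal) (p : Cone M) : Cone M :=
  (p.1, ⟨(l : ℝ) * (p.2 : ℝ), mul_pos (Set.mem_Ioi.mp l.2) (Set.mem_Ioi.mp p.2.2)⟩)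

section Sasakian

variable (m : ℕ) (M : Type*) [TopologicalSpace M] [ChartedSpace (EuclideanSpace ℝ (Fin m)) M]
  [IsManifold (𝓡 m) ∞ M]

/-- A smooth Riemannian metric on `M`. -/
abbrev SmoothMetric : Type _ :=
  Bundle.ContMDiffRiemannianMetric (𝓡 m) ∞ (EuclideanSpace ℝ (Fin m))
    (fun x : M => TangentSpace (𝓡 m) x)

variable {m M}

/-- The metric `t² g_M + dt ⊗ dt` on the cone of the Riemannian manifold `(M, g_M)`. -/
def coneMetric (gM : SmoothMetric m M) : PairingField (coneModel m) (Cone M) := fun p u v =>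
  coneT p ^ 2 *
      gM.inner p.1 (mfderiv (coneModel m) (𝓡 m) (Prod.fst : Cone M → M) p u)
        (mfderiv (coneModel m) (𝓡 m) (Prod.fst : Cone M → M) p v)
    + coneDt p u * coneDt p v

variable (m M)

/-- A Sasakian manifold: a Riemannian metric on `M` together with a Kähler structure
`(g, J, Ω)` on its Riemannian cone `(C(M), g = t² g_M + dt ⊗ dt)` such that `J` is invariant
under all dilations and `h_l^* Ω = l² Ω`. -/
structure SasakianStructure where
  /-- the metric on `M` -/
  metric : SmoothMetric m M
  /-- the complex structure on the cone -/
  J : EndField (coneModel m) (Cone M)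
  /-- the Kähler form of the cone -/
  Ω : Form (coneModel m) (Cone M) 2
  kaehler : IsKaehler (coneModel m) (coneMetric metric) J Ω
  J_invariant : ∀ (l : PosReal) (p : Cone M) (v : TangentSpace (coneModel m) p),
    mfderiv (coneModel m) (coneModel m) (dilation l) p (J p v)
      = J (dilation l p) (mfderiv (coneModel m) (coneModel m) (dilation l) p v)
  Ω_automorphic : ∀ l : PosReal,
    Form.pullback (coneModel m) (coneModel m) (dilation l : Cone M → Cone M) Ω
      = fun p => (l : ℝ) ^ 2 • Ω p

variable {m M}

/-- The form `ω₀ = dd^c log t` on the cone of a Sasakian manifold. -/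
def SasakianStructure.coneOmegaZero (S : SasakianStructure m M) :
    Form (coneModel m) (Cone M) 2 :=
  ddc (coneModel m) S.J (fun p => Real.log (coneT p))

/-- `q` is a non-trivial holomorphic homothety of the cone: a holomorphic diffeomorphism which
multiplies the cone metric by a constant `c² ≠ 1`. -/
structure SasakianStructure.IsHolomorphicHomothety (S : SasakianStructure m M)
    (q : Diffeomorph (coneModel m) (coneModel m) (Cone M) (Cone M) ∞) : Prop where
  holomorphic : IsHolomorphic (coneModel m) (coneModel m) S.J S.J q
  homothety : ∃ c : ℝ, 0 < c ∧ c ≠ 1 ∧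
    ∀ (p : Cone M) (u v : TangentSpace (coneModel m) p),
      coneMetric S.metric (q p) (mfderiv (coneModel m) (coneModel m) q p u)
          (mfderiv (coneModel m) (coneModel m) q p v)
        = c ^ 2 * coneMetric S.metric p u v

end Sasakian

/-! ### Vaisman manifolds as quotients of cones -/

/-- A presentation of the complex manifold `V` as the quotient `C(M)/⟨q⟩` of the Kähler cone of a
Sasakian structure on `M` by the group generated by a non-trivial holomorphic homothety `q`.
The identification of `V` with the quotient is given by the projection `π : C(M) → V`: a
holomorphic, surjective local diffeomorphism whose fibres are the orbits of `⟨q⟩`. -/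
structure ConePresentation (m : ℕ) (M : Type*) [TopologicalSpace M]
    [ChartedSpace (EuclideanSpace ℝ (Fin m)) M] [IsManifold (𝓡 m) ∞ M]
    (n : ℕ) (V : Type*) [TopologicalSpace V] [ChartedSpace (EuclideanSpace ℂ (Fin n)) V] where
  /-- the Sasakian structure on `M` -/
  sasakian : SasakianStructure m M
  /-- the homothety -/
  q : Diffeomorph (coneModel m) (coneModel m) (Cone M) (Cone M) ∞
  isHomothety : sasakian.IsHolomorphicHomothety q
  /-- the quotient map -/
  π : Cone M → V
  π_localDiffeo : IsLocalDiffeomorph (coneModel m) 𝓘(ℝ, EuclideanSpace ℂ (Fin n)) ∞ π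
  π_holomorphic : IsHolomorphic (coneModel m) 𝓘(ℝ, EuclideanSpace ℂ (Fin n))
    sasakian.J (complexManifoldJ n V) π
  π_surjective : Function.Surjective π
  π_fibres : ∀ x y : Cone M, π x = π y ↔ ∃ k : ℤ, (q.toEquiv ^ k : Equiv.Perm (Cone M)) x = y

/-- The `2`-form `α` on `V` is the form `ω₀` of the presentation `P`: its pullback to the cone is
`dd^c log t`. -/
def ConePresentation.IsOmegaZero {m : ℕ} {M : Type*} [TopologicalSpace M]
    [ChartedSpace (EuclideanSpace ℝ (Fin m)) M] [IsManifold (𝓡 m) ∞ M]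
    {n : ℕ} {V : Type*} [TopologicalSpace V] [ChartedSpace (EuclideanSpace ℂ (Fin n)) V]
    (P : ConePresentation m M n V) (α : Form 𝓘(ℝ, EuclideanSpace ℂ (Fin n)) V 2) : Prop :=
  Form.pullback (coneModel m) 𝓘(ℝ, EuclideanSpace ℂ (Fin n)) P.π α = P.sasakian.coneOmegaZero

end Vaisman

end

/-! Write R = t∂_t for the radial field of the cone and J for its complex structure. Differentiating
the homogeneity h_λ^*Ω = λ²Ω at λ = 1, and using dΩ = 0, gives d(ι_RΩ) = 2Ω. Since ι_RΩ = t² d^c log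
t, this yields dd^c log t = 2t⁻²(Ω - dt ∧ (dt∘J)) (`SasakianStructure.coneOmegaZero_apply`). Hence
dd^c log t (u, Ju) is -2t⁻² times the squared length of the component of u orthogonal to R and JR:
the form is semidefinite, and its kernel is the plane spanned by R and JR.

Descent to V rests on the fact that a homothety of ratio c satisfies t∘q = c·t (`coneT_homothety`),
which uses the compactness of the base. Then q preserves R, d log t, t⁻²g and dd^c log t, so all
four live on V. Write ξ = `euler`, η = `eta` and `quotForm` for the first three. Near every point of
V there is a potential φ = log t on a holomorphic chart, with η = dφ and with `quotForm` = L + dφ ⊗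
dφ + (dφ∘J) ⊗ (dφ∘J), where L is the Levi form of φ, which is nonnegative.

Now take two presentations, with ξ from the first and η', φ', L' from the second. The dilations are
holomorphic, so ξ is a holomorphic vector field, and a direct computation
(`fderiv_add_fderiv_eq_levi`) gives ξ(η'(ξ)) + Jξ(η'(Jξ)) = 2 L'(ξ, ξ) ≥ 0. Both ξ and Jξ are
holomorphic and change φ at a constant rate (1 and 0), so they are infinitesimal isometries of
`quotForm`, an expression in the derivatives of φ (`fderiv_hermForm_apply`). They therefore have
divergence zero for its Riemannian density, and the left side integrates to zero over the compact
manifold V (`eq_zero_of_eq_lieD_add_lieD`). A nonnegative continuous function with zero integral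
vanishes, so L'(ξ, ξ) = 0 and ξ lies in ker ω₀' (`euler_mem_ker`). As ker ω₀ is spanned by ξ and Jξ
and ker ω₀' is J-invariant, ker ω₀ ⊆ ker ω₀'. Exchanging the two presentations gives equality. -/

noncomputable section

set_option maxSynthPendingDepth 3
set_option linter.unusedSectionVars false

namespace Vaisman

/-! ### Derivatives of maps between manifolds, as maps between the model spaces -/

section TangentMap

variable {E : Type*} [NormedAddCommGroup E] [NormedSpace ℝ E]
  {H : Type*} [TopologicalSpace H] (I : ModelWithCorners ℝ E H)
  {M : Type*} [TopologicalSpace M] [ChartedSpace H M]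
  {E' : Type*} [NormedAddCommGroup E'] [NormedSpace ℝ E']
  {H' : Type*} [TopologicalSpace H'] (I' : ModelWithCorners ℝ E' H')
  {N : Type*} [TopologicalSpace N] [ChartedSpace H' N]
  {E'' : Type*} [NormedAddCommGroup E''] [NormedSpace ℝ E'']
  {H'' : Type*} [TopologicalSpace H''] (I'' : ModelWithCorners ℝ E'' H'')
  {P : Type*} [TopologicalSpace P] [ChartedSpace H'' P]

/-- The derivative `mfderiv I I' f x`, as a continuous linear map between the model spaces. -/
def tder (f : M → N) (x : M) : E →L[ℝ] E' := mfderiv I I' f x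

variable {I I' I''}

theorem tder_comp {g : N → P} {f : M → N} {x : M} (hg : MDifferentiableAt I' I'' g (f x))
    (hf : MDifferentiableAt I I' f x) :
    tder I I'' (g ∘ f) x = (tder I' I'' g (f x)).comp (tder I I' f x) :=
  mfderiv_comp x hg hf

theorem tder_comp_apply {g : N → P} {f : M → N} {x : M} (hg : MDifferentiableAt I' I'' g (f x))
    (hf : MDifferentiableAt I I' f x) (v : E) :
    tder I I'' (g ∘ f) x v = tder I' I'' g (f x) (tder I I' f x v) := by
  rw [tder_comp hg hf]; rfl

theorem tder_congr {f g : M → N} {x : M} (h : f =ᶠ[nhds x] g) : tder I I' f x = tder I I' g x := by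
  unfold tder
  exact h.mfderiv_eq

theorem tder_id (x : M) : tder I I id x = ContinuousLinearMap.id ℝ E := mfderiv_id

theorem tder_eq_fderiv (f : E → E') (x : E) : tder 𝓘(ℝ, E) 𝓘(ℝ, E') f x = fderiv ℝ f x :=
  mfderiv_eq_fderiv

end TangentMap

/-! ### The half-line and the cone -/

/-- The point of `ℝ^{>0}` with a given positive coordinate. -/
def toPos (s : ℝ) : PosReal := if h : 0 < s then ⟨s, h⟩ else ⟨1, Set.mem_Ioi.mpr one_pos⟩

theorem coe_toPos {s : ℝ} (h : 0 < s) : (toPos s : ℝ) = s := by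
  simp only [toPos, dif_pos h]

theorem posReal_pos (x : PosReal) : 0 < (x : ℝ) := x.2

theorem toPos_coe (x : PosReal) : toPos (x : ℝ) = x := Subtype.ext (coe_toPos (posReal_pos x))

theorem extChartAt_posReal_apply (x y : PosReal) : extChartAt 𝓘(ℝ, ℝ) x y = (y : ℝ) := by
  simp only [extChartAt, TopologicalSpace.Opens.chartAt_eq, chartAt_self_eq]
  rfl

theorem extChartAt_posReal_source (x : PosReal) : (extChartAt 𝓘(ℝ, ℝ) x).source = Set.univ := by
  rw [extChartAt_source]
  simp only [TopologicalSpace.Opens.chartAt_eq, chartAt_self_eq,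
    OpenPartialHomeomorph.subtypeRestr_source]
  rfl

theorem extChartAt_posReal_target (x : PosReal) : (extChartAt 𝓘(ℝ, ℝ) x).target = Set.Ioi 0 := by
  rw [← (extChartAt 𝓘(ℝ, ℝ) x).image_source_eq_target, extChartAt_posReal_source]
  ext s
  simp only [Set.image_univ, Set.mem_range, extChartAt_posReal_apply, Set.mem_Ioi]
  exact ⟨fun ⟨y, hy⟩ => hy ▸ posReal_pos y, fun h => ⟨⟨s, h⟩, rfl⟩⟩

theorem extChartAt_posReal_symm (x : PosReal) {s : ℝ} (h : 0 < s) :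
    (extChartAt 𝓘(ℝ, ℝ) x).symm s = toPos s := by
  apply Subtype.ext
  rw [← extChartAt_posReal_apply x, (extChartAt 𝓘(ℝ, ℝ) x).right_inv, coe_toPos h]
  rwa [extChartAt_posReal_target]

theorem contMDiffAt_toPos {s : ℝ} (h : 0 < s) : ContMDiffAt 𝓘(ℝ, ℝ) 𝓘(ℝ, ℝ) ∞ toPos s := by
  have h1 := contMDiffOn_extChartAt_symm (I := 𝓘(ℝ, ℝ)) (n := ∞) (toPos s)
  rw [extChartAt_posReal_target] at h1
  refine (h1.contMDiffAt (Ioi_mem_nhds h)).congr_of_eventuallyEq ?_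
  filter_upwards [Ioi_mem_nhds h] with r hr
  exact (extChartAt_posReal_symm _ hr).symm

theorem contMDiff_coe_posReal : ContMDiff 𝓘(ℝ, ℝ) 𝓘(ℝ, ℝ) ∞ (fun x : PosReal => (x : ℝ)) :=
  contMDiff_subtype_val

/-- The inclusion into ℝ is the preferred chart of the half-line, and a tangent space is identified
with the model space through the preferred chart at its own base point. In this identification the
derivative is the identity. -/
theorem tder_coe_posReal (x : PosReal) (v : ℝ) :
    tder 𝓘(ℝ, ℝ) 𝓘(ℝ, ℝ) (fun x : PosReal => (x : ℝ)) x v = v := by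
  have h1 : tder 𝓘(ℝ, ℝ) 𝓘(ℝ, ℝ) (fun x : PosReal => (x : ℝ)) x
      = tder 𝓘(ℝ, ℝ) 𝓘(ℝ, ℝ) (extChartAt 𝓘(ℝ, ℝ) x) x := by
    congr 1
  rw [h1, tder, ← TangentBundle.continuousLinearMapAt_trivializationAt (I := 𝓘(ℝ, ℝ))
    (mem_chart_source ℝ x),
    TangentBundle.continuousLinearMapAt_trivializationAt_eq_core (mem_chart_source ℝ x)]
  exact (tangentBundleCore 𝓘(ℝ, ℝ) PosReal).coordChange_self (achart ℝ x) x
    (mem_chart_source ℝ x) v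

theorem coneT_pos {M : Type*} (p : Cone M) : 0 < coneT p := posReal_pos p.2

/-- The dilation of the cone by a real number, meaningful for positive factors. -/
def rescale {M : Type*} (l : ℝ) (p : Cone M) : Cone M := (p.1, toPos (l * coneT p))

theorem rescale_eq_dilation {M : Type*} {l : ℝ} (hl : 0 < l) (p : Cone M) :
    rescale l p = dilation (toPos l) p := by
  refine Prod.ext rfl (Subtype.ext ?_)
  change ((toPos (l * coneT p) : PosReal) : ℝ) = (toPos l : ℝ) * coneT p
  rw [coe_toPos (mul_pos hl (coneT_pos p)), coe_toPos hl]

theorem rescale_one {M : Type*} (p : Cone M) : rescale 1 p = p := by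
  refine Prod.ext rfl ?_
  change toPos (1 * (p.2 : ℝ)) = p.2
  rw [one_mul, toPos_coe]

section Cone

variable {m : ℕ} {M : Type*} [TopologicalSpace M] [ChartedSpace (EuclideanSpace ℝ (Fin m)) M]

theorem contMDiff_coneT : ContMDiff (coneModel m) 𝓘(ℝ, ℝ) ∞ (coneT : Cone M → ℝ) :=
  contMDiff_coe_posReal.comp contMDiff_snd

theorem tder_coneT (p : Cone M) (v : EuclideanSpace ℝ (Fin m) × ℝ) :
    tder (coneModel m) 𝓘(ℝ, ℝ) (coneT : Cone M → ℝ) p v = v.2 := by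
  have h : tder (coneModel m) 𝓘(ℝ, ℝ) (coneT : Cone M → ℝ) p
      = (tder 𝓘(ℝ, ℝ) 𝓘(ℝ, ℝ) (fun x : PosReal => (x : ℝ)) p.2).comp
        (tder (coneModel m) 𝓘(ℝ, ℝ) (Prod.snd : Cone M → PosReal) p) :=
    tder_comp (contMDiff_coe_posReal.mdifferentiableAt (by simp)) mdifferentiableAt_snd
  have h2 : tder (coneModel m) 𝓘(ℝ, ℝ) (Prod.snd : Cone M → PosReal) p
      = ContinuousLinearMap.snd ℝ (EuclideanSpace ℝ (Fin m)) ℝ := mfderiv_snd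
  rw [h, h2]
  exact tder_coe_posReal p.2 v.2

theorem coneDt_apply (p : Cone M) (v : TangentSpace (coneModel m) p) : coneDt p v = v.2 :=
  tder_coneT p v

theorem tder_cone_fst (p : Cone M) (v : EuclideanSpace ℝ (Fin m) × ℝ) :
    tder (coneModel m) (𝓡 m) (Prod.fst : Cone M → M) p v = v.1 := by
  have h2 : tder (coneModel m) (𝓡 m) (Prod.fst : Cone M → M) p
      = ContinuousLinearMap.fst ℝ (EuclideanSpace ℝ (Fin m)) ℝ := mfderiv_fst
  rw [h2]; rfl

theorem contMDiffAt_rescale [IsManifold (𝓡 m) ∞ M] {l : ℝ} (hl : 0 < l) (p : Cone M) :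
    ContMDiffAt (𝓘(ℝ, ℝ).prod (coneModel m)) (coneModel m) ∞
      (fun a : ℝ × Cone M => rescale a.1 a.2) (l, p) := by
  refine ContMDiffAt.prodMk (contMDiff_fst.comp contMDiff_snd).contMDiffAt ?_
  have h1 : ContMDiffAt (𝓘(ℝ, ℝ).prod (coneModel m)) 𝓘(ℝ, ℝ) ∞
      (fun a : ℝ × Cone M => a.1 * coneT a.2) (l, p) :=
    (contMDiff_fst.mul (contMDiff_coneT.comp contMDiff_snd)).contMDiffAt
  exact ContMDiffAt.comp (l, p) (contMDiffAt_toPos (mul_pos hl (coneT_pos p))) h1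

/-- The radial vector field `t ∂_t` of the cone. -/
def radial (m : ℕ) {M : Type*} (p : Cone M) : EuclideanSpace ℝ (Fin m) × ℝ := (0, coneT p)

end Cone

/-! ### The cone metric as a bilinear form on the model space -/

section Metric

variable {m : ℕ} {M : Type*} [TopologicalSpace M] [ChartedSpace (EuclideanSpace ℝ (Fin m)) M]
  [IsManifold (𝓡 m) ∞ M] (gM : SmoothMetric m M)

/-- The metric `gM`, as a bilinear form on the model space for each point. -/
def metricForm (x : M) :
    EuclideanSpace ℝ (Fin m) →L[ℝ] EuclideanSpace ℝ (Fin m) →L[ℝ] ℝ := gM.inner x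

theorem metricForm_symm (x : M) (u v : EuclideanSpace ℝ (Fin m)) :
    metricForm gM x u v = metricForm gM x v u := gM.symm x u v

theorem metricForm_pos (x : M) {v : EuclideanSpace ℝ (Fin m)} (hv : v ≠ 0) :
    0 < metricForm gM x v v := gM.pos x v hv

theorem metricForm_self_nonneg (x : M) (v : EuclideanSpace ℝ (Fin m)) :
    0 ≤ metricForm gM x v v := by
  by_cases h : v = 0
  · simp [h]
  · exact (metricForm_pos gM x h).le

/-- The cone metric, as a bilinear form on the model space for each point. -/
def coneForm (p : Cone M) : EuclideanSpace ℝ (Fin m) × ℝ →L[ℝ]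
    EuclideanSpace ℝ (Fin m) × ℝ →L[ℝ] ℝ :=
  coneT p ^ 2 • (metricForm gM p.1).bilinearComp (ContinuousLinearMap.fst ℝ _ ℝ)
      (ContinuousLinearMap.fst ℝ _ ℝ)
    + (ContinuousLinearMap.mul ℝ ℝ).bilinearComp (ContinuousLinearMap.snd ℝ _ ℝ)
      (ContinuousLinearMap.snd ℝ _ ℝ)

theorem coneForm_apply (p : Cone M) (u v : EuclideanSpace ℝ (Fin m) × ℝ) :
    coneForm gM p u v = coneT p ^ 2 * metricForm gM p.1 u.1 v.1 + u.2 * v.2 := rfl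

theorem coneMetric_eq (p : Cone M) (u v : TangentSpace (coneModel m) p) :
    coneMetric gM p u v = coneForm gM p u v := by
  have h1 := tder_cone_fst p u
  have h2 := tder_cone_fst p v
  have h3 := coneDt_apply p u
  have h4 := coneDt_apply p v
  refine Eq.trans ?_ (coneForm_apply gM p u v).symm
  change coneT p ^ 2 * metricForm gM p.1 (tder (coneModel m) (𝓡 m) (Prod.fst : Cone M → M) p u)
    (tder (coneModel m) (𝓡 m) (Prod.fst : Cone M → M) p v) + coneDt p u * coneDt p v = _
  rw [h1, h2, h3, h4]

theorem coneForm_symm (p : Cone M) (u v : EuclideanSpace ℝ (Fin m) × ℝ) :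
    coneForm gM p u v = coneForm gM p v u := by
  rw [coneForm_apply, coneForm_apply, metricForm_symm, mul_comm u.2]

theorem snd_sq_le_coneForm (p : Cone M) (u : EuclideanSpace ℝ (Fin m) × ℝ) :
    u.2 ^ 2 ≤ coneForm gM p u u := by
  rw [coneForm_apply]
  nlinarith [mul_nonneg (sq_nonneg (coneT p)) (metricForm_self_nonneg gM p.1 u.1)]

theorem coneForm_pos (p : Cone M) {u : EuclideanSpace ℝ (Fin m) × ℝ} (hu : u ≠ 0) :
    0 < coneForm gM p u u := by
  rw [coneForm_apply]
  by_cases h : u.1 = 0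
  · have h2 : u.2 ≠ 0 := fun h2 => hu (Prod.ext h h2)
    have h3 : 0 < u.2 * u.2 := mul_self_pos.mpr h2
    simpa [h] using h3
  · have h2 := mul_pos (pow_pos (coneT_pos p) 2) (metricForm_pos gM p.1 h)
    nlinarith [mul_self_nonneg u.2]

end Metric

/-! ### Homotheties of a cone multiply the radius by a constant -/

theorem tder_toPos {s : ℝ} (h : 0 < s) (v : ℝ) :
    tder 𝓘(ℝ, ℝ) 𝓘(ℝ, ℝ) toPos s v = v := by
  have h1 := tder_comp_apply (I := 𝓘(ℝ, ℝ)) (I' := 𝓘(ℝ, ℝ)) (I'' := 𝓘(ℝ, ℝ)) (f := toPos) (x := s)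
    (contMDiff_coe_posReal.mdifferentiableAt (x := toPos s) (by simp))
    ((contMDiffAt_toPos h).mdifferentiableAt (by simp)) v
  have h2 : ((fun x : PosReal => (x : ℝ)) ∘ toPos) =ᶠ[nhds s] id := by
    filter_upwards [Ioi_mem_nhds h] with r hr using coe_toPos hr
  rw [tder_congr h2, tder_id, tder_coe_posReal] at h1
  exact h1.symm

section Homothety

variable {m : ℕ} {M : Type*} [TopologicalSpace M] [ChartedSpace (EuclideanSpace ℝ (Fin m)) M]

/-- The ray of the cone through a point of its base. -/
def ray (x : M) (s : ℝ) : Cone M := (x, toPos s)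

theorem contMDiffAt_ray (x : M) {s : ℝ} (h : 0 < s) :
    ContMDiffAt 𝓘(ℝ, ℝ) (coneModel m) ∞ (ray x) s :=
  contMDiffAt_const.prodMk (contMDiffAt_toPos h)

theorem tder_ray (x : M) {s : ℝ} (h : 0 < s) :
    tder 𝓘(ℝ, ℝ) (coneModel m) (ray x) s 1 = (0, 1) := by
  have h1 : tder 𝓘(ℝ, ℝ) (coneModel m) (ray x) s
      = (tder 𝓘(ℝ, ℝ) (𝓡 m) (fun _ : ℝ => x) s).prod (tder 𝓘(ℝ, ℝ) 𝓘(ℝ, ℝ) toPos s) :=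
    mfderiv_prodMk mdifferentiableAt_const ((contMDiffAt_toPos h).mdifferentiableAt (by simp))
  have h2 : tder 𝓘(ℝ, ℝ) (𝓡 m) (fun _ : ℝ => x) s = 0 := mfderiv_const
  rw [h1, h2]
  exact Prod.ext rfl (tder_toPos h 1)

variable [IsManifold (𝓡 m) ∞ M]

/-- Along a ray of the cone, t∘q is c-Lipschitz, because dt has norm at most 1 and q stretches
lengths by c. If t(q p) exceeded c·t(p), then t∘q would stay above a positive δ on the whole segment
from p towards the apex. The image of the segment would then lie in a compact part of the cone,
whose preimage under q is compact and so stays away from the apex, whereas the segment does not. -/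
theorem coneT_homothety_le [CompactSpace M] (gM : SmoothMetric m M)
    (q : Diffeomorph (coneModel m) (coneModel m) (Cone M) (Cone M) ∞) {c : ℝ} (hc : 0 < c)
    (hq : ∀ (p : Cone M) (u v : EuclideanSpace ℝ (Fin m) × ℝ),
      coneForm gM (q p) (tder (coneModel m) (coneModel m) q p u)
        (tder (coneModel m) (coneModel m) q p v) = c ^ 2 * coneForm gM p u v)
    (p : Cone M) : coneT (q p) ≤ c * coneT p := by
  by_contra! hlt
  set f : ℝ → ℝ := coneT ∘ q ∘ ray p.1 with hf
  have hder : ∀ s ∈ Set.Ioi (0 : ℝ), ∃ d : ℝ, HasDerivAt f d s ∧ ‖d‖ ≤ c := by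
    intro s hs
    have hs : 0 < s := hs
    have h1 := (contMDiffAt_ray (m := m) p.1 hs).mdifferentiableAt (by simp)
    have h2 := q.contMDiff.mdifferentiableAt (x := (ray p.1 s)) (by simp)
    have h3 := (contMDiff_coneT (m := m) (M := M)).mdifferentiableAt
      (x := q (ray p.1 s)) (by simp)
    have h6 := MDifferentiableAt.comp s h2 h1
    have h7 := MDifferentiableAt.comp s h3 h6
    have h4 : DifferentiableAt ℝ f s := mdifferentiableAt_iff_differentiableAt.mp h7
    refine ⟨_, h4.hasDerivAt, ?_⟩
    have h5 : deriv f s = tder (coneModel m) 𝓘(ℝ, ℝ) (coneT : Cone M → ℝ) (q (ray p.1 s))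
        (tder (coneModel m) (coneModel m) q (ray p.1 s) (0, 1)) := by
      have h8 : tder 𝓘(ℝ, ℝ) 𝓘(ℝ, ℝ) f s 1
          = tder (coneModel m) 𝓘(ℝ, ℝ) (coneT : Cone M → ℝ) (q (ray p.1 s))
            (tder 𝓘(ℝ, ℝ) (coneModel m) (q ∘ ray p.1) s 1) :=
        tder_comp_apply (f := q ∘ ray p.1) h3 h6 1
      rw [← tder_ray p.1 hs, ← tder_comp_apply h2 h1, ← h8, tder_eq_fderiv]
      exact fderiv_apply_one_eq_deriv.symm
    rw [h5, tder_coneT]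
    -- With w the image of ∂_t under dq: dt(w)² ≤ g(w, w) = c² g(∂_t, ∂_t) = c².
    refine abs_le_of_sq_le_sq ?_ hc.le
    refine (snd_sq_le_coneForm gM (q (ray p.1 s)) _).trans (le_of_eq ?_)
    rw [hq, coneForm_apply]
    simp
  choose! d hd using hder
  have hlip : ∀ s, 0 < s → ∀ r, 0 < r → ‖f r - f s‖ ≤ c * ‖r - s‖ := fun s hs r hr =>
    (convex_Ioi (0 : ℝ)).norm_image_sub_le_of_norm_hasDerivWithin_le
      (fun x hx => (hd x hx).1.hasDerivWithinAt) (fun x hx => (hd x hx).2) hs hr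
  have hp : f (coneT p) = coneT (q p) := by
    have : toPos (coneT p) = p.2 := toPos_coe p.2
    simp only [hf, ray, Function.comp_apply, this]
  set t := coneT p with ht
  have htpos : 0 < t := coneT_pos p
  set δ := coneT (q p) - c * t with hδ
  have hδpos : 0 < δ := by rw [hδ]; linarith
  have hbound : ∀ s, 0 < s → s ≤ t → f s ∈ Set.Icc δ (coneT (q p) + c * t) := by
    intro s hs hst
    have h1 := hlip t htpos s hs
    rw [hp, Real.norm_eq_abs, Real.norm_eq_abs, abs_of_nonpos (by linarith : s - t ≤ 0)] at h1
    have h2 := abs_le.mp h1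
    have h3 : c * -(s - t) ≤ c * t := by nlinarith
    exact ⟨by rw [hδ]; linarith [h2.1], by linarith [h2.2]⟩
  -- the part of the cone between two positive radii is compact
  set K : Set (Cone M) :=
    (fun a : M × Set.Icc δ (coneT (q p) + c * t) =>
      ((a.1, ⟨a.2, lt_of_lt_of_le hδpos a.2.2.1⟩) : Cone M)) '' Set.univ with hK
  have hKc : IsCompact K := by
    refine isCompact_univ.image ?_
    exact continuous_fst.prodMk
      (Continuous.subtype_mk (continuous_subtype_val.comp continuous_snd) _)
  have hmem : ∀ s, 0 < s → s ≤ t → q (ray p.1 s) ∈ K := fun s hs hst =>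
    ⟨((q (ray p.1 s)).1, ⟨f s, hbound s hs hst⟩), Set.mem_univ _, rfl⟩
  have hK' : IsCompact (q.symm '' K) := hKc.image q.symm.continuous
  have hne : (q.symm '' K).Nonempty := ⟨_, Set.mem_image_of_mem _ (hmem t htpos le_rfl)⟩
  obtain ⟨a, -, ha⟩ := hK'.exists_isMinOn hne
    (contMDiff_coneT (m := m) (M := M)).continuous.continuousOn
  have hapos := coneT_pos a
  -- The point of the segment at radius s lies in the preimage of K but is closer to the apex than
  -- the minimiser a.
  set s := min t (coneT a / 2) with hs
  have hspos : 0 < s := lt_min htpos (by linarith)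
  have h1 : (ray p.1 s) ∈ q.symm '' K :=
    ⟨_, hmem s hspos (min_le_left _ _), q.symm_apply_apply _⟩
  have h2 : coneT a ≤ coneT (ray p.1 s) := ha h1
  have h3 : coneT (ray p.1 s) = s := coe_toPos hspos
  rw [h3] at h2
  linarith [min_le_right t (coneT a / 2)]

/-- The opposite inequality is `coneT_homothety_le` for the inverse map, a homothety of ratio c⁻¹.
-/
theorem coneT_homothety [CompactSpace M] (gM : SmoothMetric m M)
    (q : Diffeomorph (coneModel m) (coneModel m) (Cone M) (Cone M) ∞) {c : ℝ} (hc : 0 < c)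
    (hq : ∀ (p : Cone M) (u v : EuclideanSpace ℝ (Fin m) × ℝ),
      coneForm gM (q p) (tder (coneModel m) (coneModel m) q p u)
        (tder (coneModel m) (coneModel m) q p v) = c ^ 2 * coneForm gM p u v)
    (p : Cone M) : coneT (q p) = c * coneT p := by
  refine le_antisymm (coneT_homothety_le gM q hc hq p) ?_
  have key := coneT_homothety_le gM q.symm (inv_pos.mpr hc) (fun x u v => ?_) (q p)
  · rw [q.symm_apply_apply, inv_mul_eq_div, le_div_iff₀ hc] at key
    linarith
  · have h : ∀ w, tder (coneModel m) (coneModel m) q (q.symm x)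
        (tder (coneModel m) (coneModel m) q.symm x w) = w := by
      intro w
      rw [← tder_comp_apply (q.contMDiff.mdifferentiableAt (by simp))
        (q.symm.contMDiff.mdifferentiableAt (by simp))]
      have h2 : q ∘ q.symm = id := funext q.apply_symm_apply
      rw [h2, tder_id]
      rfl
    have h1 := hq (q.symm x) (tder (coneModel m) (coneModel m) q.symm x u)
      (tder (coneModel m) (coneModel m) q.symm x v)
    rw [h, h, q.apply_symm_apply] at h1
    rw [h1, ← mul_assoc, inv_pow, inv_mul_cancel₀ (by positivity), one_mul]

end Homothety

/-! ### Exterior derivatives of `1`- and `2`-forms in coordinates -/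

section Coordinates

variable {E : Type*} [NormedAddCommGroup E] [NormedSpace ℝ E]

theorem extDeriv_ofSubsingleton_apply {B : E → E →L[ℝ] ℝ} {z : E} (hB : DifferentiableAt ℝ B z)
    (u v : E) :
    extDeriv (fun y => ContinuousAlternatingMap.ofSubsingleton ℝ E ℝ (0 : Fin 1) (B y)) z ![u, v]
      = fderiv ℝ B z u v - fderiv ℝ B z v u := by
  set L := (ContinuousAlternatingMap.ofSubsingletonLIE (𝕜 := ℝ) (E := E) (F := ℝ)
    (0 : Fin 1)).toContinuousLinearEquiv.toContinuousLinearMap with hL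
  have h1 : HasFDerivAt
      (fun y => ContinuousAlternatingMap.ofSubsingleton ℝ E ℝ (0 : Fin 1) (B y))
      (L.comp (fderiv ℝ B z)) z := L.hasFDerivAt.comp z hB.hasFDerivAt
  rw [extDeriv, h1.fderiv, ContinuousAlternatingMap.alternatizeUncurryFin_apply]
  have h2 : ∀ (T : E →L[ℝ] ℝ) (w : Fin 1 → E), L T w = T (w 0) := fun _ _ => rfl
  simp [Fin.sum_univ_two, h2, Fin.removeNth]
  ring

theorem alternating_two_eq (α : E [⋀^Fin 2]→L[ℝ] ℝ) (w : Fin 2 → E) : α w = α ![w 0, w 1] := by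
  congr 1
  ext i
  fin_cases i <;> rfl

/-- This allows a 2-form to be handled through a field of bilinear forms whose values are easy to
compute. Near z the form is the image of that field under a fixed continuous linear map, the
antisymmetrisation, so its derivative is controlled by that of `B`. -/
theorem extDeriv_apply_of_bilinear {α : E → E [⋀^Fin 2]→L[ℝ] ℝ} {B : E → E →L[ℝ] E →L[ℝ] ℝ} {z : E}
    (hB : DifferentiableAt ℝ B z)
    (h : ∀ᶠ y in nhds z, ∀ u v, α y ![u, v] = B y u v) (a b c : E) :
    extDeriv α z ![a, b, c]
      = fderiv ℝ B z a b c - fderiv ℝ B z b a c + fderiv ℝ B z c a b := by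
  -- The factor 1/2 makes `A` restore an alternating form from its underlying bilinear form.
  obtain ⟨A, hAap⟩ : ∃ A : (E →L[ℝ] E →L[ℝ] ℝ) →L[ℝ] E [⋀^Fin 2]→L[ℝ] ℝ,
      ∀ (T : E →L[ℝ] E →L[ℝ] ℝ) (w : Fin 2 → E),
        A T w = (1 / 2 : ℝ) * (T (w 0) (w 1) - T (w 1) (w 0)) := by
    set L := (ContinuousAlternatingMap.ofSubsingletonLIE (𝕜 := ℝ) (E := E) (F := ℝ)
      (0 : Fin 1)).toContinuousLinearEquiv.toContinuousLinearMap with hL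
    have hLA : ∀ (T : E →L[ℝ] ℝ) (w : Fin 1 → E), L T w = T (w 0) := fun _ _ => rfl
    refine ⟨(1 / 2 : ℝ) • (ContinuousAlternatingMap.alternatizeUncurryFinCLM ℝ E ℝ).comp
      (ContinuousLinearMap.compL ℝ E (E →L[ℝ] ℝ) (E [⋀^Fin 1]→L[ℝ] ℝ) L), fun T w => ?_⟩
    change (1 / 2 : ℝ) * ContinuousAlternatingMap.alternatizeUncurryFin (L.comp T) w = _
    rw [ContinuousAlternatingMap.alternatizeUncurryFin_apply]
    simp [Fin.sum_univ_two, hLA, Fin.removeNth]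
    ring
  have hswap : ∀ y u v, α y ![u, v] = - α y ![v, u] := by
    intro y u v
    refine Eq.trans (congrArg _ ?_) ((α y).map_swap ![v, u] (i := 0) (j := 1) (by decide))
    ext i
    fin_cases i <;> rfl
  have h1 : HasFDerivAt α (A.comp (fderiv ℝ B z)) z := by
    have h0 : HasFDerivAt (fun y => A (B y)) (A.comp (fderiv ℝ B z)) z :=
      A.hasFDerivAt.comp z hB.hasFDerivAt
    refine h0.congr_of_eventuallyEq ?_
    filter_upwards [h] with y hy
    ext w
    rw [hAap, ← hy, ← hy, alternating_two_eq, hswap y (w 1)]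
    ring
  -- `B` is skew near z because it agrees there with an alternating form, and its derivative
  -- inherits the skewness.
  have h2 : ∀ w u v, fderiv ℝ B z w u v = - fderiv ℝ B z w v u := by
    intro w u v
    have h3 : ∀ u v, HasFDerivAt (fun y => B y u v) ((fderiv ℝ B z).flip u |>.flip v) z :=
      fun u v => by
        have h0 := (hB.hasFDerivAt.clm_apply (hasFDerivAt_const u z)).clm_apply
          (hasFDerivAt_const v z)
        refine h0.congr_fderiv ?_
        ext w
        simp
    have h4 : (fun y => B y u v) =ᶠ[nhds z] fun y => - B y v u := by
      filter_upwards [h] with y hy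
      rw [← hy, ← hy, hswap]
    have h5 := ((h3 u v).congr_of_eventuallyEq h4.symm).unique (h3 v u).fun_neg
    exact DFunLike.congr_fun h5 w
  rw [extDeriv, h1.fderiv, ContinuousAlternatingMap.alternatizeUncurryFin_apply]
  have h6 : Fin.succAbove (2 : Fin 3) (1 : Fin 2) = 1 := rfl
  simp [Fin.sum_univ_three, hAap, Fin.removeNth, h6]
  rw [h2 a c b, h2 b c a, h2 c b a]
  ring

end Coordinates

/-! ### Forms and tangent maps in the preferred charts -/

section Charts

variable {E : Type*} [NormedAddCommGroup E] [NormedSpace ℝ E]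
  {H : Type*} [TopologicalSpace H] {I : ModelWithCorners ℝ E H} [I.Boundaryless]
  {M : Type*} [TopologicalSpace M] [ChartedSpace H M] 

theorem extChartAt_target_mem_nhds_of_mem {x : M} {z : E} (hz : z ∈ (extChartAt I x).target) :
    (extChartAt I x).target ∈ nhds z := (isOpen_extChartAt_target x).mem_nhds hz

variable [IsManifold I ∞ M]

theorem contMDiffAt_extChartAt_symm {x : M} {z : E} (hz : z ∈ (extChartAt I x).target) :
    ContMDiffAt 𝓘(ℝ, E) I ∞ (extChartAt I x).symm z :=
  (contMDiffOn_extChartAt_symm x).contMDiffAt (extChartAt_target_mem_nhds_of_mem hz)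

theorem contMDiffAt_extChartAt_of_mem {x y : M} (hy : y ∈ (extChartAt I x).source) :
    ContMDiffAt I 𝓘(ℝ, E) ∞ (extChartAt I x) y :=
  contMDiffAt_extChartAt' (by rwa [extChartAt_source] at hy)

theorem tder_extChartAt_symm_comp {x y : M} (hy : y ∈ (extChartAt I x).source) (v : E) :
    tder 𝓘(ℝ, E) I (extChartAt I x).symm (extChartAt I x y)
      (tder I 𝓘(ℝ, E) (extChartAt I x) y v) = v := by
  rw [← tder_comp_apply
    ((contMDiffAt_extChartAt_symm ((extChartAt I x).map_source hy)).mdifferentiableAt (by simp))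
    ((contMDiffAt_extChartAt_of_mem hy).mdifferentiableAt (by simp))]
  have h : (extChartAt I x).symm ∘ extChartAt I x =ᶠ[nhds y] id := by
    filter_upwards [(isOpen_extChartAt_source x).mem_nhds hy] with a ha
    exact (extChartAt I x).left_inv ha
  rw [tder_congr h, tder_id]
  rfl

theorem tder_extChartAt_comp_symm {x : M} {z : E} (hz : z ∈ (extChartAt I x).target) (v : E) :
    tder I 𝓘(ℝ, E) (extChartAt I x) ((extChartAt I x).symm z)
      (tder 𝓘(ℝ, E) I (extChartAt I x).symm z v) = v := by
  rw [← tder_comp_apply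
    ((contMDiffAt_extChartAt_of_mem ((extChartAt I x).map_target hz)).mdifferentiableAt (by simp))
    ((contMDiffAt_extChartAt_symm hz).mdifferentiableAt (by simp))]
  have h : extChartAt I x ∘ (extChartAt I x).symm =ᶠ[nhds z] id := by
    filter_upwards [extChartAt_target_mem_nhds_of_mem hz] with a ha
    exact (extChartAt I x).right_inv ha
  rw [tder_congr h, tder_id]
  rfl

/-- Tangent vectors at x are represented in the preferred chart at x itself, where the coordinate
change is the identity. This is what removes the outer derivative in the definition of `Form.d`. -/
theorem tder_extChartAt_self (x : M) (v : E) : tder I 𝓘(ℝ, E) (extChartAt I x) x v = v := by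
  have : IsManifold I 1 M := IsManifold.of_le (n := ∞) (by simp)
  rw [tder, ← TangentBundle.continuousLinearMapAt_trivializationAt (I := I)
    (mem_chart_source H x),
    TangentBundle.continuousLinearMapAt_trivializationAt_eq_core (mem_chart_source H x)]
  exact (tangentBundleCore I M).coordChange_self (achart H x) x (mem_chart_source H x) v

theorem tder_extChartAt_symm_self (x : M) (v : E) :
    tder 𝓘(ℝ, E) I (extChartAt I x).symm (extChartAt I x x) v = v := by
  have h := tder_extChartAt_symm_comp (I := I) (mem_extChartAt_source (I := I) x) v
  rwa [tder_extChartAt_self] at h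

omit [IsManifold I ∞ M] in
theorem Form.inChart_apply {k : ℕ} (α : Form I M k) (x : M) (z : E) (w : Fin k → E) :
    Form.inChart I α x z w
      = α ((extChartAt I x).symm z) (fun i => tder 𝓘(ℝ, E) I (extChartAt I x).symm z (w i)) := by
  have h : mfderivWithin 𝓘(ℝ, E) I (extChartAt I x).symm (Set.range I) z
      = mfderiv 𝓘(ℝ, E) I (extChartAt I x).symm z := by
    rw [I.range_eq_univ, mfderivWithin_univ]
  unfold Form.inChart
  rw [h]
  rfl

theorem Form.d_apply {k : ℕ} (α : Form I M k) (x : M) (w : Fin (k + 1) → E) :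
    Form.d I α x w = extDeriv (Form.inChart I α x) (extChartAt I x x) w := by
  unfold Form.d
  rw [I.range_eq_univ, extDerivWithin_univ]
  change extDeriv (Form.inChart I α x) (extChartAt I x x)
    (fun i => tder I 𝓘(ℝ, E) (extChartAt I x) x (w i)) = _
  simp only [tder_extChartAt_self]

end Charts

/-! ### The cone in its charts -/

section TangentVectors

variable {E : Type*} [NormedAddCommGroup E] [NormedSpace ℝ E]
  {H : Type*} [TopologicalSpace H] {I : ModelWithCorners ℝ E H} [I.Boundaryless]
  {M : Type*} [TopologicalSpace M] [ChartedSpace H M] [IsManifold I ∞ M]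

/-- Coordinate vector fields are smooth as maps into the tangent bundle. Smoothness of a tensor in a
chart can then be tested by evaluating it on them. -/
theorem contMDiffAt_tder_extChartAt_symm {x : M} {z : E} (hz : z ∈ (extChartAt I x).target)
    (v : E) :
    ContMDiffAt 𝓘(ℝ, E) I.tangent ∞ (fun y : E =>
      (⟨(extChartAt I x).symm y, tder 𝓘(ℝ, E) I (extChartAt I x).symm y v⟩ : TangentBundle I M))
      z := by
  have : IsManifold I 1 M := IsManifold.of_le (n := ∞) (by simp)
  have hopen := isOpen_extChartAt_target (I := I) x
  have h1 := (contMDiffOn_extChartAt_symm (I := I) (n := ∞) x).contMDiffOn_tangentMapWithin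
    (m := ∞) (by simp) hopen.uniqueMDiffOn
  have h2 : ContMDiffAt 𝓘(ℝ, E) 𝓘(ℝ, E).tangent ∞
      (fun y : E => (⟨y, v⟩ : TangentBundle 𝓘(ℝ, E) E)) z :=
    contMDiffAt_vectorSpace_iff_contDiffAt.mpr contDiffAt_const
  have h3 := (h1.contMDiffAt (x := (⟨z, v⟩ : TangentBundle 𝓘(ℝ, E) E)) ?_).comp z h2
  · refine h3.congr_of_eventuallyEq ?_
    filter_upwards [hopen.mem_nhds hz] with y hy
    have h4 : mfderivWithin 𝓘(ℝ, E) I (extChartAt I x).symm (extChartAt I x).target y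
        = mfderiv 𝓘(ℝ, E) I (extChartAt I x).symm y := mfderivWithin_of_isOpen hopen hy
    simp only [Function.comp_apply, tangentMapWithin, h4]
    rfl
  · exact (FiberBundle.continuous_proj E (TangentSpace 𝓘(ℝ, E))).continuousAt.preimage_mem_nhds
      (hopen.mem_nhds hz)

end TangentVectors

section ConeChart

variable {m : ℕ} {M : Type*} [TopologicalSpace M] [ChartedSpace (EuclideanSpace ℝ (Fin m)) M]

theorem mem_coneChart_target {p : Cone M} {z : EuclideanSpace ℝ (Fin m) × ℝ} :
    z ∈ (extChartAt (coneModel m) p).target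
      ↔ z.1 ∈ (extChartAt (𝓡 m) p.1).target ∧ 0 < z.2 := by
  rw [extChartAt_prod, PartialEquiv.prod_target, Set.mem_prod, extChartAt_posReal_target]
  rfl

theorem coneChart_symm {p : Cone M} {z : EuclideanSpace ℝ (Fin m) × ℝ} (hz : 0 < z.2) :
    (extChartAt (coneModel m) p).symm z = ((extChartAt (𝓡 m) p.1).symm z.1, toPos z.2) := by
  rw [extChartAt_prod]
  exact Prod.ext rfl (extChartAt_posReal_symm p.2 hz)

theorem coneChart_self (p : Cone M) :
    extChartAt (coneModel m) p p = (extChartAt (𝓡 m) p.1 p.1, coneT p) := by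
  rw [extChartAt_prod]
  rfl

theorem coneT_coneChart_symm {p : Cone M} {z : EuclideanSpace ℝ (Fin m) × ℝ} (hz : 0 < z.2) :
    coneT ((extChartAt (coneModel m) p).symm z) = z.2 := by
  rw [coneChart_symm hz]
  exact coe_toPos hz

variable [IsManifold (𝓡 m) ∞ M]

theorem tder_coneChart_symm_snd {p : Cone M} {z : EuclideanSpace ℝ (Fin m) × ℝ}
    (hz : z ∈ (extChartAt (coneModel m) p).target) (u : EuclideanSpace ℝ (Fin m) × ℝ) :
    (tder 𝓘(ℝ, EuclideanSpace ℝ (Fin m) × ℝ) (coneModel m)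
      (extChartAt (coneModel m) p).symm z u).2 = u.2 := by
  rw [← tder_coneT ((extChartAt (coneModel m) p).symm z),
    ← tder_comp_apply (contMDiff_coneT.mdifferentiableAt (by simp))
      ((contMDiffAt_extChartAt_symm hz).mdifferentiableAt (by simp))]
  have h : coneT ∘ (extChartAt (coneModel m) p).symm =ᶠ[nhds z] Prod.snd := by
    filter_upwards [extChartAt_target_mem_nhds_of_mem hz] with y hy
    exact coneT_coneChart_symm (mem_coneChart_target.mp hy).2
  rw [tder_congr h, tder_eq_fderiv, fderiv_snd]
  rfl

theorem tder_coneChart_symm_fst {p : Cone M} {z : EuclideanSpace ℝ (Fin m) × ℝ}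
    (hz : z ∈ (extChartAt (coneModel m) p).target) (u : EuclideanSpace ℝ (Fin m) × ℝ) :
    (tder 𝓘(ℝ, EuclideanSpace ℝ (Fin m) × ℝ) (coneModel m)
      (extChartAt (coneModel m) p).symm z u).1
        = tder 𝓘(ℝ, EuclideanSpace ℝ (Fin m)) (𝓡 m) (extChartAt (𝓡 m) p.1).symm z.1 u.1 := by
  rw [← tder_cone_fst ((extChartAt (coneModel m) p).symm z),
    ← tder_comp_apply mdifferentiableAt_fst
      ((contMDiffAt_extChartAt_symm hz).mdifferentiableAt (by simp))]
  have h : Prod.fst ∘ (extChartAt (coneModel m) p).symm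
      =ᶠ[nhds z] (extChartAt (𝓡 m) p.1).symm ∘ Prod.fst := by
    filter_upwards [extChartAt_target_mem_nhds_of_mem hz] with y hy
    simp only [Function.comp_apply, coneChart_symm (mem_coneChart_target.mp hy).2]
  have h2 : MDifferentiableAt 𝓘(ℝ, EuclideanSpace ℝ (Fin m) × ℝ) 𝓘(ℝ, EuclideanSpace ℝ (Fin m))
      (Prod.fst : EuclideanSpace ℝ (Fin m) × ℝ → EuclideanSpace ℝ (Fin m)) z :=
    differentiableAt_fst.mdifferentiableAt
  rw [tder_congr h, tder_comp_apply ((contMDiffAt_extChartAt_symm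
    (mem_coneChart_target.mp hz).1).mdifferentiableAt (by simp)) h2, tder_eq_fderiv, fderiv_fst]
  rfl

theorem tder_coneChart_symm_radial {p : Cone M} {z : EuclideanSpace ℝ (Fin m) × ℝ}
    (hz : z ∈ (extChartAt (coneModel m) p).target) (s : ℝ) :
    tder 𝓘(ℝ, EuclideanSpace ℝ (Fin m) × ℝ) (coneModel m)
      (extChartAt (coneModel m) p).symm z (0, s) = (0, s) := by
  refine Prod.ext ?_ (tder_coneChart_symm_snd hz _)
  rw [tder_coneChart_symm_fst hz, map_zero]

theorem contMDiffAt_rescale_right {l : ℝ} (hl : 0 < l) (p : Cone M) :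
    ContMDiffAt (coneModel m) (coneModel m) ∞ (rescale l : Cone M → Cone M) p :=
  ContMDiffAt.comp (I' := 𝓘(ℝ, ℝ).prod (coneModel m)) p (contMDiffAt_rescale hl p)
    (contMDiffAt_const.prodMk contMDiffAt_id)

theorem rescale_coneChart_symm {p : Cone M} {z : EuclideanSpace ℝ (Fin m) × ℝ} (hz : 0 < z.2)
    {l : ℝ} (hl : 0 < l) :
    rescale l ((extChartAt (coneModel m) p).symm z)
      = (extChartAt (coneModel m) p).symm (z.1, l * z.2) := by
  rw [coneChart_symm hz, coneChart_symm (mul_pos hl hz)]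
  refine Prod.ext rfl ?_
  change toPos (l * (toPos z.2 : ℝ)) = _
  rw [coe_toPos hz]

/-- In a product chart the dilation is the linear map (x, s) ↦ (x, l s), so it is its own
derivative. -/
theorem tder_rescale_coneChart_symm {p : Cone M} {z : EuclideanSpace ℝ (Fin m) × ℝ}
    (hz : z ∈ (extChartAt (coneModel m) p).target) {l : ℝ} (hl : 0 < l)
    (u : EuclideanSpace ℝ (Fin m) × ℝ) :
    tder (coneModel m) (coneModel m) (rescale l) ((extChartAt (coneModel m) p).symm z)
      (tder 𝓘(ℝ, EuclideanSpace ℝ (Fin m) × ℝ) (coneModel m)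
        (extChartAt (coneModel m) p).symm z u)
      = tder 𝓘(ℝ, EuclideanSpace ℝ (Fin m) × ℝ) (coneModel m)
        (extChartAt (coneModel m) p).symm (z.1, l * z.2) (u.1, l * u.2) := by
  have hz' := mem_coneChart_target.mp hz
  have hz2 : ((z.1, l * z.2) : EuclideanSpace ℝ (Fin m) × ℝ) ∈
      (extChartAt (coneModel m) p).target :=
    mem_coneChart_target.mpr ⟨hz'.1, mul_pos hl hz'.2⟩
  set L : EuclideanSpace ℝ (Fin m) × ℝ →L[ℝ] EuclideanSpace ℝ (Fin m) × ℝ :=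
    (ContinuousLinearMap.fst ℝ _ _).prod (l • ContinuousLinearMap.snd ℝ _ _) with hL
  have hLd : MDifferentiableAt 𝓘(ℝ, EuclideanSpace ℝ (Fin m) × ℝ)
      𝓘(ℝ, EuclideanSpace ℝ (Fin m) × ℝ) L z := L.differentiableAt.mdifferentiableAt
  rw [← tder_comp_apply ((contMDiffAt_rescale_right hl _).mdifferentiableAt (by simp))
      ((contMDiffAt_extChartAt_symm hz).mdifferentiableAt (by simp))]
  have h : rescale l ∘ (extChartAt (coneModel m) p).symm
      =ᶠ[nhds z] (extChartAt (coneModel m) p).symm ∘ L := by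
    filter_upwards [extChartAt_target_mem_nhds_of_mem hz] with y hy
    exact rescale_coneChart_symm (mem_coneChart_target.mp hy).2 hl
  have h2 := tder_comp_apply (f := L) (x := z) (g := (extChartAt (coneModel m) p).symm)
    ((contMDiffAt_extChartAt_symm hz2).mdifferentiableAt (by simp)) hLd u
  rw [tder_congr h, h2, tder_eq_fderiv, L.fderiv]
  rfl

end ConeChart

/-! ### Smoothness of the cone metric on smooth vector fields -/

section ConeForm

variable {m : ℕ} {M : Type*} [TopologicalSpace M] [ChartedSpace (EuclideanSpace ℝ (Fin m)) M]
  [IsManifold (𝓡 m) ∞ M]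

theorem contMDiffAt_coneForm (gM : SmoothMetric m M) {E : Type*} [NormedAddCommGroup E]
    [NormedSpace ℝ E] {σ : E → Cone M} {U W : E → EuclideanSpace ℝ (Fin m) × ℝ} {z : E}
    (hU : ContMDiffAt 𝓘(ℝ, E) (coneModel m).tangent ∞
      (fun y => (⟨σ y, U y⟩ : TangentBundle (coneModel m) (Cone M))) z)
    (hW : ContMDiffAt 𝓘(ℝ, E) (coneModel m).tangent ∞
      (fun y => (⟨σ y, W y⟩ : TangentBundle (coneModel m) (Cone M))) z) :
    ContDiffAt ℝ ∞ (fun y => coneForm gM (σ y) (U y) (W y)) z := by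
  have hσ : ContMDiffAt 𝓘(ℝ, E) (coneModel m) ∞ σ z :=
    (Bundle.contMDiff_proj (TangentSpace (coneModel m))).contMDiffAt.comp z hU
  have hfst : ∀ V : E → EuclideanSpace ℝ (Fin m) × ℝ, ContMDiffAt 𝓘(ℝ, E) (coneModel m).tangent ∞
      (fun y => (⟨σ y, V y⟩ : TangentBundle (coneModel m) (Cone M))) z →
      ContMDiffAt 𝓘(ℝ, E) (𝓡 m).tangent ∞
        (fun y => (⟨(σ y).1, (V y).1⟩ : TangentBundle (𝓡 m) M)) z := by
    intro V hV
    have h1 : ContMDiff (coneModel m) (𝓡 m) ∞ (Prod.fst : Cone M → M) := contMDiff_fst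
    have h2 := (h1.contMDiff_tangentMap (m := ∞) (by simp)).contMDiffAt.comp z hV
    refine h2.congr_of_eventuallyEq (Filter.Eventually.of_forall fun y => ?_)
    have h3 := tder_cone_fst (σ y) (V y)
    exact congrArg (fun w => (⟨(σ y).1, w⟩ : TangentBundle (𝓡 m) M)) h3.symm
  have hsnd : ∀ V : E → EuclideanSpace ℝ (Fin m) × ℝ, ContMDiffAt 𝓘(ℝ, E) (coneModel m).tangent ∞
      (fun y => (⟨σ y, V y⟩ : TangentBundle (coneModel m) (Cone M))) z →
      ContMDiffAt 𝓘(ℝ, E) 𝓘(ℝ, ℝ) ∞ (fun y => (V y).2) z := by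
    intro V hV
    have h2 := ((contMDiff_coneT (m := m) (M := M)).contMDiff_tangentMap
      (m := ∞) (by simp)).contMDiffAt.comp z hV
    have h4 := (contMDiff_snd_tangentBundle_modelSpace (n := ∞) ℝ 𝓘(ℝ, ℝ)).contMDiffAt.comp z h2
    refine h4.congr_of_eventuallyEq (Filter.Eventually.of_forall fun y => ?_)
    exact (tder_coneT (σ y) (V y)).symm
  have hg : ContMDiffAt 𝓘(ℝ, E) ((𝓡 m).prod 𝓘(ℝ, EuclideanSpace ℝ (Fin m) →L[ℝ]
      EuclideanSpace ℝ (Fin m) →L[ℝ] ℝ)) ∞ (fun y => Bundle.TotalSpace.mk' 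
        (EuclideanSpace ℝ (Fin m) →L[ℝ] EuclideanSpace ℝ (Fin m) →L[ℝ] ℝ)
        (E := fun x : M => TangentSpace (𝓡 m) x →L[ℝ] TangentSpace (𝓡 m) x →L[ℝ] ℝ)
        (σ y).1 (gM.inner (σ y).1)) z :=
    gM.contMDiff.contMDiffAt.comp z (contMDiff_fst.contMDiffAt.comp z hσ)
  have h5 := ContMDiffAt.clm_bundle_apply₂ (F₁ := EuclideanSpace ℝ (Fin m))
    (F₂ := EuclideanSpace ℝ (Fin m)) (F₃ := ℝ) (E₃ := fun _ : M => ℝ) hg (hfst U hU) (hfst W hW)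
  have h6 : ContMDiffAt 𝓘(ℝ, E) 𝓘(ℝ, ℝ) ∞
      (fun y => metricForm gM (σ y).1 (U y).1 (W y).1) z := by
    have h7 := (Bundle.contMDiffAt_totalSpace).mp h5
    exact h7.2
  have h8 : ContMDiffAt 𝓘(ℝ, E) 𝓘(ℝ, ℝ) ∞ (fun y => coneT (σ y)) z :=
    (contMDiff_coneT (m := m)).contMDiffAt.comp z hσ
  have h9 := (((h8.pow 2).mul h6).add ((hsnd U hU).mul (hsnd W hW)))
  exact h9.contDiffAt

end ConeForm

/-! ### The form `dd^c log t` of a Sasakian cone -/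

theorem comp_vecTwo {α β : Type*} (f : α → β) (u v : α) :
    (fun i => f (![u, v] i)) = ![f u, f v] := by
  ext i
  fin_cases i <;> rfl

theorem hasDerivAt_bilinear_comp {E : Type*} [NormedAddCommGroup E] [NormedSpace ℝ E]
    {B : E → E →L[ℝ] E →L[ℝ] ℝ} {x y w : ℝ → E} {x' y' w' : E} {l : ℝ}
    (hB : DifferentiableAt ℝ B (x l)) (hx : HasDerivAt x x' l) (hy : HasDerivAt y y' l)
    (hw : HasDerivAt w w' l) :
    HasDerivAt (fun r => B (x r) (y r) (w r))
      (fderiv ℝ B (x l) x' (y l) (w l) + B (x l) y' (w l) + B (x l) (y l) w') l := by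
  have h1 : HasDerivAt (fun r => B (x r)) (fderiv ℝ B (x l) x') l :=
    hB.hasFDerivAt.comp_hasDerivAt l hx
  exact (h1.clm_apply hy).clm_apply hw

/-- Euler's identity for a tensor of degree 2: both sides of the hypothesis are differentiated at l
= 1. When `R` is a projection, id + (l - 1)R multiplies its range by l and fixes its kernel, which
is the form the dilation takes in a cone chart. -/
theorem fderiv_add_of_homogeneous {E : Type*} [NormedAddCommGroup E] [NormedSpace ℝ E]
    {B : E → E →L[ℝ] E →L[ℝ] ℝ} {R : E →L[ℝ] E} {z : E} (hB : DifferentiableAt ℝ B z) (u v : E)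
    (h : ∀ᶠ l : ℝ in nhds 1, B (z + (l - 1) • R z) (u + (l - 1) • R u) (v + (l - 1) • R v)
      = l ^ 2 * B z u v) :
    fderiv ℝ B z (R z) u v + B z (R u) v + B z u (R v) = 2 * B z u v := by
  have hγ : ∀ w : E, HasDerivAt (fun l : ℝ => w + (l - 1) • R w) (R w) 1 := fun w => by
    simpa using (((hasDerivAt_id (1 : ℝ)).sub_const 1).smul_const (R w)).const_add w
  have h1 : ∀ w : E, w + ((1 : ℝ) - 1) • R w = w := fun w => by simp
  have h2 := hasDerivAt_bilinear_comp (B := B) (by rw [h1]; exact hB) (hγ z) (hγ u) (hγ v)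
  rw [h1, h1, h1] at h2
  have h3 : HasDerivAt (fun l : ℝ => l ^ 2 * B z u v) (2 * B z u v) 1 := by
    simpa using (hasDerivAt_pow 2 (1 : ℝ)).mul_const (B z u v)
  exact h2.unique (h3.congr_of_eventuallyEq h)

section Sasaki

variable {m : ℕ} {M : Type*} [TopologicalSpace M] [ChartedSpace (EuclideanSpace ℝ (Fin m)) M]

theorem contMDiff_log_coneT :
    ContMDiff (coneModel m) 𝓘(ℝ, ℝ) ∞ (Real.log ∘ coneT : Cone M → ℝ) := fun p =>
  (Real.contDiffAt_log.mpr (coneT_pos p).ne').contMDiffAt.comp p contMDiff_coneT.contMDiffAt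

theorem tder_log_coneT (p : Cone M) (v : EuclideanSpace ℝ (Fin m) × ℝ) :
    tder (coneModel m) 𝓘(ℝ, ℝ) (Real.log ∘ coneT : Cone M → ℝ) p v = (coneT p)⁻¹ * v.2 := by
  have h := Real.hasDerivAt_log (coneT_pos p).ne'
  rw [tder_comp_apply h.differentiableAt.mdifferentiableAt
    (contMDiff_coneT.mdifferentiableAt (by simp)), tder_eq_fderiv, tder_coneT,
    h.hasFDerivAt.fderiv]
  simp [mul_comm]

variable [IsManifold (𝓡 m) ∞ M] (S : SasakianStructure m M)

/-- The complex structure of the cone, as an endomorphism of the model space for each point. -/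
def SasakianStructure.jay (p : Cone M) :
    EuclideanSpace ℝ (Fin m) × ℝ →L[ℝ] EuclideanSpace ℝ (Fin m) × ℝ := S.J p

theorem SasakianStructure.jay_jay (p : Cone M) (v : EuclideanSpace ℝ (Fin m) × ℝ) :
    S.jay p (S.jay p v) = -v := S.kaehler.complex.sq_eq_neg p v

theorem SasakianStructure.coneForm_jay_jay (p : Cone M) (u v : EuclideanSpace ℝ (Fin m) × ℝ) :
    coneForm S.metric p (S.jay p u) (S.jay p v) = coneForm S.metric p u v := by
  exact ((coneMetric_eq S.metric p _ _).symm.trans (S.kaehler.hermitian p u v)).trans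
    (coneMetric_eq S.metric p u v)

theorem SasakianStructure.form_apply (p : Cone M) (u v : EuclideanSpace ℝ (Fin m) × ℝ) :
    S.Ω p ![u, v] = coneForm S.metric p u (S.jay p v) :=
  (S.kaehler.form_eq p u v).trans (coneMetric_eq S.metric p u (S.J p v))

theorem SasakianStructure.coneForm_jay_right (p : Cone M) (u v : EuclideanSpace ℝ (Fin m) × ℝ) :
    coneForm S.metric p u (S.jay p v) = - coneForm S.metric p v (S.jay p u) := by
  rw [← S.coneForm_jay_jay p u, S.jay_jay, map_neg, coneForm_symm]

theorem SasakianStructure.jay_rescale {l : ℝ} (hl : 0 < l) (p : Cone M)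
    (v : EuclideanSpace ℝ (Fin m) × ℝ) :
    tder (coneModel m) (coneModel m) (rescale l) p (S.jay p v)
      = S.jay (rescale l p) (tder (coneModel m) (coneModel m) (rescale l) p v) := by
  have h : (rescale l : Cone M → Cone M) = dilation (toPos l) :=
    funext fun p => rescale_eq_dilation hl p
  rw [h]
  exact S.J_invariant (toPos l) p v

theorem SasakianStructure.form_rescale {l : ℝ} (hl : 0 < l) (p : Cone M)
    (u v : EuclideanSpace ℝ (Fin m) × ℝ) :
    coneForm S.metric (rescale l p) (tder (coneModel m) (coneModel m) (rescale l) p u)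
      (S.jay (rescale l p) (tder (coneModel m) (coneModel m) (rescale l) p v))
      = l ^ 2 * coneForm S.metric p u (S.jay p v) := by
  have h : (rescale l : Cone M → Cone M) = dilation (toPos l) :=
    funext fun p => rescale_eq_dilation hl p
  have h2 := DFunLike.congr_fun (congrFun (S.Ω_automorphic (toPos l)) p) ![u, v]
  rw [← S.form_apply, ← S.form_apply, h]
  have h3 : ((toPos l : ℝ) ^ 2 • S.Ω p) ![u, v] = l ^ 2 * S.Ω p ![u, v] := by
    rw [coe_toPos hl]; rfl
  refine Eq.trans ?_ (h2.trans h3)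
  exact congrArg (S.Ω (dilation (toPos l) p)) (comp_vecTwo _ u v).symm

/-- The fundamental form of the cone in the chart at `p`. -/
def SasakianStructure.chartForm (p : Cone M) (z : EuclideanSpace ℝ (Fin m) × ℝ) :
    EuclideanSpace ℝ (Fin m) × ℝ →L[ℝ] EuclideanSpace ℝ (Fin m) × ℝ →L[ℝ] ℝ :=
  (coneForm S.metric ((extChartAt (coneModel m) p).symm z)).bilinearComp
    (tder 𝓘(ℝ, EuclideanSpace ℝ (Fin m) × ℝ) (coneModel m) (extChartAt (coneModel m) p).symm z)
    ((S.jay ((extChartAt (coneModel m) p).symm z)).comp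
      (tder 𝓘(ℝ, EuclideanSpace ℝ (Fin m) × ℝ) (coneModel m) (extChartAt (coneModel m) p).symm z))

theorem SasakianStructure.chartForm_apply (p : Cone M) (z u v : EuclideanSpace ℝ (Fin m) × ℝ) :
    S.chartForm p z u v = coneForm S.metric ((extChartAt (coneModel m) p).symm z)
      (tder 𝓘(ℝ, EuclideanSpace ℝ (Fin m) × ℝ) (coneModel m)
        (extChartAt (coneModel m) p).symm z u)
      (S.jay ((extChartAt (coneModel m) p).symm z)
        (tder 𝓘(ℝ, EuclideanSpace ℝ (Fin m) × ℝ) (coneModel m)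
          (extChartAt (coneModel m) p).symm z v)) := rfl

theorem SasakianStructure.contDiffOn_chartForm (p : Cone M) :
    ContDiffOn ℝ ∞ (S.chartForm p) (extChartAt (coneModel m) p).target := by
  refine contDiffOn_clm_apply.mpr fun u => contDiffOn_clm_apply.mpr fun v => fun z hz => ?_
  refine ContDiffAt.contDiffWithinAt ?_
  have hu := contMDiffAt_tder_extChartAt_symm hz u
  have hv := contMDiffAt_tder_extChartAt_symm hz v
  refine contMDiffAt_coneForm S.metric hu ?_
  have hJ : ContMDiffAt 𝓘(ℝ, EuclideanSpace ℝ (Fin m) × ℝ)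
      ((coneModel m).prod 𝓘(ℝ, EuclideanSpace ℝ (Fin m) × ℝ →L[ℝ] EuclideanSpace ℝ (Fin m) × ℝ)) ∞
      (fun y => Bundle.TotalSpace.mk'
        (EuclideanSpace ℝ (Fin m) × ℝ →L[ℝ] EuclideanSpace ℝ (Fin m) × ℝ)
        (E := fun x : Cone M => TangentSpace (coneModel m) x →L[ℝ] TangentSpace (coneModel m) x)
        ((extChartAt (coneModel m) p).symm y) (S.J ((extChartAt (coneModel m) p).symm y))) z :=
    S.kaehler.complex.smooth.contMDiffAt.comp z (contMDiffAt_extChartAt_symm hz)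
  exact ContMDiffAt.clm_bundle_apply (F₁ := EuclideanSpace ℝ (Fin m) × ℝ)
    (F₂ := EuclideanSpace ℝ (Fin m) × ℝ) hJ hv

theorem SasakianStructure.chartForm_swap (p : Cone M) (z u v : EuclideanSpace ℝ (Fin m) × ℝ) :
    S.chartForm p z u v = - S.chartForm p z v u := S.coneForm_jay_right _ _ _

theorem SasakianStructure.chartForm_self (p : Cone M) (u v : EuclideanSpace ℝ (Fin m) × ℝ) :
    S.chartForm p (extChartAt (coneModel m) p p) u v = coneForm S.metric p u (S.jay p v) := by
  rw [S.chartForm_apply, tder_extChartAt_symm_self, tder_extChartAt_symm_self,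
    extChartAt_to_inv]

theorem SasakianStructure.chartForm_closed (p : Cone M)
    (a b c : EuclideanSpace ℝ (Fin m) × ℝ) :
    fderiv ℝ (S.chartForm p) (extChartAt (coneModel m) p p) a b c
      - fderiv ℝ (S.chartForm p) (extChartAt (coneModel m) p p) b a c
      + fderiv ℝ (S.chartForm p) (extChartAt (coneModel m) p p) c a b = 0 := by
  have h1 := (S.contDiffOn_chartForm p).contDiffAt
    (extChartAt_target_mem_nhds_of_mem (mem_extChartAt_target (I := coneModel m) p))
  rw [← extDeriv_apply_of_bilinear (α := Form.inChart (coneModel m) S.Ω p)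
    (h1.differentiableAt (by simp)) (Filter.Eventually.of_forall fun y u v => ?_)]
  · rw [← Form.d_apply, S.kaehler.closed p]
    rfl
  · rw [Form.inChart_apply, S.chartForm_apply, ← S.form_apply]
    exact congrArg (S.Ω _) (comp_vecTwo _ u v)

theorem SasakianStructure.chartForm_rescale (p : Cone M) {z : EuclideanSpace ℝ (Fin m) × ℝ}
    (hz : z ∈ (extChartAt (coneModel m) p).target) {l : ℝ} (hl : 0 < l)
    (u v : EuclideanSpace ℝ (Fin m) × ℝ) :
    S.chartForm p (z.1, l * z.2) (u.1, l * u.2) (v.1, l * v.2) = l ^ 2 * S.chartForm p z u v := by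
  have hz2 := (mem_coneChart_target.mp hz).2
  rw [S.chartForm_apply, S.chartForm_apply, ← S.form_rescale hl,
    tder_rescale_coneChart_symm hz hl, tder_rescale_coneChart_symm hz hl,
    rescale_coneChart_symm hz2 hl]

/-- The projection of the model space of the cone to the radial direction. -/
def radialProj (m : ℕ) : EuclideanSpace ℝ (Fin m) × ℝ →L[ℝ] EuclideanSpace ℝ (Fin m) × ℝ :=
  (ContinuousLinearMap.inr ℝ (EuclideanSpace ℝ (Fin m)) ℝ).comp (ContinuousLinearMap.snd ℝ _ _)

theorem radialProj_apply (w : EuclideanSpace ℝ (Fin m) × ℝ) : radialProj m w = (0, w.2) := rfl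

/-- The Lie derivative of Ω along R is 2Ω, written in a chart. There R is the linear vector field
`radialProj`, so it equals its own derivative, whence the last two terms on the left. -/
theorem SasakianStructure.fderiv_chartForm_radial (p : Cone M)
    {z : EuclideanSpace ℝ (Fin m) × ℝ}
    (hz : z ∈ (extChartAt (coneModel m) p).target) (u v : EuclideanSpace ℝ (Fin m) × ℝ) :
    fderiv ℝ (S.chartForm p) z (radialProj m z) u v + S.chartForm p z (radialProj m u) v
      + S.chartForm p z u (radialProj m v) = 2 * S.chartForm p z u v := by
  refine fderiv_add_of_homogeneous (((S.contDiffOn_chartForm p).contDiffAt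
      (extChartAt_target_mem_nhds_of_mem hz)).differentiableAt (by simp)) u v ?_
  filter_upwards [Ioi_mem_nhds one_pos] with l hl
  have h : ∀ w : EuclideanSpace ℝ (Fin m) × ℝ, w + (l - 1) • radialProj m w = (w.1, l * w.2) := by
    intro w
    rw [radialProj_apply]
    refine Prod.ext (by simp) ?_
    change w.2 + (l - 1) * w.2 = l * w.2
    ring
  rw [h, h, h]
  exact S.chartForm_rescale p hz hl u v

/-- The `2`-form `dd^c log t` of a Sasakian cone. -/
theorem SasakianStructure.coneOmegaZero_apply (p : Cone M)
    (u v : EuclideanSpace ℝ (Fin m) × ℝ) :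
    S.coneOmegaZero p ![u, v] = 2 * (coneT p)⁻¹ ^ 2 * (coneForm S.metric p u (S.jay p v)
      - (u.2 * (S.jay p v).2 - v.2 * (S.jay p u).2)) := by
  set e := extChartAt (coneModel m) p with he
  set z₀ := e p with hz₀
  have hz₀t : z₀ ∈ e.target := mem_extChartAt_target (I := coneModel m) p
  have hz₀2 : z₀.2 = coneT p := by rw [hz₀, he, coneChart_self]
  have ht := coneT_pos p
  -- the contraction of the fundamental form with the radial field, times `t⁻²`
  set β : EuclideanSpace ℝ (Fin m) × ℝ → EuclideanSpace ℝ (Fin m) × ℝ →L[ℝ] ℝ :=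
    fun z => (z.2 ^ 2)⁻¹ • S.chartForm p z (radialProj m z) with hβ
  -- ι_RΩ = g(R, J·) = t · dt∘J, because R is t times the unit radial vector and is orthogonal to
  -- the base directions.
  have hβv : ∀ z ∈ e.target, ∀ v, S.chartForm p z (radialProj m z) v
      = z.2 * (S.jay (e.symm z) (tder 𝓘(ℝ, EuclideanSpace ℝ (Fin m) × ℝ) (coneModel m)
          e.symm z v)).2 := by
    intro z hz v
    rw [S.chartForm_apply, radialProj_apply, tder_coneChart_symm_radial hz, coneForm_apply]
    rw [show ((0, z.2) : EuclideanSpace ℝ (Fin m) × ℝ).1 = 0 from rfl, map_zero,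
      zero_apply, mul_zero, zero_add]
  have hB : HasFDerivAt (S.chartForm p) (fderiv ℝ (S.chartForm p) z₀) z₀ :=
    (((S.contDiffOn_chartForm p).contDiffAt
      (extChartAt_target_mem_nhds_of_mem hz₀t)).differentiableAt (by simp)).hasFDerivAt
  have hs : HasFDerivAt (fun z : EuclideanSpace ℝ (Fin m) × ℝ => (z.2 ^ 2)⁻¹)
      ((-2 * (coneT p)⁻¹ ^ 3) • ContinuousLinearMap.snd ℝ (EuclideanSpace ℝ (Fin m)) ℝ) z₀ := by
    have h1 : HasDerivAt (fun s : ℝ => (s ^ 2)⁻¹) (-2 * (coneT p)⁻¹ ^ 3) z₀.2 := by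
      have h2 := (hasDerivAt_pow 2 z₀.2).inv (pow_ne_zero 2 (by rw [hz₀2]; exact ht.ne'))
      refine h2.congr_deriv ?_
      rw [hz₀2]
      field_simp
      norm_num
      ring
    exact h1.comp_hasFDerivAt z₀ hasFDerivAt_snd
  have hβd : HasFDerivAt β _ z₀ := hs.smul (hB.clm_apply (radialProj m).hasFDerivAt)
  -- d^c log t = t⁻¹ dt∘J = t⁻² ι_RΩ.
  have hinch : Form.inChart (coneModel m) (dc (coneModel m) S.J
      (fun p => Real.log (coneT p))) p =ᶠ[nhds z₀] fun z =>
      ContinuousAlternatingMap.ofSubsingleton ℝ (EuclideanSpace ℝ (Fin m) × ℝ) ℝ (0 : Fin 1)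
        (β z) := by
    filter_upwards [extChartAt_target_mem_nhds_of_mem hz₀t] with z hz
    ext w
    rw [Form.inChart_apply]
    change tder (coneModel m) 𝓘(ℝ, ℝ) (Real.log ∘ coneT) (e.symm z)
      (S.jay (e.symm z) (tder 𝓘(ℝ, EuclideanSpace ℝ (Fin m) × ℝ) (coneModel m)
        e.symm z (w 0))) = (z.2 ^ 2)⁻¹ * S.chartForm p z (radialProj m z) (w 0)
    have hpos := (mem_coneChart_target.mp hz).2
    have hc : coneT (e.symm z) = z.2 := coneT_coneChart_symm hpos
    rw [hβv z hz, tder_log_coneT, hc]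
    field_simp
  have hmain : S.coneOmegaZero p ![u, v] = fderiv ℝ β z₀ u v - fderiv ℝ β z₀ v u := by
    refine (Form.d_apply (dc (coneModel m) S.J (fun p => Real.log (coneT p))) p ![u, v]).trans ?_
    rw [Filter.EventuallyEq.extDeriv_eq hinch,
      extDeriv_ofSubsingleton_apply hβd.differentiableAt]
  have hval : ∀ a b, fderiv ℝ β z₀ a b = (z₀.2 ^ 2)⁻¹ *
      (fderiv ℝ (S.chartForm p) z₀ a (radialProj m z₀) b + S.chartForm p z₀ (radialProj m a) b)
      + (-2 * (coneT p)⁻¹ ^ 3) * a.2 * S.chartForm p z₀ (radialProj m z₀) b := by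
    intro a b
    rw [hβd.fderiv]
    simp
    ring
  have hclosed := S.chartForm_closed p (radialProj m z₀) u v
  have hrad := S.fderiv_chartForm_radial p hz₀t u v
  have hsw := S.chartForm_swap p z₀ u (radialProj m v)
  rw [hmain, hval, hval, hβv z₀ hz₀t, hβv z₀ hz₀t]
  have e1 : e.symm z₀ = p := extChartAt_to_inv p
  rw [e1, tder_extChartAt_symm_self, tder_extChartAt_symm_self, hz₀2, ← S.chartForm_self p]
  change fderiv ℝ (S.chartForm p) z₀ (radialProj m z₀) u v - fderiv ℝ (S.chartForm p) z₀ u (radialProj m z₀) v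
    + fderiv ℝ (S.chartForm p) z₀ v (radialProj m z₀) u = 0 at hclosed
  change _ = 2 * (coneT p)⁻¹ ^ 2 * (S.chartForm p z₀ u v - _)
  -- Cartan's formula: since dΩ = 0, d(ι_RΩ) is the Lie derivative of Ω along R, which is 2Ω. The
  -- remaining term of dβ comes from differentiating the factor t⁻² and gives -2t⁻² dt ∧ (dt∘J).
  have hx : fderiv ℝ (S.chartForm p) z₀ u (radialProj m z₀) v + S.chartForm p z₀ (radialProj m u) v
      - (fderiv ℝ (S.chartForm p) z₀ v (radialProj m z₀) u + S.chartForm p z₀ (radialProj m v) u)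
      = 2 * S.chartForm p z₀ u v := by linarith
  have : S.chartForm p z₀ u v = (fderiv ℝ (S.chartForm p) z₀ u (radialProj m z₀) v
      + S.chartForm p z₀ (radialProj m u) v - (fderiv ℝ (S.chartForm p) z₀ v (radialProj m z₀) u
      + S.chartForm p z₀ (radialProj m v) u)) / 2 := by linarith
  rw [this]
  field_simp
  ring

end Sasaki

/-! ### Holomorphic coordinates on a Sasakian cone -/

theorem two_le_infty : (2 : WithTop ℕ∞) ≤ (∞ : WithTop ℕ∞) := by
  exact WithTop.coe_le_coe.mpr (le_top : (2 : ℕ∞) ≤ ⊤)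

section Coordinates

variable {m : ℕ} {M : Type*} [TopologicalSpace M] [ChartedSpace (EuclideanSpace ℝ (Fin m)) M]
  [IsManifold (𝓡 m) ∞ M] {W : Type*} [NormedAddCommGroup W] [NormedSpace ℝ W]

/-- `F` is a holomorphic coordinate system near the point `p` of a Sasakian cone, with values in
a vector space with complex structure `J₀`, and `σ` is the inverse of `F`. -/
structure IsCoordinate (S : SasakianStructure m M) (J₀ : W →L[ℝ] W) (F : Cone M → W)
    (σ : W → Cone M) (p : Cone M) : Prop where
  smooth : ∀ᶠ x in nhds p, ContMDiffAt (coneModel m) 𝓘(ℝ, W) ∞ F x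
  smooth_symm : ∀ᶠ z in nhds (F p), ContMDiffAt 𝓘(ℝ, W) (coneModel m) ∞ σ z
  left_inv : ∀ᶠ x in nhds p, σ (F x) = x
  right_inv : ∀ᶠ z in nhds (F p), F (σ z) = z
  holomorphic : ∀ᶠ x in nhds p, ∀ v, tder (coneModel m) 𝓘(ℝ, W) F x (S.jay x v)
    = J₀ (tder (coneModel m) 𝓘(ℝ, W) F x v)

namespace IsCoordinate

variable {S : SasakianStructure m M} {J₀ : W →L[ℝ] W} {F : Cone M → W} {σ : W → Cone M}
  {p : Cone M} (h : IsCoordinate S J₀ F σ p)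
include h

theorem contMDiffAt : ContMDiffAt (coneModel m) 𝓘(ℝ, W) ∞ F p := h.smooth.self_of_nhds

theorem contMDiffAt_symm : ContMDiffAt 𝓘(ℝ, W) (coneModel m) ∞ σ (F p) :=
  h.smooth_symm.self_of_nhds

theorem symm_apply : σ (F p) = p := h.left_inv.self_of_nhds

/-- Every condition is imposed on a neighbourhood, so it persists at nearby points. This is what
permits the identities below to be differentiated. -/
theorem eventually : ∀ᶠ x in nhds p, IsCoordinate S J₀ F σ x := by
  have hc := h.contMDiffAt.continuousAt
  filter_upwards [h.smooth.eventually_nhds, hc.eventually h.smooth_symm.eventually_nhds,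
    h.left_inv.eventually_nhds, hc.eventually h.right_inv.eventually_nhds,
    h.holomorphic.eventually_nhds] with x h1 h2 h3 h4 h5
  exact ⟨h1, h2, h3, h4, h5⟩

theorem eventually_symm : ∀ᶠ z in nhds (F p), IsCoordinate S J₀ F σ (σ z) ∧ F (σ z) = z := by
  have hc : Filter.Tendsto σ (nhds (F p)) (nhds p) := by
    have := h.contMDiffAt_symm.continuousAt
    rwa [ContinuousAt, h.symm_apply] at this
  exact (hc.eventually h.eventually).and h.right_inv

theorem tder_symm_tder (v : EuclideanSpace ℝ (Fin m) × ℝ) :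
    tder 𝓘(ℝ, W) (coneModel m) σ (F p) (tder (coneModel m) 𝓘(ℝ, W) F p v) = v := by
  rw [← tder_comp_apply (h.contMDiffAt_symm.mdifferentiableAt (by simp))
    (h.contMDiffAt.mdifferentiableAt (by simp)), tder_congr (f := σ ∘ F) (g := id) h.left_inv, tder_id]
  rfl

theorem tder_tder_symm (w : W) :
    tder (coneModel m) 𝓘(ℝ, W) F p (tder 𝓘(ℝ, W) (coneModel m) σ (F p) w) = w := by
  have h1 : MDifferentiableAt (coneModel m) 𝓘(ℝ, W) F (σ (F p)) := by
    rw [h.symm_apply]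
    exact h.contMDiffAt.mdifferentiableAt (by simp)
  have h2 := tder_comp_apply h1 (h.contMDiffAt_symm.mdifferentiableAt (by simp)) w
  rw [tder_congr (f := F ∘ σ) (g := id) h.right_inv, tder_id, h.symm_apply] at h2
  exact h2.symm

theorem tder_symm_mul (w : W) :
    tder 𝓘(ℝ, W) (coneModel m) σ (F p) (J₀ w)
      = S.jay p (tder 𝓘(ℝ, W) (coneModel m) σ (F p) w) := by
  have h1 := h.holomorphic.self_of_nhds (tder 𝓘(ℝ, W) (coneModel m) σ (F p) w)
  rw [h.tder_tder_symm] at h1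
  rw [← h1, h.tder_symm_tder]

/-- The function `log t` in the coordinates. -/
theorem contDiffAt_log : ContDiffAt ℝ ∞ (Real.log ∘ coneT ∘ σ) (F p) :=
  (ContMDiffAt.comp (F p) (contMDiff_log_coneT.contMDiffAt (x := σ (F p)))
    h.contMDiffAt_symm).contDiffAt

theorem fderiv_log (v : EuclideanSpace ℝ (Fin m) × ℝ) :
    fderiv ℝ (Real.log ∘ coneT ∘ σ) (F p) (tder (coneModel m) 𝓘(ℝ, W) F p v)
      = (coneT p)⁻¹ * v.2 := by
  have h1 := tder_comp_apply (contMDiff_log_coneT.mdifferentiableAt (x := σ (F p)) (by simp))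
    (h.contMDiffAt_symm.mdifferentiableAt (by simp)) (tder (coneModel m) 𝓘(ℝ, W) F p v)
  rw [tder_log_coneT, h.tder_symm_tder, tder_eq_fderiv, h.symm_apply] at h1
  exact h1

/-- In holomorphic coordinates the complex structure is the constant J₀, so d^cφ = dφ∘J₀, and its
exterior derivative involves only the second derivative of φ. The form is defined in the real
product chart of the cone, hence the passage through the transition map `G`. -/
theorem coneOmegaZero_eq (u v : EuclideanSpace ℝ (Fin m) × ℝ) :
    S.coneOmegaZero p ![u, v]
      = fderiv ℝ (fderiv ℝ (Real.log ∘ coneT ∘ σ)) (F p) (tder (coneModel m) 𝓘(ℝ, W) F p u)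
          (J₀ (tder (coneModel m) 𝓘(ℝ, W) F p v))
        - fderiv ℝ (fderiv ℝ (Real.log ∘ coneT ∘ σ)) (F p) (tder (coneModel m) 𝓘(ℝ, W) F p v)
          (J₀ (tder (coneModel m) 𝓘(ℝ, W) F p u)) := by
  set φ : W → ℝ := Real.log ∘ coneT ∘ σ with hφ
  set e := extChartAt (coneModel m) p with he
  set z₀ := e p with hz₀
  have hz₀t : z₀ ∈ e.target := mem_extChartAt_target (I := coneModel m) p
  have hez : e.symm z₀ = p := extChartAt_to_inv p
  set G : EuclideanSpace ℝ (Fin m) × ℝ → W := F ∘ e.symm with hG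
  have hGz : G z₀ = F p := by rw [hG, Function.comp_apply, hez]
  have htend : Filter.Tendsto e.symm (nhds z₀) (nhds p) := by
    have := (contMDiffAt_extChartAt_symm hz₀t).continuousAt
    rwa [ContinuousAt, ← he, hez] at this
  have hGd : ContDiffAt ℝ ∞ G z₀ := by
    refine (ContMDiffAt.comp z₀ (I' := coneModel m) ?_ (contMDiffAt_extChartAt_symm hz₀t)).contDiffAt
    rw [← he, hez]
    exact h.contMDiffAt
  have hGtder : ∀ᶠ z in nhds z₀, ∀ w, tder (coneModel m) 𝓘(ℝ, W) F (e.symm z)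
      (tder 𝓘(ℝ, EuclideanSpace ℝ (Fin m) × ℝ) (coneModel m) e.symm z w) = fderiv ℝ G z w := by
    filter_upwards [extChartAt_target_mem_nhds_of_mem hz₀t, htend.eventually h.smooth]
      with z hz h1 w
    rw [← tder_comp_apply (h1.mdifferentiableAt (by simp))
      ((contMDiffAt_extChartAt_symm hz).mdifferentiableAt (by simp)), tder_eq_fderiv]
  have hGself : ∀ w, fderiv ℝ G z₀ w = tder (coneModel m) 𝓘(ℝ, W) F p w := by
    intro w
    rw [← hGtder.self_of_nhds w, tder_extChartAt_symm_self, hez]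
  set B : EuclideanSpace ℝ (Fin m) × ℝ → EuclideanSpace ℝ (Fin m) × ℝ →L[ℝ] ℝ :=
    fun z => (fderiv ℝ φ (G z)).comp (J₀.comp (fderiv ℝ G z)) with hB
  have hφd : HasFDerivAt (fderiv ℝ φ) (fderiv ℝ (fderiv ℝ φ) (F p)) (G z₀) := by
    rw [hGz]
    exact ((h.contDiffAt_log.fderiv_right (m := ∞) (by simp)).differentiableAt
      (by simp)).hasFDerivAt
  have h1 : HasFDerivAt (fun z => fderiv ℝ φ (G z))
      ((fderiv ℝ (fderiv ℝ φ) (F p)).comp (fderiv ℝ G z₀)) z₀ :=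
    hφd.comp z₀ (hGd.differentiableAt (by simp)).hasFDerivAt
  have h2 : HasFDerivAt (fderiv ℝ G) (fderiv ℝ (fderiv ℝ G) z₀) z₀ :=
    ((hGd.fderiv_right (m := ∞) (by simp)).differentiableAt (by simp)).hasFDerivAt
  have hBd := h1.clm_comp ((hasFDerivAt_const J₀ z₀).clm_comp h2)
  have hinch : Form.inChart (coneModel m) (dc (coneModel m) S.J
      (fun p => Real.log (coneT p))) p =ᶠ[nhds z₀] fun z =>
      ContinuousAlternatingMap.ofSubsingleton ℝ (EuclideanSpace ℝ (Fin m) × ℝ) ℝ (0 : Fin 1)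
        (B z) := by
    filter_upwards [htend.eventually h.eventually, hGtder] with z hz h3
    ext w
    rw [Form.inChart_apply]
    change tder (coneModel m) 𝓘(ℝ, ℝ) (Real.log ∘ coneT) (e.symm z)
      (S.jay (e.symm z) (tder 𝓘(ℝ, EuclideanSpace ℝ (Fin m) × ℝ) (coneModel m)
        e.symm z (w 0))) = fderiv ℝ φ (G z) (J₀ (fderiv ℝ G z (w 0)))
    rw [← h3, ← hz.holomorphic.self_of_nhds]
    change _ = fderiv ℝ φ (F (e.symm z)) _
    rw [hz.fderiv_log, tder_log_coneT]
  refine (Form.d_apply (dc (coneModel m) S.J (fun p => Real.log (coneT p))) p ![u, v]).trans ?_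
  rw [Filter.EventuallyEq.extDeriv_eq hinch, extDeriv_ofSubsingleton_apply hBd.differentiableAt]
  have hval : ∀ a b, fderiv ℝ B z₀ a b
      = fderiv ℝ (fderiv ℝ φ) (F p) (fderiv ℝ G z₀ a) (J₀ (fderiv ℝ G z₀ b))
        + fderiv ℝ φ (F p) (J₀ (fderiv ℝ (fderiv ℝ G) z₀ a b)) := by
    intro a b
    have hBd' : HasFDerivAt B _ z₀ := hBd
    rw [hBd'.fderiv]
    simp [hGz]
    ring
  -- The second derivative of the transition map is symmetric, so it cancels on antisymmetrisation.
  have hsymm : fderiv ℝ (fderiv ℝ G) z₀ u v = fderiv ℝ (fderiv ℝ G) z₀ v u :=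
    (hGd.isSymmSndFDerivAt (by rw [minSmoothness_of_isRCLikeNormedField]; exact two_le_infty)) u v
  rw [hval, hval, hsymm, hGself, hGself]
  ring

/-- The radial vector field in the coordinates. -/
theorem contDiffAt_radial_and_commute {T : W → W}
    (hT : ∀ᶠ x in nhds p, T (F x) = tder (coneModel m) 𝓘(ℝ, W) F x (radial m x)) :
    ContDiffAt ℝ ∞ T (F p) ∧ ∀ w, fderiv ℝ T (F p) (J₀ w) = J₀ (fderiv ℝ T (F p) w) := by
  -- Φ(l, ·) is the dilation h_l in the coordinates. It is holomorphic for each l, and the radial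
  -- field is its derivative in l at l = 1. Interchanging the mixed derivatives, D(∂_lΦ) = ∂_l(DΦ)
  -- is a derivative of complex-linear maps, hence complex linear.
  set Φ : ℝ × W → W := fun a => F (rescale a.1 (σ a.2)) with hΦ
  have hresc : ∀ a : ℝ × W, 0 < a.1 → ContMDiffAt 𝓘(ℝ, W) (coneModel m) ∞ σ a.2 →
      ContMDiffAt 𝓘(ℝ, ℝ × W) (coneModel m) ∞ (fun a : ℝ × W => rescale a.1 (σ a.2)) a := by
    intro a ha hσ
    have h1 : ContMDiffAt 𝓘(ℝ, ℝ × W) 𝓘(ℝ, ℝ) ∞ (Prod.fst : ℝ × W → ℝ) a :=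
      contDiff_fst.contMDiff.contMDiffAt
    have h2 : ContMDiffAt 𝓘(ℝ, ℝ × W) 𝓘(ℝ, W) ∞ (Prod.snd : ℝ × W → W) a :=
      contDiff_snd.contMDiff.contMDiffAt
    exact ContMDiffAt.comp (I' := 𝓘(ℝ, ℝ).prod (coneModel m)) a
      (contMDiffAt_rescale ha (σ a.2)) (h1.prodMk (hσ.comp a h2))
  have hsmooth : ∀ a : ℝ × W, 0 < a.1 → ContMDiffAt 𝓘(ℝ, W) (coneModel m) ∞ σ a.2 →
      ContMDiffAt (coneModel m) 𝓘(ℝ, W) ∞ F (rescale a.1 (σ a.2)) → ContDiffAt ℝ ∞ Φ a := by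
    intro a ha hσ hF
    exact (ContMDiffAt.comp a hF (hresc a ha hσ)).contDiffAt
  have hone : ∀ x, IsCoordinate S J₀ F σ x → ContDiffAt ℝ ∞ Φ (1, F x) := by
    intro x hx
    refine hsmooth (1, F x) one_pos hx.contMDiffAt_symm ?_
    change ContMDiffAt _ _ _ F (rescale 1 (σ (F x)))
    rw [hx.symm_apply, rescale_one]
    exact hx.contMDiffAt
  have hTΦ : T =ᶠ[nhds (F p)] fun z => fderiv ℝ Φ (1, z) (1, 0) := by
    have hc : Filter.Tendsto σ (nhds (F p)) (nhds p) := by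
      have := h.contMDiffAt_symm.continuousAt
      rwa [ContinuousAt, h.symm_apply] at this
    filter_upwards [h.eventually_symm, hc.eventually hT] with z hz hTz
    set x := σ z with hx
    have hFx : F x = z := hz.2
    rw [hFx] at hTz
    have h1 : HasFDerivAt (fun l : ℝ => Φ (l, z))
        ((fderiv ℝ Φ (1, z)).comp (ContinuousLinearMap.inl ℝ ℝ W)) 1 := by
      have h2 := ((hone x hz.1).differentiableAt (by simp)).hasFDerivAt
      rw [hFx] at h2
      exact HasFDerivAt.comp (g := Φ) (1 : ℝ) h2 (hasFDerivAt_prodMk_left (𝕜 := ℝ) (1 : ℝ) z)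
    have hr1 : ray x.1 ((1 : ℝ) * coneT x) = x := by
      rw [one_mul]
      exact Prod.ext rfl (toPos_coe x.2)
    have h3 : tder 𝓘(ℝ, ℝ) 𝓘(ℝ, W) (F ∘ ray x.1 ∘ fun l : ℝ => l * coneT x) 1 1
        = tder (coneModel m) 𝓘(ℝ, W) F x (radial m x) := by
      have h4 : HasDerivAt (fun l : ℝ => l * coneT x) (coneT x) 1 := by
        simpa using (hasDerivAt_id (1 : ℝ)).mul_const (coneT x)
      have hpos : 0 < (1 : ℝ) * coneT x := by rw [one_mul]; exact coneT_pos x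
      have h5 := (contMDiffAt_ray (m := m) x.1 hpos).mdifferentiableAt (by simp)
      have h6 := h5.comp (1 : ℝ) h4.differentiableAt.mdifferentiableAt
      have h7 : MDifferentiableAt (coneModel m) 𝓘(ℝ, W) F (ray x.1 ((1 : ℝ) * coneT x)) := by
        rw [hr1]
        exact hz.1.contMDiffAt.mdifferentiableAt (by simp)
      have h8 := tder_comp_apply (f := ray x.1 ∘ fun l : ℝ => l * coneT x) (x := (1 : ℝ)) h7 h6 1
      have h9 := tder_comp_apply (f := fun l : ℝ => l * coneT x) (x := (1 : ℝ)) h5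
        h4.differentiableAt.mdifferentiableAt 1
      have h10 : tder 𝓘(ℝ, ℝ) 𝓘(ℝ, ℝ) (fun l : ℝ => l * coneT x) 1 1 = coneT x • (1 : ℝ) := by
        rw [tder_eq_fderiv, h4.hasFDerivAt.fderiv]
        simp
      rw [h9, h10, map_smul, tder_ray x.1 hpos] at h8
      refine h8.trans ?_
      change tder (coneModel m) 𝓘(ℝ, W) F (ray x.1 ((1 : ℝ) * coneT x)) _ = _
      rw [hr1]
      congr 1
      exact Prod.ext (smul_zero _) (mul_one _)
    rw [hTz, ← h3, tder_eq_fderiv]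
    exact DFunLike.congr_fun h1.fderiv 1
  have hΦ₀ := hone p h
  have hΦ₁ : HasFDerivAt (fderiv ℝ Φ) (fderiv ℝ (fderiv ℝ Φ) (1, F p)) (1, F p) :=
    ((hΦ₀.fderiv_right (m := ∞) (by simp)).differentiableAt (by simp)).hasFDerivAt
  -- The derivative of the radial field in the direction w is a mixed second derivative of Φ.
  have hTd : ∀ w, fderiv ℝ T (F p) w = fderiv ℝ (fderiv ℝ Φ) (1, F p) (0, w) (1, 0) := by
    intro w
    have h1 := (hΦ₁.comp (F p) (hasFDerivAt_prodMk_right (1 : ℝ) (F p))).clm_apply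
      (hasFDerivAt_const ((1 : ℝ), (0 : W)) (F p))
    have h2 := h1.congr_of_eventuallyEq hTΦ
    rw [h2.fderiv]
    simp
  have hsymm : ∀ w, fderiv ℝ (fderiv ℝ Φ) (1, F p) (0, w) (1, 0)
      = fderiv ℝ (fderiv ℝ Φ) (1, F p) (1, 0) (0, w) := fun w =>
    hΦ₀.isSymmSndFDerivAt (by rw [minSmoothness_of_isRCLikeNormedField]; exact two_le_infty) _ _
  have hhol : ∀ᶠ a in nhds ((1 : ℝ), F p), ∀ w, fderiv ℝ Φ a (0, J₀ w)
      = J₀ (fderiv ℝ Φ a (0, w)) := by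
    have hc : Filter.Tendsto (fun a : ℝ × W => rescale a.1 (σ a.2)) (nhds (1, F p)) (nhds p) := by
      have := (hresc (1, F p) one_pos h.contMDiffAt_symm).continuousAt
      rwa [ContinuousAt, h.symm_apply, rescale_one] at this
    have hfst : ∀ᶠ a in nhds ((1 : ℝ), F p), 0 < a.1 :=
      continuousAt_fst.eventually (Ioi_mem_nhds one_pos)
    have hsnd := (continuousAt_snd (p := ((1 : ℝ), F p))).eventually h.eventually_symm
    filter_upwards [hfst, hsnd, hc.eventually h.eventually] with a ha hz hr
    obtain ⟨hz, hFz⟩ := hz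
    have hσ : ContMDiffAt 𝓘(ℝ, W) (coneModel m) ∞ σ a.2 := by
      have := hz.contMDiffAt_symm
      rwa [hFz] at this
    have hder : ∀ w, fderiv ℝ Φ a (0, w) = tder (coneModel m) 𝓘(ℝ, W) F (rescale a.1 (σ a.2))
        (tder (coneModel m) (coneModel m) (rescale a.1) (σ a.2)
          (tder 𝓘(ℝ, W) (coneModel m) σ a.2 w)) := by
      intro w
      have h1 : HasFDerivAt (fun z : W => Φ (a.1, z))
          ((fderiv ℝ Φ a).comp (ContinuousLinearMap.inr ℝ ℝ W)) a.2 :=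
        HasFDerivAt.comp (g := Φ) a.2 ((hsmooth a ha hσ hr.contMDiffAt).differentiableAt
          (by simp)).hasFDerivAt (hasFDerivAt_prodMk_right a.1 a.2)
      have h2 := (contMDiffAt_rescale_right (m := m) ha (σ a.2)).mdifferentiableAt (by simp)
      have h3 := hσ.mdifferentiableAt (by simp)
      have h4 := tder_comp_apply (f := rescale a.1 ∘ σ) (x := a.2) (g := F)
        (hr.contMDiffAt.mdifferentiableAt (by simp)) (h2.comp a.2 h3) w
      rw [tder_comp_apply h2 h3, tder_eq_fderiv] at h4
      exact (DFunLike.congr_fun h1.fderiv w).symm.trans h4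
    intro w
    have h4 := hz.tder_symm_mul w
    rw [hFz] at h4
    rw [hder, hder, h4, S.jay_rescale ha, hr.holomorphic.self_of_nhds]
  refine ⟨?_, fun w => ?_⟩
  · refine ContDiffAt.congr_of_eventuallyEq ?_ hTΦ
    exact (ContDiffAt.comp (g := fderiv ℝ Φ) (F p) (hΦ₀.fderiv_right (m := ∞) (by simp))
      (contDiffAt_const.prodMk contDiffAt_id)).clm_apply contDiffAt_const
  · rw [hTd, hTd, hsymm, hsymm]
    have h1 : ∀ w, HasFDerivAt (fun a => fderiv ℝ Φ a (0, w))
        ((fderiv ℝ (fderiv ℝ Φ) (1, F p)).flip (0, w)) (1, F p) := fun w =>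
      (hΦ₁.clm_apply (hasFDerivAt_const ((0 : ℝ), w) (1, F p))).congr_fderiv (by ext <;> simp)
    have h2 := (J₀.hasFDerivAt.comp ((1 : ℝ), F p) (h1 w)).congr_of_eventuallyEq
      (f₁ := fun a => fderiv ℝ Φ a (0, J₀ w)) (by
        filter_upwards [hhol] with a ha using ha w)
    exact DFunLike.congr_fun ((h1 (J₀ w)).unique h2) (1, 0)

theorem fderiv_log_radial : fderiv ℝ (Real.log ∘ coneT ∘ σ) (F p)
    (tder (coneModel m) 𝓘(ℝ, W) F p (radial m p)) = 1 := by
  rw [h.fderiv_log]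
  exact inv_mul_cancel₀ (coneT_pos p).ne'

/-- dt(JR) = t⁻¹ g(R, JR) = t⁻¹ Ω(R, R) = 0. -/
theorem fderiv_log_mul_radial : fderiv ℝ (Real.log ∘ coneT ∘ σ) (F p)
    (J₀ (tder (coneModel m) 𝓘(ℝ, W) F p (radial m p))) = 0 := by
  rw [← h.holomorphic.self_of_nhds, h.fderiv_log]
  have h1 := S.coneForm_jay_right p (radial m p) (radial m p)
  have h2 : coneForm S.metric p (radial m p) (S.jay p (radial m p))
      = coneT p * (S.jay p (radial m p)).2 := by
    rw [coneForm_apply]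
    simp [radial]
  have h3 : coneT p * (S.jay p (radial m p)).2 = 0 := by rw [← h2]; linarith
  rw [(mul_eq_zero.mp h3).resolve_left (coneT_pos p).ne', mul_zero]

end IsCoordinate

end Coordinates

/-! ### The divergence theorem on a compact manifold -/

section Divergence

open MeasureTheory

variable {E : Type*} [NormedAddCommGroup E] [NormedSpace ℝ E] [FiniteDimensional ℝ E]

theorem trace_eq_sum_coord {ι : Type*} [Fintype ι] (b : Module.Basis ι ℝ E) (L : E →ₗ[ℝ] E) :
    LinearMap.trace ℝ E L = ∑ i, b.coord i (L (b i)) := by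
  classical
  rw [LinearMap.trace_eq_matrix_trace ℝ b, Matrix.trace]
  simp [LinearMap.toMatrix_apply]

variable [MeasurableSpace E] [BorelSpace E] (μ : Measure E) [μ.IsAddHaarMeasure]

/-- The integral of the divergence of a compactly supported vector field vanishes. -/
theorem integral_trace_fderiv_eq_zero {F : E → E} (hF : ContDiff ℝ 1 F)
    (hc : HasCompactSupport F) :
    ∫ x, LinearMap.trace ℝ E (fderiv ℝ F x : E →ₗ[ℝ] E) ∂μ = 0 := by
  set b := Module.finBasis ℝ E
  set c : ∀ _ : Fin (Module.finrank ℝ E), E →L[ℝ] ℝ := fun i => LinearMap.toContinuousLinearMap (b.coord i)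
  have hc' : ∀ i, HasCompactSupport (fun x => c i (F x)) := fun i =>
    hc.comp_left (g := c i) (map_zero _)
  have hcd : ∀ i, ContDiff ℝ 1 (fun x => c i (F x)) := fun i => (c i).contDiff.comp hF
  have hint : ∀ i, Integrable (fun x => fderiv ℝ (fun y => c i (F y)) x (b i)) μ := fun i =>
    Continuous.integrable_of_hasCompactSupport
      (((hcd i).continuous_fderiv (by simp)).clm_apply continuous_const)
      ((hc' i).fderiv_apply ℝ (b i))
  have h1 : ∀ i, ∫ x, fderiv ℝ (fun y => c i (F y)) x (b i) ∂μ = 0 := by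
    intro i
    -- Integration by parts against the constant function 1.
    have := integral_mul_fderiv_eq_neg_fderiv_mul_of_integrable (μ := μ) (f := fun _ : E => (1 : ℝ))
      (g := fun x => c i (F x)) (v := b i) (by simp) (by simpa using hint i)
      (by simpa using (hcd i).continuous.integrable_of_hasCompactSupport (hc' i))
      (fun x _ => by fun_prop) (fun x _ => ((hcd i).differentiable (by simp)) x)
    simpa using this
  have h2 : ∀ x, LinearMap.trace ℝ E (fderiv ℝ F x : E →ₗ[ℝ] E)
      = ∑ i, fderiv ℝ (fun y => c i (F y)) x (b i) := by
    intro x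
    rw [trace_eq_sum_coord b]
    refine Finset.sum_congr rfl fun i _ => ?_
    have := ((c i).hasFDerivAt.comp x ((hF.differentiable (by simp)) x).hasFDerivAt).fderiv
    change _ = fderiv ℝ (c i ∘ F) x (b i)
    rw [this]
    rfl
  simp only [h2]
  rw [integral_finsetSum _ fun i _ => hint i]
  exact Finset.sum_eq_zero fun i _ => h1 i

variable {V : Type*} [TopologicalSpace V] [ChartedSpace E V]

/-- The Lie derivative of a function along a vector field. -/
def lieD (X : V → E) (h : V → ℝ) (y : V) : ℝ := tder 𝓘(ℝ, E) 𝓘(ℝ, ℝ) h y (X y)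

/-- The expression of a vector field in the preferred chart around `i`. -/
def chartVec (X : V → E) (i : V) (z : E) : E :=
  tder 𝓘(ℝ, E) 𝓘(ℝ, E) (extChartAt 𝓘(ℝ, E) i) ((extChartAt 𝓘(ℝ, E) i).symm z)
    (X ((extChartAt 𝓘(ℝ, E) i).symm z))

/-- The functions `δ i`, on the targets of the preferred charts, are the local expressions of a
positive density of class `C¹`. -/
structure IsChartDensity (δ : V → E → ℝ) : Prop where
  pos : ∀ i, ∀ z ∈ (extChartAt 𝓘(ℝ, E) i).target, 0 < δ i z
  contDiffAt : ∀ i, ∀ z ∈ (extChartAt 𝓘(ℝ, E) i).target, ContDiffAt ℝ 1 (δ i) z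
  coordChange : ∀ i j y, y ∈ (extChartAt 𝓘(ℝ, E) i).source → y ∈ (extChartAt 𝓘(ℝ, E) j).source →
    δ i (extChartAt 𝓘(ℝ, E) i y)
      = |(fderiv ℝ (extChartAt 𝓘(ℝ, E) j ∘ (extChartAt 𝓘(ℝ, E) i).symm)
          (extChartAt 𝓘(ℝ, E) i y)).det| * δ j (extChartAt 𝓘(ℝ, E) j y)

/-- The vector field `X` is of class `C¹` and has divergence zero with respect to `δ`. -/
structure IsDivFree (δ : V → E → ℝ) (X : V → E) : Prop where
  contDiffAt : ∀ i, ∀ z ∈ (extChartAt 𝓘(ℝ, E) i).target, ContDiffAt ℝ 1 (chartVec X i) z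
  div_eq_zero : ∀ i, ∀ z ∈ (extChartAt 𝓘(ℝ, E) i).target,
    fderiv ℝ (δ i) z (chartVec X i z)
      + δ i z * LinearMap.trace ℝ E (fderiv ℝ (chartVec X i) z : E →ₗ[ℝ] E) = 0

/-- The integral of the function `k` over the preferred chart around `i`. -/
def chartIntegral (δ : V → E → ℝ) (i : V) (k : V → ℝ) : ℝ :=
  ∫ z in (extChartAt 𝓘(ℝ, E) i).target, k ((extChartAt 𝓘(ℝ, E) i).symm z) * δ i z ∂μ

variable [IsManifold 𝓘(ℝ, E) ∞ V]

/-- Change of variables under the transition map: its Jacobian is exactly the factor in the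
transformation law of δ. A function supported in one chart thus has a well-defined integral, and no
measure on the manifold is needed. -/
theorem chartIntegral_eq_chartIntegral {δ : V → E → ℝ} (hδ : IsChartDensity δ) {i j : V}
    {k : V → ℝ} (hi : Function.support k ⊆ (extChartAt 𝓘(ℝ, E) i).source)
    (hj : Function.support k ⊆ (extChartAt 𝓘(ℝ, E) j).source) :
    chartIntegral μ δ i k = chartIntegral μ δ j k := by
  have key : ∀ i j : V, Function.support k ⊆ (extChartAt 𝓘(ℝ, E) j).source →
      chartIntegral μ δ i k
        = ∫ z in (extChartAt 𝓘(ℝ, E) i).target ∩ (extChartAt 𝓘(ℝ, E) i).symm ⁻¹'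
          (extChartAt 𝓘(ℝ, E) j).source, k ((extChartAt 𝓘(ℝ, E) i).symm z) * δ i z ∂μ := by
    intro i j hj
    refine setIntegral_eq_of_subset_of_forall_sdiff_eq_zero
      (isOpen_extChartAt_target i).measurableSet Set.inter_subset_left ?_
    intro z hz
    have : k ((extChartAt 𝓘(ℝ, E) i).symm z) = 0 := by
      by_contra hne
      exact hz.2 ⟨hz.1, hj hne⟩
    rw [this, zero_mul]
  rw [key i j hj, key j i hi]
  set ei := extChartAt 𝓘(ℝ, E) i
  set ej := extChartAt 𝓘(ℝ, E) j
  have himg : (ej ∘ ei.symm) '' (ei.target ∩ ei.symm ⁻¹' ej.source)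
      = ej.target ∩ ej.symm ⁻¹' ei.source := (ei.symm.trans ej).image_source_eq_target
  have hopen : IsOpen (ei.target ∩ ei.symm ⁻¹' ej.source) :=
    (continuousOn_extChartAt_symm i).isOpen_inter_preimage (isOpen_extChartAt_target i)
      (isOpen_extChartAt_source j)
  rw [← himg, integral_image_eq_integral_abs_det_fderiv_smul (f := ej ∘ ei.symm)
    (f' := fun z => fderiv ℝ (ej ∘ ei.symm) z) μ hopen.measurableSet]
  · refine setIntegral_congr_fun hopen.measurableSet fun z hz => ?_
    have h1 := hδ.coordChange i j (ei.symm z) (ei.map_target hz.1) hz.2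
    change δ i (ei (ei.symm z)) = |(fderiv ℝ (ej ∘ ei.symm) (ei (ei.symm z))).det| *
      δ j (ej (ei.symm z)) at h1
    rw [ei.right_inv hz.1] at h1
    change k (ei.symm z) * δ i z = |(fderiv ℝ (ej ∘ ei.symm) z).det| *
      (k (ej.symm (ej (ei.symm z))) * δ j (ej (ei.symm z)))
    rw [ej.left_inv hz.2, h1]
    ring
  · intro z hz
    have h1 : ContMDiffAt 𝓘(ℝ, E) 𝓘(ℝ, E) ∞ (ej ∘ ei.symm) z :=
      ContMDiffAt.comp z (contMDiffAt_extChartAt_of_mem hz.2) (contMDiffAt_extChartAt_symm hz.1)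
    exact ((h1.contDiffAt.differentiableAt (by simp)).hasFDerivAt).hasFDerivWithinAt
  · exact (ei.symm.trans ej).injOn

/-! ### Extension by zero from a chart to the model space -/

section Extension

variable {G : Type*} [NormedAddCommGroup G] [NormedSpace ℝ G]

/-- The function `k • g` in the preferred chart around `i`, extended by zero. -/
def chartExt (i : V) (k : V → ℝ) (g : E → G) : E → G :=
  (extChartAt 𝓘(ℝ, E) i).target.indicator fun z => k ((extChartAt 𝓘(ℝ, E) i).symm z) • g z

variable [CompactSpace V] {i : V} {k : V → ℝ} (hk : tsupport k ⊆ (extChartAt 𝓘(ℝ, E) i).source)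
include hk

theorem isCompact_image_tsupport : IsCompact (extChartAt 𝓘(ℝ, E) i '' tsupport k) :=
  (isClosed_tsupport k).isCompact.image_of_continuousOn ((continuousOn_extChartAt i).mono hk)

theorem chartExt_eq_zero (g : E → G) {z : E} (hz : z ∉ extChartAt 𝓘(ℝ, E) i '' tsupport k) :
    chartExt i k g z = 0 := by
  unfold chartExt
  by_cases h : z ∈ (extChartAt 𝓘(ℝ, E) i).target
  · rw [Set.indicator_of_mem h]
    have : k ((extChartAt 𝓘(ℝ, E) i).symm z) = 0 := by
      by_contra hne
      exact hz ⟨_, subset_tsupport _ hne, (extChartAt 𝓘(ℝ, E) i).right_inv h⟩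
    rw [this, zero_smul]
  · exact Set.indicator_of_notMem h _

theorem hasCompactSupport_chartExt (g : E → G) : HasCompactSupport (chartExt i k g) :=
  HasCompactSupport.intro (isCompact_image_tsupport hk) fun _ hz => chartExt_eq_zero hk g hz

theorem chartExt_eventuallyEq_zero (g : E → G) {z : E} (hz : z ∉ (extChartAt 𝓘(ℝ, E) i).target) :
    chartExt i k g =ᶠ[nhds z] fun _ => 0 := by
  have h : z ∉ extChartAt 𝓘(ℝ, E) i '' tsupport k := by
    rintro ⟨y, hy, rfl⟩
    exact hz ((extChartAt 𝓘(ℝ, E) i).map_source (hk hy))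
  filter_upwards [(isCompact_image_tsupport hk).isClosed.isOpen_compl.mem_nhds h] with w hw
  exact chartExt_eq_zero hk g hw

omit hk [CompactSpace V] in
theorem chartExt_eventuallyEq (g : E → G) {z : E} (hz : z ∈ (extChartAt 𝓘(ℝ, E) i).target) :
    chartExt i k g =ᶠ[nhds z] fun z => k ((extChartAt 𝓘(ℝ, E) i).symm z) • g z := by
  filter_upwards [extChartAt_target_mem_nhds_of_mem hz] with w hw
  exact Set.indicator_of_mem hw _

theorem continuous_chartExt {g : E → G} (hkc : Continuous k)
    (hg : ∀ z ∈ (extChartAt 𝓘(ℝ, E) i).target, ContinuousAt g z) :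
    Continuous (chartExt i k g) := by
  refine continuous_iff_continuousAt.2 fun z => ?_
  by_cases h : z ∈ (extChartAt 𝓘(ℝ, E) i).target
  · refine ContinuousAt.congr ?_ (chartExt_eventuallyEq g h).symm
    exact (hkc.continuousAt.comp (contMDiffAt_extChartAt_symm h).continuousAt).smul (hg z h)
  · exact continuousAt_const.congr (chartExt_eventuallyEq_zero hk g h).symm

theorem contDiff_chartExt {g : E → G} (hkc : ContMDiff 𝓘(ℝ, E) 𝓘(ℝ, ℝ) ∞ k)
    (hg : ∀ z ∈ (extChartAt 𝓘(ℝ, E) i).target, ContDiffAt ℝ 1 g z) :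
    ContDiff ℝ 1 (chartExt i k g) := by
  refine contDiff_iff_contDiffAt.2 fun z => ?_
  by_cases h : z ∈ (extChartAt 𝓘(ℝ, E) i).target
  · refine ContDiffAt.congr_of_eventuallyEq ?_ (chartExt_eventuallyEq g h)
    exact ((ContMDiffAt.comp z hkc.contMDiffAt
      (contMDiffAt_extChartAt_symm h)).contDiffAt.of_le (by simp)).smul (hg z h)
  · exact contDiffAt_const.congr_of_eventuallyEq (chartExt_eventuallyEq_zero hk g h)

end Extension

end Divergence
-- Integrating derivatives along divergence-free vector fields
section DivergenceFree

open MeasureTheory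

variable {E : Type*} [NormedAddCommGroup E] [NormedSpace ℝ E] [FiniteDimensional ℝ E]
  [MeasurableSpace E] [BorelSpace E] (μ : Measure E) [μ.IsAddHaarMeasure]
  {V : Type*} [TopologicalSpace V] [ChartedSpace E V] [IsManifold 𝓘(ℝ, E) ∞ V]

theorem lieD_symm (X : V → E) {h : V → ℝ} (hh : ContMDiff 𝓘(ℝ, E) 𝓘(ℝ, ℝ) ∞ h) {i : V} {z : E}
    (hz : z ∈ (extChartAt 𝓘(ℝ, E) i).target) :
    lieD X h ((extChartAt 𝓘(ℝ, E) i).symm z)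
      = fderiv ℝ (h ∘ (extChartAt 𝓘(ℝ, E) i).symm) z (chartVec X i z) := by
  have hy := (extChartAt 𝓘(ℝ, E) i).map_target hz
  have h1 := tder_comp_apply (f := (extChartAt 𝓘(ℝ, E) i).symm) (g := h) (x := z)
    (hh.mdifferentiableAt (by simp))
    ((contMDiffAt_extChartAt_symm hz).mdifferentiableAt (by simp)) (chartVec X i z)
  rw [tder_eq_fderiv] at h1
  rw [h1]
  unfold lieD
  congr 1
  have h2 := tder_extChartAt_symm_comp hy (X ((extChartAt 𝓘(ℝ, E) i).symm z))
  rw [(extChartAt 𝓘(ℝ, E) i).right_inv hz] at h2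
  exact h2.symm

theorem lieD_sum (X : V → E) {ι : Type*} (s : Finset ι) (h : ι → V → ℝ)
    (hh : ∀ j ∈ s, ContMDiff 𝓘(ℝ, E) 𝓘(ℝ, ℝ) ∞ (h j)) (y : V) :
    lieD X (∑ j ∈ s, h j) y = ∑ j ∈ s, lieD X (h j) y := by
  classical
  suffices h1 : HasMFDerivAt 𝓘(ℝ, E) 𝓘(ℝ, ℝ) (∑ j ∈ s, h j) y
      (∑ j ∈ s, tder 𝓘(ℝ, E) 𝓘(ℝ, ℝ) (h j) y : E →L[ℝ] ℝ) by
    have h2 : tder 𝓘(ℝ, E) 𝓘(ℝ, ℝ) (∑ j ∈ s, h j) y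
      = ∑ j ∈ s, tder 𝓘(ℝ, E) 𝓘(ℝ, ℝ) (h j) y := h1.mfderiv
    unfold lieD
    rw [h2, sum_apply]
  induction s using Finset.induction_on with
  | empty => exact hasMFDerivAt_const (0 : ℝ) y
  | insert j s hj ih =>
    rw [Finset.sum_insert hj, Finset.sum_insert hj]
    exact ((hh j (Finset.mem_insert_self j s)).mdifferentiableAt (by simp)).hasMFDerivAt.add
      (ih fun k hk => hh k (Finset.mem_insert_of_mem hk))

theorem lieD_eq_zero (X : V → E) {h : V → ℝ} {y : V} (hy : y ∉ tsupport h) : lieD X h y = 0 := by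
  unfold lieD
  have h1 : h =ᶠ[nhds y] fun _ => 0 := notMem_tsupport_iff_eventuallyEq.1 hy
  rw [tder_congr h1]
  have : tder 𝓘(ℝ, E) 𝓘(ℝ, ℝ) (fun _ : V => (0 : ℝ)) y = 0 := mfderiv_const
  rw [this]
  rfl

theorem tsupport_lieD_subset (X : V → E) (h : V → ℝ) : tsupport (lieD X h) ⊆ tsupport h :=
  closure_minimal (fun _ hy => by_contra fun hn => hy (lieD_eq_zero X hn)) (isClosed_tsupport h)

theorem continuous_lieD {δ : V → E → ℝ} {X : V → E} (hX : IsDivFree δ X) {h : V → ℝ}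
    (hh : ContMDiff 𝓘(ℝ, E) 𝓘(ℝ, ℝ) ∞ h) : Continuous (lieD X h) := by
  refine continuous_iff_continuousAt.2 fun y => ?_
  set e := extChartAt 𝓘(ℝ, E) y
  have hy : e y ∈ e.target := mem_extChartAt_target y
  have h1 : lieD X h =ᶠ[nhds y] fun x => fderiv ℝ (h ∘ e.symm) (e x) (chartVec X y (e x)) := by
    filter_upwards [(isOpen_extChartAt_source (I := 𝓘(ℝ, E)) y).mem_nhds
      (mem_extChartAt_source (I := 𝓘(ℝ, E)) y)] with x hx
    have := lieD_symm X hh (e.map_source hx)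
    rw [e.left_inv hx] at this
    exact this
  have h2 : ContDiffAt ℝ ∞ (h ∘ e.symm) (e y) :=
    (ContMDiffAt.comp (e y) hh.contMDiffAt (contMDiffAt_extChartAt_symm hy)).contDiffAt
  have h3 : ContinuousAt (fun z => fderiv ℝ (h ∘ e.symm) z (chartVec X y z)) (e y) :=
    ((h2.fderiv_right (m := 0) (by simp)).continuousAt).clm_apply
      (hX.contDiffAt y (e y) hy).continuousAt
  refine ContinuousAt.congr ?_ h1.symm
  exact ContinuousAt.comp (g := fun z => fderiv ℝ (h ∘ e.symm) z (chartVec X y z)) h3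
    (continuousAt_extChartAt y)

theorem chartIntegral_eq_integral_chartExt (δ : V → E → ℝ) (i : V) (k : V → ℝ) :
    chartIntegral μ δ i k = ∫ z, chartExt i k (δ i) z ∂μ := by
  unfold chartIntegral chartExt
  rw [integral_indicator (isOpen_extChartAt_target i).measurableSet]
  rfl

variable [CompactSpace V]

/-- Since div(δX) = 0, the integrand X(h)·δ is the divergence of the compactly supported field hδX.
-/
theorem chartIntegral_lieD_eq_zero {δ : V → E → ℝ} (hδ : IsChartDensity δ) {X : V → E}
    (hX : IsDivFree δ X) {h : V → ℝ} (hh : ContMDiff 𝓘(ℝ, E) 𝓘(ℝ, ℝ) ∞ h) {i : V}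
    (hi : tsupport h ⊆ (extChartAt 𝓘(ℝ, E) i).source) :
    chartIntegral μ δ i (lieD X h) = 0 := by
  set e := extChartAt 𝓘(ℝ, E) i
  have hF : ContDiff ℝ 1 (chartExt i h fun z => δ i z • chartVec X i z) :=
    contDiff_chartExt hi hh fun z hz => (hδ.contDiffAt i z hz).smul (hX.contDiffAt i z hz)
  rw [chartIntegral_eq_integral_chartExt,
    ← integral_trace_fderiv_eq_zero μ hF (hasCompactSupport_chartExt hi _)]
  refine integral_congr_ae (Filter.Eventually.of_forall fun z => ?_)
  dsimp only
  by_cases hz : z ∈ e.target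
  · rw [(chartExt_eventuallyEq _ hz).fderiv_eq, (chartExt_eventuallyEq _ hz).self_of_nhds]
    have h1 : HasFDerivAt (h ∘ e.symm) (fderiv ℝ (h ∘ e.symm) z) z :=
      ((ContMDiffAt.comp z hh.contMDiffAt (contMDiffAt_extChartAt_symm hz)).contDiffAt.differentiableAt
        (by simp)).hasFDerivAt
    have h2 := ((hδ.contDiffAt i z hz).differentiableAt (by simp)).hasFDerivAt
    have h3 := ((hX.contDiffAt i z hz).differentiableAt (by simp)).hasFDerivAt
    have h4 := (h1.smul (h2.smul h3)).fderiv
    change lieD X h (e.symm z) • δ i z = LinearMap.trace ℝ E ((fderiv ℝ ((h ∘ e.symm) •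
      (δ i • chartVec X i)) z : E →L[ℝ] E) : E →ₗ[ℝ] E)
    rw [h4, lieD_symm X hh hz]
    have h5 := hX.div_eq_zero i z hz
    have htr : ∀ (c : E →L[ℝ] ℝ) (v : E),
        LinearMap.trace ℝ E (c.smulRight v : E →ₗ[ℝ] E) = c v := fun c v =>
      LinearMap.trace_smulRight (c : E →ₗ[ℝ] ℝ) v
    simp only [ContinuousLinearMap.toLinearMap_add, ContinuousLinearMap.toLinearMap_smul, map_add, map_smul, htr,
      Pi.smul_apply', smul_eq_mul]
    linear_combination (-(h ∘ e.symm) z) * h5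
  · rw [(chartExt_eventuallyEq_zero hi _ hz).fderiv_eq, chartExt,
      Set.indicator_of_notMem hz]
    simp

theorem chartIntegral_sum {δ : V → E → ℝ} (hδ : IsChartDensity δ) (i : V) {ι : Type*}
    (s : Finset ι) (k : ι → V → ℝ) (hc : ∀ a ∈ s, Continuous (k a))
    (hs : ∀ a ∈ s, tsupport (k a) ⊆ (extChartAt 𝓘(ℝ, E) i).source) :
    chartIntegral μ δ i (fun y => ∑ a ∈ s, k a y) = ∑ a ∈ s, chartIntegral μ δ i (k a) := by
  simp only [chartIntegral_eq_integral_chartExt]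
  rw [← integral_finsetSum]
  · congr 1
    ext z
    unfold chartExt
    by_cases hz : z ∈ (extChartAt 𝓘(ℝ, E) i).target
    · simp only [Set.indicator_of_mem hz, Finset.sum_smul]
    · simp only [Set.indicator_of_notMem hz, Finset.sum_const_zero]
  · intro a ha
    exact (continuous_chartExt (hs a ha) (hc a ha) fun z hz =>
      (hδ.contDiffAt i z hz).continuousAt).integrable_of_hasCompactSupport
        (hasCompactSupport_chartExt (hs a ha) _)

/-- A nonnegative continuous function with zero integral vanishes almost everywhere, hence
everywhere because Haar measure charges open sets; then δ > 0 can be divided out. -/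
theorem eq_zero_of_chartIntegral_eq_zero {δ : V → E → ℝ} (hδ : IsChartDensity δ) {i : V}
    {k : V → ℝ} (hc : Continuous k) (hs : tsupport k ⊆ (extChartAt 𝓘(ℝ, E) i).source)
    (hk : ∀ y, 0 ≤ k y) (h0 : chartIntegral μ δ i k = 0) (y : V) : k y = 0 := by
  rw [chartIntegral_eq_integral_chartExt] at h0
  have hcont := continuous_chartExt hs hc fun z hz => (hδ.contDiffAt i z hz).continuousAt
  have hnn : 0 ≤ chartExt i k (δ i) := fun z =>
    Set.indicator_nonneg (fun w hw => mul_nonneg (hk _) (hδ.pos i w hw).le) z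
  have h1 := Continuous.ae_eq_iff_eq μ hcont (g := fun _ => 0) continuous_const |>.1
    ((integral_eq_zero_iff_of_nonneg hnn
      (hcont.integrable_of_hasCompactSupport (hasCompactSupport_chartExt hs _))).1 h0)
  by_contra hne
  have hy := hs (subset_tsupport _ hne)
  have h2 := congrFun h1 (extChartAt 𝓘(ℝ, E) i y)
  rw [chartExt, Set.indicator_of_mem ((extChartAt 𝓘(ℝ, E) i).map_source hy),
    (extChartAt 𝓘(ℝ, E) i).left_inv hy] at h2
  exact (mul_ne_zero hne (hδ.pos i _ ((extChartAt 𝓘(ℝ, E) i).map_source hy)).ne') h2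

/-- A nonnegative function on a compact manifold that is a sum of derivatives along
divergence-free vector fields vanishes. -/
theorem eq_zero_of_eq_lieD_add_lieD [T2Space V] {δ : V → E → ℝ} (hδ : IsChartDensity δ)
    {X Y : V → E} (hX : IsDivFree δ X) (hY : IsDivFree δ Y) {a b f : V → ℝ}
    (ha : ContMDiff 𝓘(ℝ, E) 𝓘(ℝ, ℝ) ∞ a) (hb : ContMDiff 𝓘(ℝ, E) 𝓘(ℝ, ℝ) ∞ b)
    (hf : ∀ y, f y = lieD X a y + lieD Y b y) (hf0 : ∀ y, 0 ≤ f y) (y : V) : f y = 0 := by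
  let μ : Measure E := Measure.addHaar
  obtain ⟨ρ, hρ⟩ := SmoothPartitionOfUnity.exists_isSubordinate_chartAt_source 𝓘(ℝ, E) V
  have hρs : ∀ j, tsupport (ρ j) ⊆ (extChartAt 𝓘(ℝ, E) j).source := fun j => by
    rw [extChartAt_source]; exact hρ j
  have hfin : {j | (Function.support (ρ j)).Nonempty}.Finite :=
    ρ.locallyFinite.finite_nonempty_of_compact
  set s := hfin.toFinset
  have hsum : ∀ x, ∑ j ∈ s, ρ j x = 1 := by
    intro x
    rw [← ρ.sum_eq_one (Set.mem_univ x)]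
    refine (finsum_eq_sum_of_support_subset _ fun j hj => ?_).symm
    simp only [s, Set.Finite.coe_toFinset]
    exact ⟨x, hj⟩
  have hρsm : ∀ j, ContMDiff 𝓘(ℝ, E) 𝓘(ℝ, ℝ) ∞ (ρ j) := fun j => (ρ j).contMDiff
  have hmul : ∀ {h : V → ℝ} (j), ContMDiff 𝓘(ℝ, E) 𝓘(ℝ, ℝ) ∞ h →
      ContMDiff 𝓘(ℝ, E) 𝓘(ℝ, ℝ) ∞ (fun x => ρ j x * h x) := fun j hh =>
    contDiff_mul.comp_contMDiff ((hρsm j).prodMk_space hh)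
  have hsup : ∀ (h : V → ℝ) (j), tsupport (fun x => ρ j x * h x) ⊆ (extChartAt 𝓘(ℝ, E) j).source :=
    fun h j => (tsupport_mul_subset_left).trans (hρs j)
  have hlie : ∀ (Z : V → E) {h : V → ℝ}, ContMDiff 𝓘(ℝ, E) 𝓘(ℝ, ℝ) ∞ h → ∀ x,
      lieD Z h x = ∑ j ∈ s, lieD Z (fun x => ρ j x * h x) x := by
    intro Z h hh x
    have h1 : h = ∑ j ∈ s, (fun x => ρ j x * h x) := by
      ext x
      rw [Finset.sum_apply, ← Finset.sum_mul, hsum, one_mul]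
    rw [← lieD_sum Z s (fun j x => ρ j x * h x) fun j _ => hmul j hh, ← h1]
  -- Cutting off a and b, rather than f, keeps each piece a sum of derivatives along X and Y; the
  -- piece is supported in one chart and integrates to zero there.
  set g : V → V → ℝ := fun k x => lieD X (fun x => ρ k x * a x) x + lieD Y (fun x => ρ k x * b x) x
  have hgc : ∀ k, Continuous (g k) := fun k =>
    (continuous_lieD hX (hmul k ha)).add (continuous_lieD hY (hmul k hb))
  have hgs : ∀ k, tsupport (g k) ⊆ (extChartAt 𝓘(ℝ, E) k).source := fun k =>
    (tsupport_add _ _).trans (Set.union_subset ((tsupport_lieD_subset _ _).trans (hsup a k))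
      ((tsupport_lieD_subset _ _).trans (hsup b k)))
  have hg0 : ∀ k, chartIntegral μ δ k (g k) = 0 := by
    intro k
    have := chartIntegral_sum μ hδ k Finset.univ (fun c : Bool => bif c then
        lieD X (fun x => ρ k x * a x) else lieD Y (fun x => ρ k x * b x))
      (fun c _ => by
        cases c
        · exact continuous_lieD hY (hmul k hb)
        · exact continuous_lieD hX (hmul k ha))
      (fun c _ => by
        cases c
        · exact (tsupport_lieD_subset _ _).trans (hsup b k)
        · exact (tsupport_lieD_subset _ _).trans (hsup a k))
    simp only [Fintype.sum_bool, cond_true, cond_false,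
      chartIntegral_lieD_eq_zero μ hδ hX (hmul k ha) (hsup a k),
      chartIntegral_lieD_eq_zero μ hδ hY (hmul k hb) (hsup b k), add_zero] at this
    exact this
  have hfg : f = fun x => ∑ k ∈ s, g k x := by
    ext x
    rw [hf, hlie X ha, hlie Y hb, ← Finset.sum_add_distrib]
  have hfc : Continuous f := by
    rw [hfg]
    exact continuous_finsetSum _ fun k _ => hgc k
  have hsub : ∀ j k, tsupport (fun x => ρ j x * g k x) ⊆ (extChartAt 𝓘(ℝ, E) j).source :=
    fun j k => tsupport_mul_subset_left.trans (hρs j)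
  have hcont : ∀ j {h : V → ℝ}, Continuous h → Continuous (fun x => ρ j x * h x) := fun j _ hh =>
    (hρsm j).continuous.mul hh
  -- The total integral of f is the double sum of the integrals of ρ_j g_k. Each of these may be
  -- computed in chart k instead of chart j, and summing over j first leaves the vanishing integral
  -- of g_k.
  have htotal : ∑ j ∈ s, chartIntegral μ δ j (fun x => ρ j x * f x) = 0 := by
    have h1 : ∀ j, chartIntegral μ δ j (fun x => ρ j x * f x)
        = ∑ k ∈ s, chartIntegral μ δ k (fun x => ρ j x * g k x) := by
      intro j
      rw [hfg]
      simp only [Finset.mul_sum]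
      rw [chartIntegral_sum μ hδ j s (fun k x => ρ j x * g k x)
        (fun k _ => hcont j (hgc k)) (fun k _ => hsub j k)]
      refine Finset.sum_congr rfl fun k _ => chartIntegral_eq_chartIntegral μ hδ
        ((subset_tsupport _).trans (hsub j k)) ?_
      exact (subset_tsupport _).trans (tsupport_mul_subset_right.trans (hgs k))
    simp only [h1]
    rw [Finset.sum_comm]
    refine Finset.sum_eq_zero fun k _ => ?_
    rw [← chartIntegral_sum μ hδ k s (fun j x => ρ j x * g k x)
        (fun j _ => hcont j (hgc k)) (fun j _ => tsupport_mul_subset_right.trans (hgs k)),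
      ← hg0 k]
    congr 1
    ext x
    rw [← Finset.sum_mul, hsum, one_mul]
  have hnn : ∀ j x, 0 ≤ ρ j x * f x := fun j x => mul_nonneg (ρ.nonneg j x) (hf0 x)
  have hI : ∀ j, 0 ≤ chartIntegral μ δ j (fun x => ρ j x * f x) := fun j =>
    setIntegral_nonneg (isOpen_extChartAt_target j).measurableSet fun z hz =>
      mul_nonneg (hnn j _) (hδ.pos j z hz).le
  have hzero := (Finset.sum_eq_zero_iff_of_nonneg fun j _ => hI j).1 htotal
  have h1 : f y = ∑ j ∈ s, ρ j y * f y := by rw [← Finset.sum_mul, hsum, one_mul]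
  rw [h1]
  exact Finset.sum_eq_zero fun j hj => eq_zero_of_chartIntegral_eq_zero μ hδ (hcont j hfc)
    (hsup f j) (hnn j) (hzero j hj) y

end DivergenceFree

/-! ### Gram determinants -/

section GramDet

variable {E : Type*} [NormedAddCommGroup E] [NormedSpace ℝ E] [FiniteDimensional ℝ E]

/-- The determinant of the Gram matrix of a bilinear form in a fixed basis. -/
def gramDet (B : E →L[ℝ] E →L[ℝ] ℝ) : ℝ :=
  (LinearMap.BilinForm.toMatrix (Module.finBasis ℝ E) B.toLinearMap₁₂).det

/-- The pullback of the bilinear form `B` under the linear map `A`. -/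
def bilinComp (B : E →L[ℝ] E →L[ℝ] ℝ) (A : E →L[ℝ] E) : E →L[ℝ] E →L[ℝ] ℝ :=
  ((ContinuousLinearMap.compL ℝ E E ℝ).flip A).comp (B.comp A)

theorem bilinComp_apply (B : E →L[ℝ] E →L[ℝ] ℝ) (A : E →L[ℝ] E) (u v : E) :
    bilinComp B A u v = B (A u) (A v) := rfl

/-- The square root of this identity is the transformation law of the Riemannian density; its
first-order form at the identity gives the derivative of the Gram determinant. -/
theorem gramDet_bilinComp (B : E →L[ℝ] E →L[ℝ] ℝ) (A : E →L[ℝ] E) :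
    gramDet (bilinComp B A) = A.det ^ 2 * gramDet B := by
  unfold gramDet
  have h : (bilinComp B A).toLinearMap₁₂
      = LinearMap.BilinForm.comp B.toLinearMap₁₂ (A : E →ₗ[ℝ] E) (A : E →ₗ[ℝ] E) := rfl
  rw [h, LinearMap.BilinForm.toMatrix_comp (Module.finBasis ℝ E) (Module.finBasis ℝ E), Matrix.det_mul, Matrix.det_mul,
    Matrix.det_transpose, LinearMap.det_toMatrix]
  change LinearMap.det (A : E →ₗ[ℝ] E) * _ * LinearMap.det (A : E →ₗ[ℝ] E)
    = LinearMap.det (A : E →ₗ[ℝ] E) ^ 2 * _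
  ring

theorem gramDet_pos {B : E →L[ℝ] E →L[ℝ] ℝ} (hs : ∀ u v, B u v = B v u)
    (hB : ∀ u, u ≠ 0 → 0 < B u u) : 0 < gramDet B := by
  refine Matrix.PosDef.det_pos (Matrix.PosDef.of_dotProduct_mulVec_pos ?_ fun x hx => ?_)
  · ext i j
    simp only [Matrix.conjTranspose_apply, LinearMap.BilinForm.toMatrix_apply, star_trivial]
    exact hs _ _
  · rw [star_trivial, LinearMap.BilinForm.dotProduct_toMatrix_mulVec]
    exact hB _ ((LinearEquiv.map_ne_zero_iff _).2 hx)

theorem contDiff_gramDet : ContDiff ℝ ∞ (gramDet : (E →L[ℝ] E →L[ℝ] ℝ) → ℝ) := by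
  unfold gramDet
  simp only [Matrix.det_apply, LinearMap.BilinForm.toMatrix_apply]
  refine ContDiff.sum fun σ _ => ContDiff.const_smul _ (contDiff_prod fun i _ => ?_)
  change ContDiff ℝ ∞ fun B : E →L[ℝ] E →L[ℝ] ℝ => B _ _
  fun_prop

/-- The derivative of the Gram determinant along an infinitesimal change of basis. -/
theorem fderiv_gramDet_apply (B H : E →L[ℝ] E →L[ℝ] ℝ) (A : E →L[ℝ] E)
    (hH : ∀ u v, H u v = -(B (A u) v) - B u (A v)) :
    fderiv ℝ gramDet B H = -(2 * LinearMap.trace ℝ E (A : E →ₗ[ℝ] E) * gramDet B) := by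
  -- The pullback of B under id - sA is a curve through B with velocity H, along which the Gram
  -- determinant is det(id - sA)² times its initial value.
  have h1 : ∀ s : ℝ, bilinComp B (ContinuousLinearMap.id ℝ E + s • (-A))
      = B + (s • H + s ^ 2 • bilinComp B A) := by
    intro s
    ext u v
    simp only [bilinComp_apply, add_apply, smul_apply,
      neg_apply, map_add, map_smul, map_neg, hH, smul_eq_mul,
      ContinuousLinearMap.id_apply]
    ring
  have hd : ∀ s : ℝ, gramDet (B + (s • H + s ^ 2 • bilinComp B A))
      = (ContinuousLinearMap.id ℝ E + s • (-A)).det ^ 2 * gramDet B := fun s => by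
    rw [← gramDet_bilinComp, h1]
  set N := LinearMap.toMatrix (Module.finBasis ℝ E) (Module.finBasis ℝ E) (-A : E →ₗ[ℝ] E)
  have hdet : ∀ s : ℝ, (ContinuousLinearMap.id ℝ E + s • (-A)).det = (1 + s • N).det := by
    intro s
    change LinearMap.det (LinearMap.id + s • (-A : E →ₗ[ℝ] E)) = _
    rw [← LinearMap.det_toMatrix (Module.finBasis ℝ E), map_add, map_smul, LinearMap.toMatrix_id]
  have hN : N.trace = - LinearMap.trace ℝ E (A : E →ₗ[ℝ] E) := by
    rw [← LinearMap.trace_eq_matrix_trace, map_neg]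
  have hleft : HasDerivAt (fun s : ℝ => gramDet (B + (s • H + s ^ 2 • bilinComp B A)))
      (fderiv ℝ gramDet B H) 0 := by
    have hc : HasDerivAt (fun s : ℝ => B + (s • H + s ^ 2 • bilinComp B A)) H 0 := by
      have := (((hasDerivAt_id (0 : ℝ)).smul_const H).add
        (((hasDerivAt_id (0 : ℝ)).pow 2).smul_const (bilinComp B A))).const_add B
      simpa using this
    have hg : HasFDerivAt gramDet (fderiv ℝ gramDet B)
        (B + ((0 : ℝ) • H + (0 : ℝ) ^ 2 • bilinComp B A)) := by
      have h0 : B + ((0 : ℝ) • H + (0 : ℝ) ^ 2 • bilinComp B A) = B := by simp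
      rw [h0]
      exact (contDiff_gramDet.differentiable (by simp) B).hasFDerivAt
    exact hg.comp_hasDerivAt 0 hc
  have hright : HasDerivAt (fun s : ℝ => (1 + s • N).det ^ 2 * gramDet B)
      (2 * N.trace * gramDet B) 0 := by
    have h2 : HasDerivAt (fun s : ℝ => (1 + s • N).det) N.trace 0 := by
      -- det(1 + sN) = 1 + s·tr N + O(s²), with a polynomial remainder.
      have h3 : (fun s : ℝ => (1 + s • N).det) = _ := funext fun s => Matrix.det_one_add_smul s N
      rw [h3]
      have hp := (Polynomial.hasDerivAt (Matrix.det (1 + (Polynomial.X : Polynomial ℝ) •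
        N.map Polynomial.C)).divX.divX 0).mul ((hasDerivAt_id (0 : ℝ)).pow 2)
      have := (((hasDerivAt_id (0 : ℝ)).const_mul N.trace).const_add 1).add hp
      exact this.congr_deriv (by simp)
    have := (h2.pow 2).mul_const (gramDet B)
    simpa using this
  simp only [hd, hdet] at hleft
  rw [hleft.unique hright, hN]
  ring

/-- The square root of the Gram determinant of a field of bilinear forms satisfies the
continuity equation along an infinitesimal isometry. -/
theorem fderiv_sqrt_gramDet {G : E → E →L[ℝ] E →L[ℝ] ℝ} {X : E → E} {z : E}
    (hG : DifferentiableAt ℝ G z) (hpos : 0 < gramDet (G z))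
    (hX : ∀ u v, fderiv ℝ G z (X z) u v
      = -(G z (fderiv ℝ X z u) v) - G z u (fderiv ℝ X z v)) :
    fderiv ℝ (fun w => √(gramDet (G w))) z (X z)
      + √(gramDet (G z)) * LinearMap.trace ℝ E (fderiv ℝ X z : E →ₗ[ℝ] E) = 0 := by
  have h1 : HasFDerivAt (fun w => gramDet (G w)) ((fderiv ℝ gramDet (G z)).comp (fderiv ℝ G z)) z :=
    (contDiff_gramDet.differentiable (by simp) (G z)).hasFDerivAt.comp z hG.hasFDerivAt
  rw [(h1.sqrt hpos.ne').fderiv]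
  have h2 := fderiv_gramDet_apply (G z) (fderiv ℝ G z (X z)) (fderiv ℝ X z) hX
  simp only [smul_apply, ContinuousLinearMap.comp_apply, h2, smul_eq_mul]
  have h3 : 0 < √(gramDet (G z)) := Real.sqrt_pos.2 hpos
  have h4 : √(gramDet (G z)) ^ 2 = gramDet (G z) := Real.sq_sqrt hpos.le
  field_simp
  rw [h4]
  ring

theorem contDiffAt_sqrt_gramDet {G : E → E →L[ℝ] E →L[ℝ] ℝ} {z : E}
    (hG : ContDiffAt ℝ 1 G z) (hpos : 0 < gramDet (G z)) :
    ContDiffAt ℝ 1 (fun w => √(gramDet (G w))) z :=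
  ContDiffAt.sqrt (((contDiff_gramDet.of_le (by simp)).contDiffAt).comp z hG) hpos.ne'

end GramDet

/-! ### Infinitesimal automorphisms of a potential -/

section Potential

variable {W : Type*} [NormedAddCommGroup W] [NormedSpace ℝ W] {J₀ : W →L[ℝ] W}

/-- The Levi form `½ (D²φ(u, v) + D²φ(J₀ u, J₀ v))` of the function `φ`. -/
def levi (J₀ : W →L[ℝ] W) (φ : W → ℝ) (z : W) : W →L[ℝ] W →L[ℝ] ℝ :=
  (2⁻¹ : ℝ) • (fderiv ℝ (fderiv ℝ φ) z + bilinComp (fderiv ℝ (fderiv ℝ φ) z) J₀)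

theorem levi_apply (φ : W → ℝ) (z u v : W) : levi J₀ φ z u v
    = 2⁻¹ * (fderiv ℝ (fderiv ℝ φ) z u v + fderiv ℝ (fderiv ℝ φ) z (J₀ u) (J₀ v)) := rfl

/-- The bilinear form `L + dφ ⊗ dφ + dᶜφ ⊗ dᶜφ`, where `L` is the Levi form of `φ`. -/
def hermForm (J₀ : W →L[ℝ] W) (φ : W → ℝ) (z : W) : W →L[ℝ] W →L[ℝ] ℝ :=
  levi J₀ φ z + (fderiv ℝ φ z).smulRight (fderiv ℝ φ z)
    + ((fderiv ℝ φ z).comp J₀).smulRight ((fderiv ℝ φ z).comp J₀)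

theorem hermForm_apply (φ : W → ℝ) (z u v : W) : hermForm J₀ φ z u v
    = levi J₀ φ z u v + fderiv ℝ φ z u * fderiv ℝ φ z v
      + fderiv ℝ φ z (J₀ u) * fderiv ℝ φ z (J₀ v) := rfl

theorem contDiffAt_hermForm {φ : W → ℝ} {z : W} (hφ : ContDiffAt ℝ ∞ φ z) :
    ContDiffAt ℝ ∞ (hermForm J₀ φ) z := by
  have h1 : ContDiffAt ℝ ∞ (fderiv ℝ φ) z := hφ.fderiv_right (by simp)
  have h2 : ContDiffAt ℝ ∞ (fderiv ℝ (fderiv ℝ φ)) z := h1.fderiv_right (by simp)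
  unfold hermForm levi bilinComp
  refine ContDiffAt.add (ContDiffAt.add (ContDiffAt.const_smul _ (h2.add ?_)) ?_) ?_
  · exact contDiffAt_const.clm_comp (h2.clm_comp contDiffAt_const)
  · exact h1.smulRight h1
  · exact (h1.clm_comp contDiffAt_const).smulRight (h1.clm_comp contDiffAt_const)

theorem isSymm_fderiv_fderiv {G : Type*} [NormedAddCommGroup G] [NormedSpace ℝ G] {f : W → G}
    {z : W} (hf : ContDiffAt ℝ ∞ f z) (u v : W) :
    fderiv ℝ (fderiv ℝ f) z u v = fderiv ℝ (fderiv ℝ f) z v u :=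
  (hf.isSymmSndFDerivAt (n := ∞) (by simpa using two_le_infty)) u v

theorem fderiv_fderiv_apply {G : Type*} [NormedAddCommGroup G] [NormedSpace ℝ G]
    {f : W → W →L[ℝ] G} {z : W} (hf : DifferentiableAt ℝ f z) (u v : W) :
    fderiv ℝ (fun w => f w v) z u = fderiv ℝ f z u v := by
  rw [(hf.hasFDerivAt.clm_apply (hasFDerivAt_const v z)).fderiv]
  simp

/-! ### Holomorphic fields that change a potential at a constant rate -/

section Invariance

variable {φ : W → ℝ} {X : W → W} {z : W} {c : ℝ} (hφ : ∀ᶠ w in nhds z, ContDiffAt ℝ ∞ φ w)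
  (hX : ∀ᶠ w in nhds z, ContDiffAt ℝ ∞ X w) (hφX : ∀ᶠ w in nhds z, fderiv ℝ φ w (X w) = c)
include hφ hX hφX

/-- The constancy of dφ(X) is differentiated once: the Lie derivative of dφ along X vanishes. -/
theorem fderiv_fderiv_add_eq_zero (v : W) :
    fderiv ℝ (fderiv ℝ φ) z (X z) v + fderiv ℝ φ z (fderiv ℝ X z v) = 0 := by
  have h1 : DifferentiableAt ℝ (fderiv ℝ φ) z :=
    (hφ.self_of_nhds.fderiv_right (m := ∞) (by simp)).differentiableAt (by simp)
  have h2 := (h1.hasFDerivAt.clm_apply (hX.self_of_nhds.differentiableAt (by simp)).hasFDerivAt).fderiv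
  have h3 : fderiv ℝ (fun w => fderiv ℝ φ w (X w)) z = 0 := by
    rw [Filter.EventuallyEq.fderiv_eq (f := fun _ => c) hφX]
    simp
  rw [h3] at h2
  have h4 := congrArg (fun L : W →L[ℝ] ℝ => L v) h2
  simp only [zero_apply, add_apply, ContinuousLinearMap.comp_apply,
    ContinuousLinearMap.flip_apply] at h4
  rw [isSymm_fderiv_fderiv hφ.self_of_nhds]
  linarith

/-- Differentiating the previous identity once more. The term with D²X prevents the Hessian of φ
from being invariant; it disappears only in the Levi form of a holomorphic X. -/
theorem fderiv_fderiv_fderiv_add_eq_zero (u v : W) :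
    fderiv ℝ (fderiv ℝ (fderiv ℝ φ)) z (X z) u v
      + fderiv ℝ (fderiv ℝ φ) z (fderiv ℝ X z u) v + fderiv ℝ (fderiv ℝ φ) z u (fderiv ℝ X z v)
      + fderiv ℝ φ z (fderiv ℝ (fderiv ℝ X) z u v) = 0 := by
  have e1 : ContDiffAt ℝ ∞ (fderiv ℝ φ) z := hφ.self_of_nhds.fderiv_right (by simp)
  have e2 : ContDiffAt ℝ ∞ (fderiv ℝ (fderiv ℝ φ)) z := e1.fderiv_right (by simp)
  have e3 : ContDiffAt ℝ ∞ (fderiv ℝ X) z := hX.self_of_nhds.fderiv_right (by simp)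
  have h1 : (fun w => fderiv ℝ (fderiv ℝ φ) w (X w) v + fderiv ℝ φ w (fderiv ℝ X w v))
      =ᶠ[nhds z] fun _ => (0 : ℝ) := by
    filter_upwards [hφ.eventually_nhds, hX.eventually_nhds, hφX.eventually_nhds]
      with w a1 a2 a3
    exact fderiv_fderiv_add_eq_zero a1 a2 a3 v
  have d1 := (e1.differentiableAt (by simp)).hasFDerivAt
  have d2 := (e2.differentiableAt (by simp)).hasFDerivAt
  have d3 := (e3.differentiableAt (by simp)).hasFDerivAt
  have dX := (hX.self_of_nhds.differentiableAt (by simp)).hasFDerivAt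
  have h2 := (((d2.clm_apply dX).clm_apply (hasFDerivAt_const v z)).add
    (d1.clm_apply (d3.clm_apply (hasFDerivAt_const v z)))).fderiv
  have h3 := h1.fderiv_eq (𝕜 := ℝ)
  have h4 := congrArg (fun L : W →L[ℝ] ℝ => L u) (h2.symm.trans h3)
  simp only [add_apply, ContinuousLinearMap.comp_apply, ContinuousLinearMap.flip_apply,
    zero_apply, map_zero, zero_add, fderiv_fun_const, Pi.zero_apply] at h4
  rw [isSymm_fderiv_fderiv e1 (X z) u]
  linarith

variable (hJ : ∀ v, J₀ (J₀ v) = -v)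
  (hXJ : ∀ᶠ w in nhds z, ∀ v, fderiv ℝ X w (J₀ v) = J₀ (fderiv ℝ X w v))
include hJ hXJ

/-- A holomorphic vector field along which `φ` changes at a constant rate is an infinitesimal
isometry of the Hermitian form of `φ`. -/
theorem fderiv_hermForm_apply (u v : W) :
    fderiv ℝ (hermForm J₀ φ) z (X z) u v
      = -(hermForm J₀ φ z (fderiv ℝ X z u) v) - hermForm J₀ φ z u (fderiv ℝ X z v) := by
  have e1 : ContDiffAt ℝ ∞ (fderiv ℝ φ) z := hφ.self_of_nhds.fderiv_right (by simp)
  have e2 : ContDiffAt ℝ ∞ (fderiv ℝ (fderiv ℝ φ)) z := e1.fderiv_right (by simp)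
  have e3 : ContDiffAt ℝ ∞ (fderiv ℝ X) z := hX.self_of_nhds.fderiv_right (by simp)
  have d1 := (e1.differentiableAt (by simp)).hasFDerivAt
  have d2 := (e2.differentiableAt (by simp)).hasFDerivAt
  have d3 := (e3.differentiableAt (by simp)).hasFDerivAt
  have hd := (contDiffAt_hermForm (J₀ := J₀) hφ.self_of_nhds).differentiableAt (by simp)
  have k1 : fderiv ℝ (hermForm J₀ φ) z (X z) u v
      = fderiv ℝ (fun w => hermForm J₀ φ w u v) z (X z) := by
    rw [fderiv_fderiv_apply (f := fun w => hermForm J₀ φ w u)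
      (hd.clm_apply (differentiableAt_const u)), fderiv_fderiv_apply hd]
  have c1 : ∀ a, HasFDerivAt (fun w => fderiv ℝ φ w a) _ z := fun a =>
    d1.clm_apply (hasFDerivAt_const a z)
  have c2 : ∀ a b, HasFDerivAt (fun w => fderiv ℝ (fderiv ℝ φ) w a b) _ z := fun a b =>
    (d2.clm_apply (hasFDerivAt_const a z)).clm_apply (hasFDerivAt_const b z)
  have k2 : HasFDerivAt (fun w => hermForm J₀ φ w u v) _ z :=
    (((c2 u v).add (c2 (J₀ u) (J₀ v))).const_mul (2⁻¹ : ℝ)).add ((c1 u).mul (c1 v)) |>.add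
      ((c1 (J₀ u)).mul (c1 (J₀ v)))
  rw [k1, k2.fderiv]
  simp only [add_apply, smul_apply, smul_eq_mul, ContinuousLinearMap.comp_apply,
    ContinuousLinearMap.flip_apply, zero_apply, map_zero, zero_add, hermForm_apply, levi_apply]
  change _ + (_ + fderiv ℝ φ z (J₀ v) * _) = _
  have a1 := fderiv_fderiv_fderiv_add_eq_zero hφ hX hφX u v
  have a2 := fderiv_fderiv_fderiv_add_eq_zero hφ hX hφX (J₀ u) (J₀ v)
  have b := fderiv_fderiv_add_eq_zero hφ hX hφX
  have hXJ0 := hXJ.self_of_nhds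
  -- Differentiating DX∘J₀ = J₀∘DX shows that D²X is complex bilinear, so D²X(J₀u, J₀v) = -D²X(u,
  -- v).
  have hDJ : ∀ x y, fderiv ℝ (fderiv ℝ X) z x (J₀ y) = J₀ (fderiv ℝ (fderiv ℝ X) z x y) := by
    intro x y
    have f1 : (fun w => fderiv ℝ X w (J₀ y)) =ᶠ[nhds z] fun w => J₀ (fderiv ℝ X w y) := by
      filter_upwards [hXJ] with w hw using hw y
    have f2 := congrArg (fun L : W →L[ℝ] W => L x) f1.fderiv_eq
    rw [fderiv_fderiv_apply d3.differentiableAt] at f2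
    have f3 : HasFDerivAt (fun w => J₀ (fderiv ℝ X w y)) _ z :=
      J₀.hasFDerivAt.comp z (d3.clm_apply (hasFDerivAt_const y z))
    rw [f2, f3.fderiv]
    simp
  have hJJ : fderiv ℝ (fderiv ℝ X) z (J₀ u) (J₀ v) = - fderiv ℝ (fderiv ℝ X) z u v := by
    rw [hDJ, isSymm_fderiv_fderiv hX.self_of_nhds, hDJ, hJ, isSymm_fderiv_fderiv hX.self_of_nhds]
  rw [hJJ, hXJ0, hXJ0, map_neg] at a2
  have b1 := b u
  have b2 := b v
  have b3 := b (J₀ u)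
  have b4 := b (J₀ v)
  rw [hXJ0] at b3 b4
  -- The D²X terms at (u, v) and (J₀u, J₀v) cancel in the average of `a1` and `a2`, which treats the
  -- Levi form. The first-order identities treat the two rank-one terms.
  linear_combination 2⁻¹ * a1 + 2⁻¹ * a2 + fderiv ℝ φ z v * b1 + fderiv ℝ φ z u * b2
    + fderiv ℝ φ z (J₀ v) * b3 + fderiv ℝ φ z (J₀ u) * b4

end Invariance

/-- The second derivatives of a function along a holomorphic vector field `X` and along `J₀ X`
add up to twice the Levi form. -/
theorem fderiv_add_fderiv_eq_levi {φ : W → ℝ} {X : W → W} {z : W} (hφ : ContDiffAt ℝ ∞ φ z)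
    (hX : ContDiffAt ℝ ∞ X z) (hJ : ∀ v, J₀ (J₀ v) = -v)
    (hXJ : ∀ v, fderiv ℝ X z (J₀ v) = J₀ (fderiv ℝ X z v)) :
    fderiv ℝ (fun w => fderiv ℝ φ w (X w)) z (X z)
      + fderiv ℝ (fun w => fderiv ℝ φ w (J₀ (X w))) z (J₀ (X z)) = 2 * levi J₀ φ z (X z) (X z) := by
  have d1 := ((hφ.fderiv_right (m := ∞) (by simp)).differentiableAt (by simp)).hasFDerivAt
  have dX := (hX.differentiableAt (by simp)).hasFDerivAt
  have h2 : HasFDerivAt (fun w => fderiv ℝ φ w (J₀ (X w))) _ z :=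
    d1.clm_apply (J₀.hasFDerivAt.comp z dX)
  -- The first-order terms are dφ(DX(X)) and dφ(J₀ DX(J₀X)) = -dφ(DX(X)), and they cancel.
  rw [(d1.clm_apply dX).fderiv, h2.fderiv, levi_apply]
  simp only [add_apply, ContinuousLinearMap.comp_apply, ContinuousLinearMap.flip_apply, hXJ, hJ,
    map_neg]
  ring

end Potential

/-! ### The real manifold underlying a complex manifold -/

section ComplexManifold

variable {W : Type*} [NormedAddCommGroup W] [NormedSpace ℂ W] [NormedSpace ℝ W]
  [IsScalarTower ℝ ℂ W] {V : Type*} [TopologicalSpace V] [ChartedSpace W V]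

variable (W V) in
theorem isManifold_real [h : IsManifold 𝓘(ℂ, W) ω V] : IsManifold 𝓘(ℝ, W) ∞ V := by
  refine isManifold_of_contDiffOn _ _ _ fun e e' he he' => ?_
  have h1 := (contDiffGroupoid ω 𝓘(ℂ, W)).compatible he he'
  rw [contDiffGroupoid, mem_groupoid_of_pregroupoid] at h1
  have h2 : ContDiffOn ℂ ω (𝓘(ℂ, W) ∘ e.symm ≫ₕ e' ∘ 𝓘(ℂ, W).symm)
    (𝓘(ℂ, W).symm ⁻¹' (e.symm ≫ₕ e').source ∩ Set.range 𝓘(ℂ, W)) := h1.1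
  exact (h2.restrict_scalars ℝ).of_le le_top

variable [IsManifold 𝓘(ℂ, W) ω V] [IsManifold 𝓘(ℝ, W) ∞ V]

/-- In the identification of the tangent space at y by the chart at y, this derivative is that of a
transition map between complex charts, hence complex linear. Consequently, multiplication by i reads
as the same constant operator in every chart. -/
theorem tder_extChartAt_smul {i y : V} (hy : y ∈ (extChartAt 𝓘(ℝ, W) i).source) (c : ℂ) (v : W) :
    tder 𝓘(ℝ, W) 𝓘(ℝ, W) (extChartAt 𝓘(ℝ, W) i) y (c • v)
      = c • tder 𝓘(ℝ, W) 𝓘(ℝ, W) (extChartAt 𝓘(ℝ, W) i) y v := by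
  set e := extChartAt 𝓘(ℝ, W) i
  set e' := extChartAt 𝓘(ℝ, W) y
  have hz : e' y ∈ e'.target := mem_extChartAt_target y
  have hey : e'.symm (e' y) = y := extChartAt_to_inv y
  have h1 : ∀ w, fderiv ℝ (e ∘ e'.symm) (e' y) w = tder 𝓘(ℝ, W) 𝓘(ℝ, W) e y w := by
    intro w
    have hm : MDifferentiableAt 𝓘(ℝ, W) 𝓘(ℝ, W) e (e'.symm (e' y)) := by
      rw [hey]
      exact (contMDiffAt_extChartAt_of_mem hy).mdifferentiableAt (by simp)
    have := tder_comp_apply (f := e'.symm) (g := e) (x := e' y) hm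
      ((contMDiffAt_extChartAt_symm hz).mdifferentiableAt (by simp)) w
    rw [tder_eq_fderiv, tder_extChartAt_symm_self, hey] at this
    exact this
  have h2 : DifferentiableAt ℂ (e ∘ e'.symm) (e' y) := by
    have hmem : extChartAt 𝓘(ℂ, W) y y ∈
        ((extChartAt 𝓘(ℂ, W) y).symm ≫ extChartAt 𝓘(ℂ, W) i).source := by
      refine ⟨mem_extChartAt_target (I := 𝓘(ℂ, W)) y, ?_⟩
      change (extChartAt 𝓘(ℂ, W) y).symm (extChartAt 𝓘(ℂ, W) y y) ∈
        (extChartAt 𝓘(ℂ, W) i).source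
      rw [extChartAt_to_inv]
      exact hy
    have := contDiffWithinAt_ext_coord_change (I := 𝓘(ℂ, W)) (n := ω) i y hmem
    rw [modelWithCornersSelf_coe, Set.range_id, contDiffWithinAt_univ] at this
    exact this.differentiableAt (by simp)
  rw [← h1, ← h1, h2.fderiv_restrictScalars ℝ]
  exact map_smul (fderiv ℂ (e ∘ e'.symm) (e' y)) c v

end ComplexManifold

/-! ### Descent to the quotient of a cone -/

section Descent

variable {m : ℕ} {M : Type*} [TopologicalSpace M] [ChartedSpace (EuclideanSpace ℝ (Fin m)) M]
  [IsManifold (𝓡 m) ∞ M]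

theorem SasakianStructure.coneForm_radial (S : SasakianStructure m M) (p : Cone M)
    (v : EuclideanSpace ℝ (Fin m) × ℝ) :
    coneForm S.metric p (radial m p) v = coneT p * v.2 := by
  rw [coneForm_apply]
  simp [radial]

variable {n : ℕ} {V : Type*} [TopologicalSpace V]
  [ChartedSpace (EuclideanSpace ℂ (Fin n)) V]

variable (n) in
/-- Multiplication by `i` on `ℂⁿ`, as a real linear map. -/
def mulI : EuclideanSpace ℂ (Fin n) →L[ℝ] EuclideanSpace ℂ (Fin n) :=
  Complex.I • ContinuousLinearMap.id ℝ (EuclideanSpace ℂ (Fin n))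

theorem mulI_apply (v : EuclideanSpace ℂ (Fin n)) : mulI n v = Complex.I • v := rfl

theorem mulI_mulI (v : EuclideanSpace ℂ (Fin n)) : mulI n (mulI n v) = -v := by
  rw [mulI_apply, mulI_apply, smul_smul, Complex.I_mul_I, neg_one_smul]

namespace ConePresentation

variable (P : ConePresentation m M n V)

/-- The derivative of the quotient map. -/
def dpi (p : Cone M) : EuclideanSpace ℝ (Fin m) × ℝ →L[ℝ] EuclideanSpace ℂ (Fin n) :=
  tder (coneModel m) 𝓘(ℝ, EuclideanSpace ℂ (Fin n)) P.π p

/-- The inverse of the derivative of the quotient map. -/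
def dpiInv (p : Cone M) : EuclideanSpace ℂ (Fin n) →L[ℝ] EuclideanSpace ℝ (Fin m) × ℝ :=
  (P.π_localDiffeo.mfderivToContinuousLinearEquiv (by simp) p).symm.toContinuousLinearMap

theorem dpiInv_dpi (p : Cone M) (u : EuclideanSpace ℝ (Fin m) × ℝ) :
    P.dpiInv p (P.dpi p u) = u := by
  have := (P.π_localDiffeo.mfderivToContinuousLinearEquiv (by simp) p).symm_apply_apply u
  exact this

theorem dpi_dpiInv (p : Cone M) (v : EuclideanSpace ℂ (Fin n)) :
    P.dpi p (P.dpiInv p v) = v := by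
  have := (P.π_localDiffeo.mfderivToContinuousLinearEquiv (by simp) p).apply_symm_apply v
  exact this

theorem contMDiff_pi :
    ContMDiff (coneModel m) 𝓘(ℝ, EuclideanSpace ℂ (Fin n)) ∞ P.π := P.π_localDiffeo.contMDiff

theorem dpi_jay (p : Cone M) (v : EuclideanSpace ℝ (Fin m) × ℝ) :
    P.dpi p (P.sasakian.jay p v) = mulI n (P.dpi p v) := P.π_holomorphic.commutes p v

theorem pi_q (p : Cone M) : P.π (P.q p) = P.π p :=
  ((P.π_fibres p (P.q p)).2 ⟨1, by rw [zpow_one]; rfl⟩).symm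

/-- The derivative of the homothety. -/
def dq (p : Cone M) : EuclideanSpace ℝ (Fin m) × ℝ →L[ℝ] EuclideanSpace ℝ (Fin m) × ℝ :=
  tder (coneModel m) (coneModel m) P.q p

theorem dpi_dq (p : Cone M) (u : EuclideanSpace ℝ (Fin m) × ℝ) :
    P.dpi (P.q p) (P.dq p u) = P.dpi p u := by
  have h1 := tder_comp_apply (f := P.q) (g := P.π) (x := p)
    (P.contMDiff_pi.mdifferentiableAt (by simp)) (P.q.contMDiff.mdifferentiableAt (by simp)) u
  have h2 : P.π ∘ P.q = P.π := funext P.pi_q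
  rw [h2] at h1
  exact h1.symm

theorem dpiInv_q (p : Cone M) (v : EuclideanSpace ℂ (Fin n)) :
    P.dpiInv (P.q p) v = P.dq p (P.dpiInv p v) := by
  conv_lhs => rw [← P.dpi_dpiInv p v, ← P.dpi_dq, P.dpiInv_dpi]

theorem dq_jay (p : Cone M) (v : EuclideanSpace ℝ (Fin m) × ℝ) :
    P.dq p (P.sasakian.jay p v) = P.sasakian.jay (P.q p) (P.dq p v) :=
  P.isHomothety.holomorphic.commutes p v

theorem exists_coneT_q [CompactSpace M] : ∃ c : ℝ, 0 < c ∧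
    (∀ p, coneT (P.q p) = c * coneT p) ∧
    ∀ p u v, coneForm P.sasakian.metric (P.q p) (P.dq p u) (P.dq p v)
      = c ^ 2 * coneForm P.sasakian.metric p u v := by
  obtain ⟨c, hc, -, h⟩ := P.isHomothety.homothety
  have h1 : ∀ p u v, coneForm P.sasakian.metric (P.q p) (P.dq p u) (P.dq p v)
      = c ^ 2 * coneForm P.sasakian.metric p u v := fun p u v => by
    refine (coneMetric_eq P.sasakian.metric (P.q p) _ _).symm.trans ((h p u v).trans ?_)
    exact congrArg (c ^ 2 * ·) (coneMetric_eq P.sasakian.metric p u v)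
  exact ⟨c, hc, coneT_homothety P.sasakian.metric P.q hc h1, h1⟩

theorem dq_snd [CompactSpace M] {c : ℝ} (hc : ∀ p, coneT (P.q p) = c * coneT p) (p : Cone M)
    (u : EuclideanSpace ℝ (Fin m) × ℝ) : (P.dq p u).2 = c * u.2 := by
  have h1 := tder_comp_apply (f := P.q) (g := (coneT : Cone M → ℝ)) (x := p)
    (contMDiff_coneT.mdifferentiableAt (by simp)) (P.q.contMDiff.mdifferentiableAt (by simp)) u
  rw [tder_coneT] at h1
  have h2 : coneT ∘ P.q = (fun s => c * s) ∘ (coneT : Cone M → ℝ) := funext hc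
  have h3 := tder_comp_apply (f := (coneT : Cone M → ℝ)) (g := fun s : ℝ => c * s) (x := p)
    (I' := 𝓘(ℝ, ℝ)) (I'' := 𝓘(ℝ, ℝ))
    (mdifferentiableAt_iff_differentiableAt.2 (by fun_prop))
    (contMDiff_coneT.mdifferentiableAt (by simp)) u
  rw [h2, h3, tder_coneT, tder_eq_fderiv] at h1
  refine h1.symm.trans ?_
  simp [mul_comm]

/-- R is t times the gradient of t, since g(R, ·) = t dt, and q scales both g and t dt by c². Thus
the difference of the two sides is orthogonal to the image of dq, which is the whole tangent space.
-/
theorem dq_radial [CompactSpace M] (p : Cone M) : P.dq p (radial m p) = radial m (P.q p) := by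
  obtain ⟨c, hc, h1, h2⟩ := P.exists_coneT_q
  set d := P.dq p (radial m p) - radial m (P.q p) with hd
  have key : ∀ v, coneForm P.sasakian.metric (P.q p) d (P.dq p v) = 0 := by
    intro v
    rw [hd, map_sub, sub_apply, h2, P.sasakian.coneForm_radial, P.sasakian.coneForm_radial, h1,
      P.dq_snd h1]
    ring
  have hsurj : P.dq p (P.dpiInv p (P.dpi (P.q p) d)) = d := by
    rw [← P.dpiInv_q, P.dpiInv_dpi]
  have h3 := key (P.dpiInv p (P.dpi (P.q p) d))
  rw [hsurj] at h3
  by_contra hne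
  exact (coneForm_pos P.sasakian.metric (P.q p) (sub_ne_zero.2 hne)).ne' h3

/-- Fibres of π are orbits of ⟨q⟩, so invariance under the generator suffices; the induction runs
over positive and negative powers. -/
theorem eq_of_pi_eq {A : Type*} {f : Cone M → A} (hf : ∀ p, f (P.q p) = f p) {p p' : Cone M}
    (h : P.π p = P.π p') : f p = f p' := by
  obtain ⟨k, rfl⟩ := (P.π_fibres p p').1 h
  have hq : ∀ x, f (P.q.toEquiv x) = f x := hf
  symm
  induction k using Int.induction_on with
  | zero => rfl
  | succ k ih =>
    rw [add_comm, zpow_add, zpow_one, Equiv.Perm.mul_apply, hq]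
    exact ih ((P.π_fibres _ _).2 ⟨_, rfl⟩)
  | pred k ih =>
    rw [← hq, ← Equiv.Perm.mul_apply, ← zpow_one_add]
    have : (1 + (-(k : ℤ) - 1)) = -k := by ring
    rw [this]
    exact ih ((P.π_fibres _ _).2 ⟨_, rfl⟩)

/-- A point of the cone over a point of the quotient. -/
def lift (y : V) : Cone M := Function.surjInv P.π_surjective y

theorem pi_lift (y : V) : P.π (P.lift y) = y := Function.surjInv_eq P.π_surjective y

/-- Objects on the quotient are defined through an arbitrary choice of lift. For q-invariant data
the choice is immaterial, and any point of the fibre may replace it. -/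
theorem apply_lift_pi {A : Type*} {f : Cone M → A} (hf : ∀ p, f (P.q p) = f p) (p : Cone M) :
    f (P.lift (P.π p)) = f p := P.eq_of_pi_eq hf (P.pi_lift _)

/-- The vector field on the quotient induced by `t ∂ₜ`. -/
def euler (y : V) : EuclideanSpace ℂ (Fin n) := P.dpi (P.lift y) (radial m (P.lift y))

/-- The `1`-form on the quotient induced by `d log t`. -/
def eta (y : V) : EuclideanSpace ℂ (Fin n) →L[ℝ] ℝ :=
  (coneT (P.lift y))⁻¹ • (ContinuousLinearMap.snd ℝ _ _).comp (P.dpiInv (P.lift y))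

/-- The metric on the quotient induced by `t⁻² g`. -/
def quotForm (y : V) : EuclideanSpace ℂ (Fin n) →L[ℝ] EuclideanSpace ℂ (Fin n) →L[ℝ] ℝ :=
  (coneT (P.lift y))⁻¹ ^ 2 •
    ((ContinuousLinearMap.compL ℝ _ _ ℝ).flip (P.dpiInv (P.lift y))).comp
      ((coneForm P.sasakian.metric (P.lift y)).comp (P.dpiInv (P.lift y)))

/-- The form on the quotient induced by `ddᶜ log t`. -/
def omegaZero : Form 𝓘(ℝ, EuclideanSpace ℂ (Fin n)) V 2 := fun y =>
  (P.sasakian.coneOmegaZero (P.lift y)).compContinuousLinearMap (P.dpiInv (P.lift y))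

variable [CompactSpace M]

theorem euler_pi (p : Cone M) : P.euler (P.π p) = P.dpi p (radial m p) :=
  P.apply_lift_pi (f := fun p => P.dpi p (radial m p))
    (fun p => by rw [← P.dq_radial, P.dpi_dq]) p

theorem eta_pi (p : Cone M) (u : EuclideanSpace ℝ (Fin m) × ℝ) :
    P.eta (P.π p) (P.dpi p u) = (coneT p)⁻¹ * u.2 := by
  have h := P.apply_lift_pi
    (f := fun p => fun w : EuclideanSpace ℂ (Fin n) => (coneT p)⁻¹ * (P.dpiInv p w).2)
    (fun p => by
      obtain ⟨c, hc, h1, -⟩ := P.exists_coneT_q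
      ext w
      rw [P.dpiInv_q, P.dq_snd h1, h1, mul_inv]
      field_simp) p
  refine (congrFun h (P.dpi p u)).trans ?_
  rw [P.dpiInv_dpi]

theorem quotForm_pi (p : Cone M) (u v : EuclideanSpace ℝ (Fin m) × ℝ) :
    P.quotForm (P.π p) (P.dpi p u) (P.dpi p v)
      = (coneT p)⁻¹ ^ 2 * coneForm P.sasakian.metric p u v := by
  have h := P.apply_lift_pi
    (f := fun p => fun w w' : EuclideanSpace ℂ (Fin n) => (coneT p)⁻¹ ^ 2 *
      coneForm P.sasakian.metric p (P.dpiInv p w) (P.dpiInv p w'))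
    (fun p => by
      obtain ⟨c, hc, h1, h2⟩ := P.exists_coneT_q
      ext w w'
      rw [P.dpiInv_q, P.dpiInv_q, h2, h1, mul_inv]
      field_simp) p
  refine (congrFun (congrFun h (P.dpi p u)) (P.dpi p v)).trans ?_
  rw [P.dpiInv_dpi, P.dpiInv_dpi]

/-- In the formula of `SasakianStructure.coneOmegaZero_apply` the bracket scales by c² under q and
the prefactor by c⁻². -/
theorem coneOmegaZero_q (p : Cone M) (u v : EuclideanSpace ℝ (Fin m) × ℝ) :
    P.sasakian.coneOmegaZero (P.q p) ![P.dq p u, P.dq p v]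
      = P.sasakian.coneOmegaZero p ![u, v] := by
  obtain ⟨c, hc, h1, h2⟩ := P.exists_coneT_q
  refine (P.sasakian.coneOmegaZero_apply _ _ _).trans
    (Eq.trans ?_ (P.sasakian.coneOmegaZero_apply _ _ _).symm)
  rw [← P.dq_jay, ← P.dq_jay, h2, P.dq_snd h1, P.dq_snd h1, P.dq_snd h1, P.dq_snd h1, h1, mul_inv]
  field_simp

theorem omegaZero_pi (p : Cone M) (w : Fin 2 → EuclideanSpace ℝ (Fin m) × ℝ) :
    P.omegaZero (P.π p) (fun i => P.dpi p (w i)) = P.sasakian.coneOmegaZero p w := by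
  have h := P.apply_lift_pi
    (f := fun p => fun w : Fin 2 → EuclideanSpace ℂ (Fin n) =>
      P.sasakian.coneOmegaZero p (fun i => P.dpiInv p (w i)))
    (fun p => by
      ext w
      have hw : ∀ x, (fun i => P.dpiInv x (w i)) = ![P.dpiInv x (w 0), P.dpiInv x (w 1)] := by
        intro x
        ext1 i
        fin_cases i <;> rfl
      rw [hw, hw, P.dpiInv_q, P.dpiInv_q]
      exact P.coneOmegaZero_q p (P.dpiInv p (w 0)) (P.dpiInv p (w 1))) p
  refine (congrFun h fun i => P.dpi p (w i)).trans ?_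
  exact congrArg (P.sasakian.coneOmegaZero p) (funext fun i => P.dpiInv_dpi p (w i))

theorem isOmegaZero_omegaZero : P.IsOmegaZero P.omegaZero := by
  funext p
  exact ContinuousAlternatingMap.ext fun w => P.omegaZero_pi p w

variable {P} in
theorem IsOmegaZero.eq_omegaZero {α : Form 𝓘(ℝ, EuclideanSpace ℂ (Fin n)) V 2}
    (h : P.IsOmegaZero α) : α = P.omegaZero := by
  funext y
  obtain ⟨p, rfl⟩ := P.π_surjective y
  refine ContinuousAlternatingMap.ext fun w => ?_
  have h1 := P.omegaZero_pi p fun i => P.dpiInv p (w i)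
  have h2 : α (P.π p) (fun i => P.dpi p (P.dpiInv p (w i)))
      = P.sasakian.coneOmegaZero p fun i => P.dpiInv p (w i) :=
    DFunLike.congr_fun (congrFun h p) fun i => P.dpiInv p (w i)
  have h3 : (fun i => P.dpi p (P.dpiInv p (w i))) = w := funext fun i => P.dpi_dpiInv p (w i)
  rw [h3] at h1 h2
  exact h2.trans h1.symm

theorem existsUnique_isOmegaZero : ∃! α, P.IsOmegaZero α :=
  ⟨P.omegaZero, P.isOmegaZero_omegaZero, fun _ h => h.eq_omegaZero⟩

end ConePresentation

end Descent

/-! ### The kernel of `ddᶜ log t` -/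

section Kernel

variable {m : ℕ} {M : Type*} [TopologicalSpace M] [ChartedSpace (EuclideanSpace ℝ (Fin m)) M]
  [IsManifold (𝓡 m) ∞ M] (S : SasakianStructure m M) (p : Cone M)

namespace SasakianStructure

theorem coneForm_jay_radial (v : EuclideanSpace ℝ (Fin m) × ℝ) :
    coneForm S.metric p (S.jay p (radial m p)) v = -(coneT p * (S.jay p v).2) := by
  rw [coneForm_symm, S.coneForm_jay_right, S.coneForm_radial]

theorem jay_radial_snd : (S.jay p (radial m p)).2 = 0 := by
  have h1 := S.coneForm_jay_radial p (radial m p)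
  rw [coneForm_symm, S.coneForm_radial] at h1
  have h2 := coneT_pos p
  have h3 : coneT p * (S.jay p (radial m p)).2 = 0 := by linarith
  exact (mul_eq_zero.1 h3).resolve_left h2.ne'

theorem coneOmegaZero_jay (u v : EuclideanSpace ℝ (Fin m) × ℝ) :
    S.coneOmegaZero p ![u, S.jay p v] = -2 * ((coneT p)⁻¹ ^ 2 *
      (coneForm S.metric p u v - u.2 * v.2 - (S.jay p u).2 * (S.jay p v).2)) := by
  refine (S.coneOmegaZero_apply p u (S.jay p v)).trans ?_
  rw [S.jay_jay, map_neg, Prod.snd_neg]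
  ring

theorem coneOmegaZero_radial (v : EuclideanSpace ℝ (Fin m) × ℝ) :
    S.coneOmegaZero p ![radial m p, v] = 0 := by
  refine (S.coneOmegaZero_apply p _ v).trans ?_
  rw [S.coneForm_radial, S.jay_radial_snd]
  simp [radial]

theorem coneOmegaZero_jay_radial (v : EuclideanSpace ℝ (Fin m) × ℝ) :
    S.coneOmegaZero p ![S.jay p (radial m p), v] = 0 := by
  refine (S.coneOmegaZero_apply p _ v).trans ?_
  rw [S.coneForm_jay_radial, S.jay_radial_snd, S.jay_jay, S.jay_jay]
  simp only [radial, Prod.snd_neg]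
  ring

/-- R and JR are orthogonal of length t, with g(u, R) = t·dt(u) and g(u, JR) = -t·dt(Ju). The vector
on the left is therefore the component of u orthogonal to both, and the identity is Pythagoras. -/
theorem coneForm_remainder (u : EuclideanSpace ℝ (Fin m) × ℝ) :
    coneForm S.metric p
      (u - ((coneT p)⁻¹ * u.2) • radial m p + ((coneT p)⁻¹ * (S.jay p u).2) • S.jay p (radial m p))
      (u - ((coneT p)⁻¹ * u.2) • radial m p + ((coneT p)⁻¹ * (S.jay p u).2) • S.jay p (radial m p))
      = coneForm S.metric p u u - u.2 * u.2 - (S.jay p u).2 * (S.jay p u).2 := by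
  have h1 := coneT_pos p
  simp only [map_add, map_sub, map_smul, add_apply, sub_apply, smul_apply, smul_eq_mul,
    S.coneForm_radial, S.coneForm_jay_radial, coneForm_symm S.metric p u (radial m p),
    coneForm_symm S.metric p u (S.jay p (radial m p)), S.jay_radial_snd, S.jay_jay]
  simp only [radial, Prod.snd_neg]
  field_simp
  ring

theorem coneForm_remainder_nonneg (u : EuclideanSpace ℝ (Fin m) × ℝ) :
    0 ≤ coneForm S.metric p u u - u.2 * u.2 - (S.jay p u).2 * (S.jay p u).2 := by
  rw [← S.coneForm_remainder]
  exact (sq_nonneg _).trans (snd_sq_le_coneForm S.metric p _)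

/-- Up to the factor -2t⁻², ω₀(u, Ju) is the squared length of the component of u orthogonal to R
and JR, so its vanishing puts u in their span. -/
theorem exists_of_coneOmegaZero_jay_eq_zero {u : EuclideanSpace ℝ (Fin m) × ℝ}
    (h : S.coneOmegaZero p ![u, S.jay p u] = 0) :
    ∃ a b : ℝ, u = a • radial m p + b • S.jay p (radial m p) := by
  rw [S.coneOmegaZero_jay, ← S.coneForm_remainder] at h
  have h0 : 0 < (coneT p)⁻¹ ^ 2 := by have := coneT_pos p; positivity
  refine ⟨(coneT p)⁻¹ * u.2, -((coneT p)⁻¹ * (S.jay p u).2), ?_⟩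
  by_contra hne
  have h1 := coneForm_pos S.metric p (u := u - ((coneT p)⁻¹ * u.2) • radial m p
      + ((coneT p)⁻¹ * (S.jay p u).2) • S.jay p (radial m p)) fun h2 => hne (by
    rw [neg_smul, ← sub_eq_add_neg, ← sub_eq_zero, ← h2]
    abel)
  have h2 := mul_pos h0 h1
  linarith

end SasakianStructure

end Kernel

/-! ### The potential in the charts of the quotient -/

section Charts

variable {m : ℕ} {M : Type*} [TopologicalSpace M] [ChartedSpace (EuclideanSpace ℝ (Fin m)) M]
  [IsManifold (𝓡 m) ∞ M] {n : ℕ} {V : Type*} [TopologicalSpace V]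
  [ChartedSpace (EuclideanSpace ℂ (Fin n)) V]
  [IsManifold 𝓘(ℝ, EuclideanSpace ℂ (Fin n)) ∞ V]

namespace ConePresentation

variable (P : ConePresentation m M n V)

/-- The inverse of the composite of the quotient map with the preferred chart around `i`, near
the point `p`. -/
def chartLift (i : V) (p : Cone M) : EuclideanSpace ℂ (Fin n) → Cone M :=
  (P.π_localDiffeo p).localInverse ∘ (extChartAt 𝓘(ℝ, EuclideanSpace ℂ (Fin n)) i).symm

theorem eventually_pi_mem {i : V} {p : Cone M}
    (hp : P.π p ∈ (extChartAt 𝓘(ℝ, EuclideanSpace ℂ (Fin n)) i).source) :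
    ∀ᶠ x in nhds p, P.π x ∈ (extChartAt 𝓘(ℝ, EuclideanSpace ℂ (Fin n)) i).source :=
  P.contMDiff_pi.continuous.continuousAt.eventually ((isOpen_extChartAt_source i).mem_nhds hp)

theorem tder_chart_pi {i : V} {p : Cone M}
    (hp : P.π p ∈ (extChartAt 𝓘(ℝ, EuclideanSpace ℂ (Fin n)) i).source)
    (u : EuclideanSpace ℝ (Fin m) × ℝ) :
    tder (coneModel m) 𝓘(ℝ, EuclideanSpace ℂ (Fin n))
        (extChartAt 𝓘(ℝ, EuclideanSpace ℂ (Fin n)) i ∘ P.π) p u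
      = tder 𝓘(ℝ, EuclideanSpace ℂ (Fin n)) 𝓘(ℝ, EuclideanSpace ℂ (Fin n))
        (extChartAt 𝓘(ℝ, EuclideanSpace ℂ (Fin n)) i) (P.π p) (P.dpi p u) :=
  tder_comp_apply (f := P.π) (g := extChartAt 𝓘(ℝ, EuclideanSpace ℂ (Fin n)) i) (x := p)
    ((contMDiffAt_extChartAt_of_mem hp).mdifferentiableAt (by simp))
    (P.contMDiff_pi.mdifferentiableAt (by simp)) u

theorem isCoordinate [IsManifold 𝓘(ℂ, EuclideanSpace ℂ (Fin n)) ω V] {i : V} {p : Cone M}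
    (hp : P.π p ∈ (extChartAt 𝓘(ℝ, EuclideanSpace ℂ (Fin n)) i).source) :
    IsCoordinate P.sasakian (mulI n) (extChartAt 𝓘(ℝ, EuclideanSpace ℂ (Fin n)) i ∘ P.π)
      (P.chartLift i p) p := by
  set e := extChartAt 𝓘(ℝ, EuclideanSpace ℂ (Fin n)) i
  have hloc := P.π_localDiffeo p
  have hz : e (P.π p) ∈ e.target := e.map_source hp
  have htend : Filter.Tendsto e.symm (nhds (e (P.π p))) (nhds (P.π p)) := by
    have := (contMDiffAt_extChartAt_symm hz).continuousAt
    rwa [ContinuousAt, e.left_inv hp] at this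
  have hmem : ∀ᶠ z in nhds (e (P.π p)), z ∈ e.target ∧ e.symm z ∈ hloc.localInverse.source :=
    Filter.Eventually.and (extChartAt_target_mem_nhds_of_mem hz) (htend.eventually
      (hloc.localInverse_open_source.mem_nhds hloc.localInverse_mem_source))
  refine ⟨?_, ?_, ?_, ?_, ?_⟩
  · filter_upwards [P.eventually_pi_mem hp] with x hx
    exact ContMDiffAt.comp x (contMDiffAt_extChartAt_of_mem hx) P.contMDiff_pi.contMDiffAt
  · filter_upwards [hmem] with z hz
    exact ContMDiffAt.comp z (hloc.localInverse_contMDiffOn.contMDiffAt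
      (hloc.localInverse_open_source.mem_nhds hz.2)) (contMDiffAt_extChartAt_symm hz.1)
  · filter_upwards [P.eventually_pi_mem hp, hloc.localInverse_eventuallyEq_left] with x hx h1
    change hloc.localInverse (e.symm (e (P.π x))) = x
    rw [e.left_inv hx]
    exact h1
  · filter_upwards [hmem] with z hz
    change e (P.π (hloc.localInverse (e.symm z))) = z
    rw [hloc.localInverse_right_inv hz.2, e.right_inv hz.1]
  · filter_upwards [P.eventually_pi_mem hp] with x hx v
    rw [P.tder_chart_pi hx, P.tder_chart_pi hx, P.dpi_jay]
    exact tder_extChartAt_smul hx Complex.I _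

/-- The function `φ` on `ℂⁿ` is, near `w`, a local potential of the quotient in the preferred
chart around `i`. -/
structure IsPotential (i : V) (φ : EuclideanSpace ℂ (Fin n) → ℝ) (w : EuclideanSpace ℂ (Fin n)) :
    Prop where
  contDiffAt : ContDiffAt ℝ ∞ φ w
  contDiffAt_euler : ContDiffAt ℝ ∞ (chartVec P.euler i) w
  fderiv_euler_mul : ∀ v, fderiv ℝ (chartVec P.euler i) w (mulI n v)
    = mulI n (fderiv ℝ (chartVec P.euler i) w v)
  fderiv_euler : fderiv ℝ φ w (chartVec P.euler i w) = 1
  fderiv_mul_euler : fderiv ℝ φ w (mulI n (chartVec P.euler i w)) = 0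
  eta_eq : ∀ v, P.eta ((extChartAt 𝓘(ℝ, EuclideanSpace ℂ (Fin n)) i).symm w)
    (tder 𝓘(ℝ, EuclideanSpace ℂ (Fin n)) 𝓘(ℝ, EuclideanSpace ℂ (Fin n))
      (extChartAt 𝓘(ℝ, EuclideanSpace ℂ (Fin n)) i).symm w v) = fderiv ℝ φ w v
  quotForm_eq : bilinComp (P.quotForm ((extChartAt 𝓘(ℝ, EuclideanSpace ℂ (Fin n)) i).symm w))
    (tder 𝓘(ℝ, EuclideanSpace ℂ (Fin n)) 𝓘(ℝ, EuclideanSpace ℂ (Fin n))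
      (extChartAt 𝓘(ℝ, EuclideanSpace ℂ (Fin n)) i).symm w) = hermForm (mulI n) φ w
  levi_nonneg : ∀ v, 0 ≤ levi (mulI n) φ w v v
  omegaZero_eq_zero : ∀ v, levi (mulI n) φ w v v = 0 → ∀ v' : EuclideanSpace ℂ (Fin n),
    P.omegaZero ((extChartAt 𝓘(ℝ, EuclideanSpace ℂ (Fin n)) i).symm w)
      ![tder 𝓘(ℝ, EuclideanSpace ℂ (Fin n)) 𝓘(ℝ, EuclideanSpace ℂ (Fin n))
      (extChartAt 𝓘(ℝ, EuclideanSpace ℂ (Fin n)) i).symm w v, v'] = 0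

/-- ω₀ is semidefinite, so testing against the single vector Ju already detects the kernel; the
converse is bilinearity, R and JR being in the kernel. -/
theorem omegaZero_eq_zero_iff [CompactSpace M] (p : Cone M) (u : EuclideanSpace ℝ (Fin m) × ℝ) :
    (∀ v : EuclideanSpace ℂ (Fin n), P.omegaZero (P.π p) ![P.dpi p u, v] = 0)
      ↔ ∃ a b : ℝ, u = a • radial m p + b • P.sasakian.jay p (radial m p) := by
  have h1 : ∀ u v, P.omegaZero (P.π p) ![P.dpi p u, P.dpi p v]
      = P.sasakian.coneOmegaZero p ![u, v] := fun u v =>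
    (congrArg (P.omegaZero (P.π p)) (comp_vecTwo (P.dpi p) u v)).symm.trans
      (P.omegaZero_pi p ![u, v])
  constructor
  · intro h
    apply P.sasakian.exists_of_coneOmegaZero_jay_eq_zero
    rw [← h1]
    exact h _
  · rintro ⟨a, b, rfl⟩ v
    rw [← P.dpi_dpiInv p v, h1]
    have h2 := P.sasakian.coneOmegaZero_radial p (P.dpiInv p v)
    have h3 := P.sasakian.coneOmegaZero_jay_radial p (P.dpiInv p v)
    rw [SasakianStructure.coneOmegaZero_apply] at h2 h3
    refine (P.sasakian.coneOmegaZero_apply p _ _).trans ?_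
    simp only [map_add, map_smul, add_apply, smul_apply, Prod.snd_add, Prod.smul_snd, smul_eq_mul]
    linear_combination a * h2 + b * h3

variable [CompactSpace M] [IsManifold 𝓘(ℂ, EuclideanSpace ℂ (Fin n)) ω V]

/-- All clauses follow by writing tangent vectors of the chart as images of vectors u of the cone.
The central fact is that the Levi form of log t is t⁻²(g - dt ⊗ dt - (dt∘J) ⊗ (dt∘J)), read off from
ω₀(u, Jv); the expression of t⁻²g as `hermForm` is a rearrangement of it. -/
theorem isPotential_of_isCoordinate {i : V} {x : Cone M} {σ : EuclideanSpace ℂ (Fin n) → Cone M}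
    (hx : P.π x ∈ (extChartAt 𝓘(ℝ, EuclideanSpace ℂ (Fin n)) i).source)
    (h : IsCoordinate P.sasakian (mulI n)
      (extChartAt 𝓘(ℝ, EuclideanSpace ℂ (Fin n)) i ∘ P.π) σ x) :
    P.IsPotential i (Real.log ∘ coneT ∘ σ) (extChartAt 𝓘(ℝ, EuclideanSpace ℂ (Fin n)) i (P.π x)) := by
  set e := extChartAt 𝓘(ℝ, EuclideanSpace ℂ (Fin n)) i
  set φ := Real.log ∘ coneT ∘ σ
  set F' := tder (coneModel m) 𝓘(ℝ, EuclideanSpace ℂ (Fin n)) (e ∘ P.π) x with hF'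
  set S := P.sasakian
  have hex : e.symm (e (P.π x)) = P.π x := e.left_inv hx
  have hF : ∀ u, tder 𝓘(ℝ, EuclideanSpace ℂ (Fin n)) 𝓘(ℝ, EuclideanSpace ℂ (Fin n))
      e.symm (e (P.π x)) (F' u) = P.dpi x u := fun u => by
    rw [hF', P.tder_chart_pi hx]
    exact tder_extChartAt_symm_comp hx _
  have hsurj : ∀ v, ∃ u, F' u = v := fun v => ⟨_, h.tder_tder_symm v⟩
  have hJ : ∀ u, mulI n (F' u) = F' (S.jay x u) := fun u => (h.holomorphic.self_of_nhds u).symm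
  have hT : ∀ᶠ x' in nhds x, chartVec P.euler i ((e ∘ P.π) x')
      = tder (coneModel m) 𝓘(ℝ, EuclideanSpace ℂ (Fin n)) (e ∘ P.π) x' (radial m x') := by
    filter_upwards [P.eventually_pi_mem hx] with x' hx'
    rw [P.tder_chart_pi hx', ← P.euler_pi]
    unfold chartVec
    change tder _ _ e (e.symm (e (P.π x'))) (P.euler (e.symm (e (P.π x')))) = _
    rw [e.left_inv hx']
  have hTx : chartVec P.euler i (e (P.π x)) = F' (radial m x) := hT.self_of_nhds
  obtain ⟨hT1, hT2⟩ := h.contDiffAt_radial_and_commute hT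
  have hD : ∀ u, fderiv ℝ φ (e (P.π x)) (F' u) = (coneT x)⁻¹ * u.2 := h.fderiv_log
  have hω : ∀ u v, S.coneOmegaZero x ![u, v] = fderiv ℝ (fderiv ℝ φ) (e (P.π x)) (F' u)
      (mulI n (F' v)) - fderiv ℝ (fderiv ℝ φ) (e (P.π x)) (F' v) (mulI n (F' u)) :=
    h.coneOmegaZero_eq
  have hφ : ContDiffAt ℝ ∞ φ (e (P.π x)) := h.contDiffAt_log
  -- By the sign convention d^cφ = dφ∘J, the Levi form is -½ ω₀(u, Jv).
  have hL : ∀ u v, levi (mulI n) φ (e (P.π x)) (F' u) (F' v) = (coneT x)⁻¹ ^ 2 *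
      (coneForm S.metric x u v - u.2 * v.2 - (S.jay x u).2 * (S.jay x v).2) := by
    intro u v
    have h1 := hω u (S.jay x v)
    rw [← hJ, mulI_mulI, map_neg, isSymm_fderiv_fderiv hφ (mulI n (F' v))] at h1
    have h2 := S.coneOmegaZero_jay x u v
    rw [levi_apply]
    linear_combination (-1 / 2 : ℝ) * h1.symm.trans h2
  refine ⟨h.contDiffAt_log, hT1, hT2, ?_, ?_, ?_, ?_, ?_, ?_⟩
  · rw [hTx]
    exact h.fderiv_log_radial
  · rw [hTx]
    exact h.fderiv_log_mul_radial
  · intro v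
    obtain ⟨u, rfl⟩ := hsurj v
    rw [hF, hex, hD, P.eta_pi]
  · ext v v'
    obtain ⟨u, rfl⟩ := hsurj v
    obtain ⟨u', rfl⟩ := hsurj v'
    rw [bilinComp_apply, hF, hF, hex, P.quotForm_pi, hermForm_apply, hL, hJ, hJ, hD, hD, hD, hD]
    ring
  · intro v
    obtain ⟨u, rfl⟩ := hsurj v
    rw [hL]
    exact mul_nonneg (sq_nonneg _) (S.coneForm_remainder_nonneg x u)
  · intro v
    obtain ⟨u, rfl⟩ := hsurj v
    intro h0 v'
    rw [hF]
    have h1 : S.coneOmegaZero x ![u, S.jay x u] = 0 := by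
      rw [S.coneOmegaZero_jay, ← hL, h0, mul_zero]
    have h2 := (P.omegaZero_eq_zero_iff x u).2 (S.exists_of_coneOmegaZero_jay_eq_zero x h1) v'
    rw [hex]
    exact h2

theorem exists_isPotential {i : V} {z : EuclideanSpace ℂ (Fin n)}
    (hz : z ∈ (extChartAt 𝓘(ℝ, EuclideanSpace ℂ (Fin n)) i).target) :
    ∃ φ, ∀ᶠ w in nhds z, P.IsPotential i φ w := by
  set e := extChartAt 𝓘(ℝ, EuclideanSpace ℂ (Fin n)) i
  set p := P.lift (e.symm z)
  have hp : P.π p ∈ e.source := by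
    rw [P.pi_lift]
    exact e.map_target hz
  have h := P.isCoordinate hp
  have hFp : (e ∘ P.π) p = z := by
    rw [Function.comp_apply, P.pi_lift, e.right_inv hz]
  have hc : Filter.Tendsto (P.chartLift i p) (nhds ((e ∘ P.π) p)) (nhds p) := by
    have := h.contMDiffAt_symm.continuousAt
    rwa [ContinuousAt, h.symm_apply] at this
  refine ⟨Real.log ∘ coneT ∘ P.chartLift i p, ?_⟩
  rw [← hFp]
  filter_upwards [h.eventually_symm, hc.eventually (P.eventually_pi_mem hp)] with w h1 h2
  have := P.isPotential_of_isCoordinate h2 h1.1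
  rwa [show e (P.π (P.chartLift i p w)) = w from h1.2] at this

end ConePresentation

end Charts

/-! ### The canonical foliation -/

section CanonicalFoliation

variable {n : ℕ} {V : Type*} [TopologicalSpace V] [ChartedSpace (EuclideanSpace ℂ (Fin n)) V]

theorem mem_ker_iff {α : Form 𝓘(ℝ, EuclideanSpace ℂ (Fin n)) V 2} {y : V}
    {u : EuclideanSpace ℂ (Fin n)} :
    u ∈ Form.ker 𝓘(ℝ, EuclideanSpace ℂ (Fin n)) α y
      ↔ ∀ v : EuclideanSpace ℂ (Fin n), α y ![u, v] = 0 := by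
  have h0 : u ∈ Form.ker 𝓘(ℝ, EuclideanSpace ℂ (Fin n)) α y
      ↔ (α y).toAlternatingMap.curryLeft u = 0 := Iff.rfl
  refine h0.trans ⟨fun h v => DFunLike.congr_fun h ![v], fun h => AlternatingMap.ext fun w => ?_⟩
  have hw : w = ![w 0] := by
    ext1 i
    fin_cases i
    rfl
  rw [hw]
  exact h (w 0)

variable {m : ℕ} {M : Type*} [TopologicalSpace M] [ChartedSpace (EuclideanSpace ℝ (Fin m)) M]
  [IsManifold (𝓡 m) ∞ M] [CompactSpace M] [IsManifold 𝓘(ℝ, EuclideanSpace ℂ (Fin n)) ∞ V]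

namespace ConePresentation

variable (P : ConePresentation m M n V)

theorem mem_ker_omegaZero_iff {y : V} {u : EuclideanSpace ℂ (Fin n)} :
    u ∈ Form.ker 𝓘(ℝ, EuclideanSpace ℂ (Fin n)) P.omegaZero y
      ↔ ∃ a b : ℝ, u = a • P.euler y + b • mulI n (P.euler y) := by
  obtain ⟨p, rfl⟩ := P.π_surjective y
  refine mem_ker_iff.trans ?_
  have h1 := P.omegaZero_eq_zero_iff p (P.dpiInv p u)
  rw [P.dpi_dpiInv] at h1
  refine h1.trans (exists_congr fun a => exists_congr fun b => ?_)
  rw [P.euler_pi, ← P.dpi_jay]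
  constructor
  · intro h
    rw [← P.dpi_dpiInv p u, h, map_add, map_smul, map_smul]
  · rintro rfl
    rw [← map_smul, ← map_smul, ← map_add, P.dpiInv_dpi]

theorem quotForm_symm (y : V) (u v : EuclideanSpace ℂ (Fin n)) :
    P.quotForm y u v = P.quotForm y v u := by
  obtain ⟨p, rfl⟩ := P.π_surjective y
  rw [← P.dpi_dpiInv p u, ← P.dpi_dpiInv p v, P.quotForm_pi, P.quotForm_pi, coneForm_symm]

theorem quotForm_pos (y : V) {u : EuclideanSpace ℂ (Fin n)} (hu : u ≠ 0) :
    0 < P.quotForm y u u := by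
  obtain ⟨p, rfl⟩ := P.π_surjective y
  have h1 : P.dpiInv p u ≠ 0 := fun h => hu (by rw [← P.dpi_dpiInv p u, h, map_zero])
  rw [← P.dpi_dpiInv p u, P.quotForm_pi]
  have := coneT_pos p
  exact mul_pos (by positivity) (coneForm_pos P.sasakian.metric p h1)

/-- The metric on the quotient, in the preferred chart around `i`. -/
def chartForm (i : V) (w : EuclideanSpace ℂ (Fin n)) :
    EuclideanSpace ℂ (Fin n) →L[ℝ] EuclideanSpace ℂ (Fin n) →L[ℝ] ℝ :=
  bilinComp (P.quotForm ((extChartAt 𝓘(ℝ, EuclideanSpace ℂ (Fin n)) i).symm w))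
    (tder 𝓘(ℝ, EuclideanSpace ℂ (Fin n)) 𝓘(ℝ, EuclideanSpace ℂ (Fin n))
      (extChartAt 𝓘(ℝ, EuclideanSpace ℂ (Fin n)) i).symm w)

/-- The Riemannian density of the quotient. -/
def density (i : V) (w : EuclideanSpace ℂ (Fin n)) : ℝ := √(gramDet (P.chartForm i w))

theorem gramDet_chartForm_pos {i : V} {w : EuclideanSpace ℂ (Fin n)}
    (hw : w ∈ (extChartAt 𝓘(ℝ, EuclideanSpace ℂ (Fin n)) i).target) :
    0 < gramDet (P.chartForm i w) := by
  refine gramDet_pos (fun u v => P.quotForm_symm _ _ _) fun u hu => P.quotForm_pos _ fun h => hu ?_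
  exact (tder_extChartAt_comp_symm hw u).symm.trans ((congrArg _ h).trans (map_zero _))

variable [IsManifold 𝓘(ℂ, EuclideanSpace ℂ (Fin n)) ω V]

/-- `quotForm` is defined pointwise through choices of lifts. Its smoothness comes from the local
equality with `hermForm` of a smooth potential. -/
theorem isChartDensity : IsChartDensity P.density where
  pos i z hz := Real.sqrt_pos.2 (P.gramDet_chartForm_pos hz)
  contDiffAt i z hz := by
    obtain ⟨φ, hφ⟩ := P.exists_isPotential hz
    refine contDiffAt_sqrt_gramDet ?_ (P.gramDet_chartForm_pos hz)
    refine ((contDiffAt_hermForm (J₀ := mulI n) hφ.self_of_nhds.contDiffAt).of_le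
      (by simp)).congr_of_eventuallyEq ?_
    filter_upwards [hφ] with w hw using hw.quotForm_eq
  coordChange i j y hi hj := by
    set ei := extChartAt 𝓘(ℝ, EuclideanSpace ℂ (Fin n)) i
    set ej := extChartAt 𝓘(ℝ, EuclideanSpace ℂ (Fin n)) j
    have hiy : ei.symm (ei y) = y := ei.left_inv hi
    have h1 : ∀ v, fderiv ℝ (ej ∘ ei.symm) (ei y) v
        = tder 𝓘(ℝ, EuclideanSpace ℂ (Fin n)) 𝓘(ℝ, EuclideanSpace ℂ (Fin n)) ej y
          (tder 𝓘(ℝ, EuclideanSpace ℂ (Fin n)) 𝓘(ℝ, EuclideanSpace ℂ (Fin n)) ei.symm (ei y) v) := by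
      intro v
      have hm : MDifferentiableAt 𝓘(ℝ, EuclideanSpace ℂ (Fin n)) 𝓘(ℝ, EuclideanSpace ℂ (Fin n)) ej
          (ei.symm (ei y)) := by
        rw [hiy]
        exact (contMDiffAt_extChartAt_of_mem hj).mdifferentiableAt (by simp)
      have := tder_comp_apply (f := ei.symm) (g := ej) (x := ei y) hm
        ((contMDiffAt_extChartAt_symm (ei.map_source hi)).mdifferentiableAt (by simp)) v
      rw [tder_eq_fderiv, hiy] at this
      exact this
    have h2 : P.chartForm i (ei y)
        = bilinComp (P.chartForm j (ej y)) (fderiv ℝ (ej ∘ ei.symm) (ei y)) := by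
      ext u v
      unfold chartForm
      change P.quotForm (ei.symm (ei y)) _ _ = P.quotForm (ej.symm (ej y))
        (tder _ _ ej.symm (ej y) (fderiv ℝ (ej ∘ ei.symm) (ei y) u))
        (tder _ _ ej.symm (ej y) (fderiv ℝ (ej ∘ ei.symm) (ei y) v))
      rw [h1, h1, tder_extChartAt_symm_comp hj, tder_extChartAt_symm_comp hj, hiy,
        ej.left_inv hj]
      rfl
    unfold density
    rw [h2, gramDet_bilinComp, Real.sqrt_mul (sq_nonneg _), Real.sqrt_sq_eq_abs]

/-- A holomorphic field with dφ(X) constant is an infinitesimal isometry of the quotient metric, and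
infinitesimal isometries preserve the Riemannian density. -/
theorem isDivFree_of_fderiv_eq {X : V → EuclideanSpace ℂ (Fin n)} {c : ℝ}
    (hX : ∀ i φ, ∀ w ∈ (extChartAt 𝓘(ℝ, EuclideanSpace ℂ (Fin n)) i).target, P.IsPotential i φ w →
      ContDiffAt ℝ ∞ (chartVec X i) w
        ∧ (∀ v, fderiv ℝ (chartVec X i) w (mulI n v) = mulI n (fderiv ℝ (chartVec X i) w v))
        ∧ fderiv ℝ φ w (chartVec X i w) = c) : IsDivFree P.density X where
  contDiffAt i z hz := by
    obtain ⟨φ, hφ⟩ := P.exists_isPotential hz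
    exact (hX i φ z hz hφ.self_of_nhds).1.of_le (by simp)
  div_eq_zero i z hz := by
    obtain ⟨φ, hφ⟩ := P.exists_isPotential hz
    have h1 : ∀ᶠ w in nhds z, P.IsPotential i φ w ∧ ContDiffAt ℝ ∞ (chartVec X i) w
        ∧ (∀ v, fderiv ℝ (chartVec X i) w (mulI n v) = mulI n (fderiv ℝ (chartVec X i) w v))
        ∧ fderiv ℝ φ w (chartVec X i w) = c := by
      filter_upwards [hφ, extChartAt_target_mem_nhds_of_mem hz] with w hw hwt
      exact ⟨hw, hX i φ w hwt hw⟩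
    have h2 : P.chartForm i =ᶠ[nhds z] hermForm (mulI n) φ := by
      filter_upwards [hφ] with w hw using hw.quotForm_eq
    have h3 : P.density i =ᶠ[nhds z] fun w => √(gramDet (hermForm (mulI n) φ w)) := by
      filter_upwards [h2] with w hw
      rw [density, hw]
    rw [h3.fderiv_eq, h3.self_of_nhds]
    refine fderiv_sqrt_gramDet ((contDiffAt_hermForm hφ.self_of_nhds.contDiffAt).differentiableAt
      (by simp)) (by rw [← h2.self_of_nhds]; exact P.gramDet_chartForm_pos hz) fun u v => ?_
    exact fderiv_hermForm_apply (c := c) (h1.mono fun w h => h.1.contDiffAt)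
      (h1.mono fun w h => h.2.1) (h1.mono fun w h => h.2.2.2) mulI_mulI
      (h1.mono fun w h => h.2.2.1) u v

theorem chartVec_mulI_eventuallyEq (X : V → EuclideanSpace ℂ (Fin n)) {i : V}
    {w : EuclideanSpace ℂ (Fin n)}
    (hw : w ∈ (extChartAt 𝓘(ℝ, EuclideanSpace ℂ (Fin n)) i).target) :
    chartVec (fun y => mulI n (X y)) i =ᶠ[nhds w] fun z => mulI n (chartVec X i z) := by
  filter_upwards [extChartAt_target_mem_nhds_of_mem hw] with z hz
  exact tder_extChartAt_smul ((extChartAt 𝓘(ℝ, EuclideanSpace ℂ (Fin n)) i).map_target hz)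
    Complex.I _

theorem isDivFree_euler : IsDivFree P.density P.euler :=
  P.isDivFree_of_fderiv_eq (c := 1) fun _ _ _ _ h =>
    ⟨h.contDiffAt_euler, h.fderiv_euler_mul, h.fderiv_euler⟩

theorem isDivFree_mulI_euler : IsDivFree P.density fun y => mulI n (P.euler y) := by
  refine P.isDivFree_of_fderiv_eq (c := 0) fun i φ w hw h => ?_
  have h1 := chartVec_mulI_eventuallyEq P.euler hw
  have h2 : HasFDerivAt (fun z => mulI n (chartVec P.euler i z)) _ w :=
    (mulI n).hasFDerivAt.comp w (h.contDiffAt_euler.differentiableAt (by simp)).hasFDerivAt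
  refine ⟨((mulI n).contDiff.contDiffAt.comp w h.contDiffAt_euler).congr_of_eventuallyEq h1, ?_, ?_⟩
  · rw [h1.fderiv_eq, h2.fderiv]
    intro v
    exact congrArg (mulI n) (h.fderiv_euler_mul v)
  · rw [h1.self_of_nhds]
    exact h.fderiv_mul_euler

/-! ### Comparison of two presentations of the same manifold -/

section TwoPresentations

variable {m' : ℕ} {M' : Type*} [TopologicalSpace M'] [ChartedSpace (EuclideanSpace ℝ (Fin m')) M']
  [IsManifold (𝓡 m') ∞ M'] [CompactSpace M'] (P' : ConePresentation m' M' n V)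

theorem eta_symm {X : V → EuclideanSpace ℂ (Fin n)} {i : V} {w : EuclideanSpace ℂ (Fin n)}
    {φ : EuclideanSpace ℂ (Fin n) → ℝ}
    (hw : w ∈ (extChartAt 𝓘(ℝ, EuclideanSpace ℂ (Fin n)) i).target) (h : P.IsPotential i φ w) :
    P.eta ((extChartAt 𝓘(ℝ, EuclideanSpace ℂ (Fin n)) i).symm w)
      (X ((extChartAt 𝓘(ℝ, EuclideanSpace ℂ (Fin n)) i).symm w))
      = fderiv ℝ φ w (chartVec X i w) := by
  rw [← h.eta_eq]
  congr 1
  have h2 := tder_extChartAt_symm_comp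
    ((extChartAt 𝓘(ℝ, EuclideanSpace ℂ (Fin n)) i).map_target hw)
    (X ((extChartAt 𝓘(ℝ, EuclideanSpace ℂ (Fin n)) i).symm w))
  rw [(extChartAt 𝓘(ℝ, EuclideanSpace ℂ (Fin n)) i).right_inv hw] at h2
  exact h2.symm

theorem eta_comp_symm_eventuallyEq {X : V → EuclideanSpace ℂ (Fin n)} {i : V}
    {w : EuclideanSpace ℂ (Fin n)} {φ : EuclideanSpace ℂ (Fin n) → ℝ}
    (hw : w ∈ (extChartAt 𝓘(ℝ, EuclideanSpace ℂ (Fin n)) i).target)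
    (h : ∀ᶠ z in nhds w, P.IsPotential i φ z) :
    (fun y => P.eta y (X y)) ∘ (extChartAt 𝓘(ℝ, EuclideanSpace ℂ (Fin n)) i).symm
      =ᶠ[nhds w] fun z => fderiv ℝ φ z (chartVec X i z) := by
  filter_upwards [h, extChartAt_target_mem_nhds_of_mem hw] with z hz hzt
  exact P.eta_symm hzt hz

theorem contMDiff_eta_apply {X : V → EuclideanSpace ℂ (Fin n)}
    (hX : ∀ i, ∀ w ∈ (extChartAt 𝓘(ℝ, EuclideanSpace ℂ (Fin n)) i).target,
      ContDiffAt ℝ ∞ (chartVec X i) w) :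
    ContMDiff 𝓘(ℝ, EuclideanSpace ℂ (Fin n)) 𝓘(ℝ, ℝ) ∞ fun y => P.eta y (X y) := by
  intro y
  set e := extChartAt 𝓘(ℝ, EuclideanSpace ℂ (Fin n)) y
  have hz : e y ∈ e.target := mem_extChartAt_target y
  obtain ⟨φ, hφ⟩ := P.exists_isPotential hz
  have h1 : ContDiffAt ℝ ∞ (fun z => fderiv ℝ φ z (chartVec X y z)) (e y) :=
    (hφ.self_of_nhds.contDiffAt.fderiv_right (by simp)).clm_apply (hX y _ hz)
  have h2 := ContMDiffAt.comp y (h1.congr_of_eventuallyEq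
    (P.eta_comp_symm_eventuallyEq (X := X) hz hφ)).contMDiffAt
    (contMDiffAt_extChartAt (I := 𝓘(ℝ, EuclideanSpace ℂ (Fin n))) (n := ∞) (x := y))
  refine h2.congr_of_eventuallyEq ?_
  filter_upwards [(isOpen_extChartAt_source (I := 𝓘(ℝ, EuclideanSpace ℂ (Fin n))) y).mem_nhds
    (mem_extChartAt_source y)] with x hx
  change _ = P.eta (e.symm (e x)) (X (e.symm (e x)))
  rw [e.left_inv hx]

theorem contDiffAt_chartVec_euler (i : V) {w : EuclideanSpace ℂ (Fin n)}
    (hw : w ∈ (extChartAt 𝓘(ℝ, EuclideanSpace ℂ (Fin n)) i).target) :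
    ContDiffAt ℝ ∞ (chartVec P.euler i) w := by
  obtain ⟨φ, hφ⟩ := P.exists_isPotential hw
  exact hφ.self_of_nhds.contDiffAt_euler

/-- The Levi form of the potential of one presentation, evaluated on the vector field `t ∂ₜ` of
another, as a sum of derivatives along divergence-free vector fields. -/
theorem lieD_add_lieD_eq_levi {i : V} {z : EuclideanSpace ℂ (Fin n)}
    {φ : EuclideanSpace ℂ (Fin n) → ℝ}
    (hz : z ∈ (extChartAt 𝓘(ℝ, EuclideanSpace ℂ (Fin n)) i).target)
    (hφ : ∀ᶠ w in nhds z, P'.IsPotential i φ w) :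
    lieD P.euler (fun y => P'.eta y (P.euler y))
        ((extChartAt 𝓘(ℝ, EuclideanSpace ℂ (Fin n)) i).symm z)
      + lieD (fun y => mulI n (P.euler y)) (fun y => P'.eta y (mulI n (P.euler y)))
        ((extChartAt 𝓘(ℝ, EuclideanSpace ℂ (Fin n)) i).symm z)
      = 2 * levi (mulI n) φ z (chartVec P.euler i z) (chartVec P.euler i z) := by
  have h1 := chartVec_mulI_eventuallyEq P.euler hz
  have h2 : (fun y => P'.eta y (mulI n (P.euler y))) ∘
      (extChartAt 𝓘(ℝ, EuclideanSpace ℂ (Fin n)) i).symm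
      =ᶠ[nhds z] fun z => fderiv ℝ φ z (mulI n (chartVec P.euler i z)) := by
    filter_upwards [P'.eta_comp_symm_eventuallyEq (X := fun y => mulI n (P.euler y)) hz hφ, h1]
      with w a1 a2
    rw [a1, a2]
  rw [lieD_symm _ (P'.contMDiff_eta_apply fun i w hw => P.contDiffAt_chartVec_euler i hw) hz,
    lieD_symm _ (P'.contMDiff_eta_apply (X := fun y => mulI n (P.euler y)) fun i w hw =>
      ((mulI n).contDiff.contDiffAt.comp w (P.contDiffAt_chartVec_euler i hw)).congr_of_eventuallyEq
        (chartVec_mulI_eventuallyEq P.euler hw)) hz,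
    (P'.eta_comp_symm_eventuallyEq (X := P.euler) hz hφ).fderiv_eq, h2.fderiv_eq, h1.self_of_nhds]
  obtain ⟨ψ, hψ⟩ := P.exists_isPotential hz
  exact fderiv_add_fderiv_eq_levi hφ.self_of_nhds.contDiffAt hψ.self_of_nhds.contDiffAt_euler
    mulI_mulI hψ.self_of_nhds.fderiv_euler_mul

variable [CompactSpace V] [T2Space V]

/-- The function 2L'(ξ, ξ) is nonnegative and is a sum of derivatives along ξ and iξ, which are
divergence-free for the density of `P`. It therefore vanishes identically, and a null vector of the
semidefinite form L' lies in ker ω₀'. -/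
theorem euler_mem_ker (y : V) :
    P.euler y ∈ Form.ker 𝓘(ℝ, EuclideanSpace ℂ (Fin n)) P'.omegaZero y := by
  have hlevi : ∀ y : V, ∃ φ, P'.IsPotential y φ (extChartAt 𝓘(ℝ, EuclideanSpace ℂ (Fin n)) y y) ∧
      lieD P.euler (fun y => P'.eta y (P.euler y)) y
        + lieD (fun y => mulI n (P.euler y)) (fun y => P'.eta y (mulI n (P.euler y))) y
        = 2 * levi (mulI n) φ (extChartAt 𝓘(ℝ, EuclideanSpace ℂ (Fin n)) y y) (P.euler y)
          (P.euler y) := by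
    intro y
    have hz := mem_extChartAt_target (I := 𝓘(ℝ, EuclideanSpace ℂ (Fin n))) y
    obtain ⟨φ, hφ⟩ := P'.exists_isPotential hz
    refine ⟨φ, hφ.self_of_nhds, ?_⟩
    have h1 := P.lieD_add_lieD_eq_levi P' hz hφ
    have h2 : chartVec P.euler y (extChartAt 𝓘(ℝ, EuclideanSpace ℂ (Fin n)) y y) = P.euler y := by
      unfold chartVec
      rw [extChartAt_to_inv, tder_extChartAt_self]
    rw [h2, extChartAt_to_inv] at h1
    exact h1
  have h0 := eq_zero_of_eq_lieD_add_lieD P.isChartDensity P.isDivFree_euler P.isDivFree_mulI_euler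
    (P'.contMDiff_eta_apply fun i w hw => P.contDiffAt_chartVec_euler i hw)
    (P'.contMDiff_eta_apply (X := fun y => mulI n (P.euler y)) fun i w hw =>
      ((mulI n).contDiff.contDiffAt.comp w (P.contDiffAt_chartVec_euler i hw)).congr_of_eventuallyEq
        (chartVec_mulI_eventuallyEq P.euler hw))
    (fun _ => rfl) (fun y => by
      obtain ⟨φ, h1, h2⟩ := hlevi y
      rw [h2]
      exact mul_nonneg zero_le_two (h1.levi_nonneg _)) y
  obtain ⟨φ, h1, h2⟩ := hlevi y
  rw [h0] at h2
  refine mem_ker_iff.2 fun v => ?_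
  have h3 := h1.omegaZero_eq_zero (P.euler y) (by linarith) v
  rw [tder_extChartAt_symm_self, extChartAt_to_inv] at h3
  exact h3

theorem ker_omegaZero_le (y : V) : Form.ker 𝓘(ℝ, EuclideanSpace ℂ (Fin n)) P.omegaZero y
    ≤ Form.ker 𝓘(ℝ, EuclideanSpace ℂ (Fin n)) P'.omegaZero y := by
  intro u hu
  obtain ⟨a, b, rfl⟩ := P.mem_ker_omegaZero_iff.1 hu
  obtain ⟨a', b', h⟩ := P'.mem_ker_omegaZero_iff.1 (P.euler_mem_ker P' y)
  -- Both kernels consist of complex multiples of the respective `euler` field, and the coefficients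
  -- multiply as (a + ib)(a' + ib').
  refine P'.mem_ker_omegaZero_iff.2 ⟨a * a' - b * b', a * b' + b * a', ?_⟩
  rw [h, map_add, map_smul, map_smul, mulI_mulI]
  module

theorem ker_omegaZero_eq (y : V) : Form.ker 𝓘(ℝ, EuclideanSpace ℂ (Fin n)) P.omegaZero y
    = Form.ker 𝓘(ℝ, EuclideanSpace ℂ (Fin n)) P'.omegaZero y :=
  le_antisymm (P.ker_omegaZero_le P' y) (P'.ker_omegaZero_le P y)

end TwoPresentations

end ConePresentation

end CanonicalFoliation
end Vaisman

end

/-- The canonical foliation `ker ω₀` of a compact Vaisman manifold `V` does not depend on the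
presentation `V = C(M)/⟨q⟩`. -/
theorem mainTheorem5
    (n : ℕ) (V : Type*) [TopologicalSpace V] [T2Space V] [CompactSpace V]
    [ChartedSpace (EuclideanSpace ℂ (Fin n)) V]
    [IsManifold 𝓘(ℂ, EuclideanSpace ℂ (Fin n)) ω V]
    (m : ℕ) (M : Type*) [TopologicalSpace M] [T2Space M] [CompactSpace M]
    [ChartedSpace (EuclideanSpace ℝ (Fin m)) M] [IsManifold (𝓡 m) ∞ M]
    (m' : ℕ) (M' : Type*) [TopologicalSpace M'] [T2Space M'] [CompactSpace M']
    [ChartedSpace (EuclideanSpace ℝ (Fin m')) M'] [IsManifold (𝓡 m') ∞ M']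
    (P : Vaisman.ConePresentation m M n V) (P' : Vaisman.ConePresentation m' M' n V) :
    (∃! α, P.IsOmegaZero α) ∧ (∃! α', P'.IsOmegaZero α') ∧
      ∀ α α', P.IsOmegaZero α → P'.IsOmegaZero α' →
        ∀ y : V, Vaisman.Form.ker 𝓘(ℝ, EuclideanSpace ℂ (Fin n)) α y
          = Vaisman.Form.ker 𝓘(ℝ, EuclideanSpace ℂ (Fin n)) α' y := by
  have : IsManifold 𝓘(ℝ, EuclideanSpace ℂ (Fin n)) ∞ V :=
    Vaisman.isManifold_real (EuclideanSpace ℂ (Fin n)) V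
  refine ⟨P.existsUnique_isOmegaZero, P'.existsUnique_isOmegaZero, fun α α' h h' y => ?_⟩
  rw [h.eq_omegaZero, h'.eq_omegaZero]
  exact P.ker_omegaZero_eq P' y
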